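/- Let $p>1$ and consider the one-dimensional profile equation $$-f''''-\tfrac14\,y f'-\tfrac1{p-1}f+|f|^{p-1}f=0. \qquad (1)$$ Fix a sign $\sigma\in\{1,-1\}$. For $y_0<b$, a *blow-up solution at $y_0$* is a $C^4$ solution $f$ of (1) on $(y_0,b)$ such that, as $y\to y_0^+$, $\sigma f(y)\to+\infty$ and $f''''=|f|^{p-1}f\,(1+o(1))$. Put $\Phi(m)=m(m-1)(m-2)(m-3)$ and $f_0(y)=A_0(y-y_0)^{-4/(p-1)}$ with $A_0>0$, $A_0^{p-1}=\Phi(-\tfrac4{p-1})$. For $y_1\in\mathbb R$ let $D(y_1)\subset\mathbb R^4$ be the set of the Cauchy data $(f,f',f'',f''')(y_1)$ of all blow-up solutions $f$ at points $y_0<y_1$ that are defined on an interval $(y_0,b)$ with $b>y_1$; let $D(y_0,y_1)\subset D(y_1)$ be the subset obtained for a given $y_0$. The set of blow-up solutions is four-dimensional, in the following sense. 1. Two solutions of (1) on an open interval that have the same Cauchy data at one of its points coincide on that interval. For every $y_1$ the set $D(y_1)$ is a non-empty open subset of $\mathbb R^4$, and there is a $C^1$ function $T$ on $D(y_1)$ with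 nowhere vanishing differential such that $D(y_0,y_1)=\{z\in D(y_1): T(z)=y_0\}$ for every $y_0\in\mathbb R$. Thus the blow-up point $y_0$ is one of the four parameters, and for fixed $y_0$ there remains an embedded three-dimensional $C^1$ manifold (possibly empty for some pairs $y_0,y_1$). For every $y_0\in\mathbb R$ there is a blow-up solution at $y_0$. 2. For fixed $y_0$, this manifold is the stable manifold of the explicit solution $\sigma f_0$: a solution $f$ of (1) on $(y_0,b)$ is a blow-up solution at $y_0$ if and only if $f^{(k)}(y)/f_0^{(k)}(y)\to\sigma$ as $y\to y_0^+$ for $k=0,1,2,3$. 3. For $m\in\mathbb C$, the power $Y=(y-y_0)^m$ solves the linearized (Euler type) equation $Y''''=p\,f_0^{p-1}Y$ on $y>y_0$ if and only if $\Phi(m)=p\,\Phi(-\tfrac4{p-1})$. The roots of this equation are a real $m_+>3$, a real $m_-<-\tfrac4{p-1}$, and two complex numbers $\tfrac32\pm i\beta$ with $\beta>0$; so exactly three of them have real part larger than $-\tfrac4{p-1}$. -/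

import Mathlib

open Set Filter Topology

noncomputable section

/-- `f` is a classical solution on the open interval `(a, b)` of the profile equation
`-f'''' - (1/4) y f' - f/(p-1) + |f|^(p-1) f = 0`. -/
def IsProfileSolution (p a b : ℝ) (f : ℝ → ℝ) : Prop :=
  ContDiffOn ℝ 4 f (Ioo a b) ∧
    ∀ y ∈ Ioo a b,
      -(iteratedDeriv 4 f y) - (1 / 4) * y * deriv f y - f y / (p - 1)
        + |f y| ^ (p - 1) * f y = 0

/-- `f` is a solution on `(y₀, b)` that blows up at the finite point `y₀` from the right, without
oscillation: `f → +∞` (for `σ = 1`) or `f → -∞` (for `σ = -1`) as `y → y₀⁺`, the principal part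
of the equation being `f'''' = |f|^(p-1) f (1 + o(1))`. -/
def IsBlowUpSolution (p σ y₀ b : ℝ) (f : ℝ → ℝ) : Prop :=
  IsProfileSolution p y₀ b f ∧
    Tendsto (fun y => σ * f y) (𝓝[>] y₀) atTop ∧
    Tendsto (fun y => iteratedDeriv 4 f y / (|f y| ^ (p - 1) * f y)) (𝓝[>] y₀) (𝓝 1)

/-- The Cauchy data `(f, f', f'', f''')` of `f` at `y`. -/
def jet (f : ℝ → ℝ) (y : ℝ) : Fin 4 → ℝ := fun k => iteratedDeriv (k : ℕ) f y

/-- Cauchy data at `y₁` of the blow-up solutions with the prescribed blow-up point `y₀ < y₁`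
whose interval of existence reaches beyond `y₁`. -/
def blowUpFibre (p σ y₀ y₁ : ℝ) : Set (Fin 4 → ℝ) :=
  {z | ∃ b f, y₁ ∈ Ioo y₀ b ∧ IsBlowUpSolution p σ y₀ b f ∧ jet f y₁ = z}

/-- Cauchy data at `y₁` of all blow-up solutions, with an arbitrary blow-up point `y₀ < y₁`. -/
def blowUpData (p σ y₁ : ℝ) : Set (Fin 4 → ℝ) := ⋃ y₀ : ℝ, blowUpFibre p σ y₀ y₁

/-- `Φ(m) = m (m - 1) (m - 2) (m - 3)`. -/
def eulerPhi {R : Type*} [CommRing R] (m : R) : R := m * (m - 1) * (m - 2) * (m - 3)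

/-- The explicit solution `A₀ (y - y₀)^(-4/(p-1))` of `f'''' = |f|^(p-1) f` on `y > y₀`, where
`A₀ > 0` and `A₀^(p-1) = Φ(-4/(p-1))`. -/
def explicitBlowUp (p y₀ : ℝ) (y : ℝ) : ℝ :=
  (eulerPhi (-4 / (p - 1))) ^ (1 / (p - 1)) * (y - y₀) ^ (-4 / (p - 1))

/-- The power `Y = (y - y₀)^m` solves, on `y > y₀`, the Euler type equation `Y'''' = p f₀^(p-1) Y`,
the linearization of `f'''' = |f|^(p-1) f` about the explicit solution `f₀`. -/
def IsEulerMode (p y₀ : ℝ) (m : ℂ) : Prop :=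
  ∀ y : ℝ, y₀ < y →
    iteratedDeriv 4 (fun x : ℝ => ((x - y₀ : ℝ) : ℂ) ^ m) y
      = ((p * explicitBlowUp p y₀ y ^ (p - 1) : ℝ) : ℂ) * ((y - y₀ : ℝ) : ℂ) ^ m

end

/-!
Write `k = (p - 1) / 4`. Near a blow-up point the jet `(f, f', f'', f''')` of a blow-up solution
has alternating signs, and the scale-invariant quotients `P = f f''/f'²`, `Q = f f'''/(f' f'')`,
`S = f^(p+1)/(f' f''')` satisfy, with `log f` as independent variable, a Lotka–Volterra system that
is perturbed by `δ = f''''/f^p - 1 → 0`: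
`P' = P (1 + Q - 2P)`, `Q' = Q (S (1 + δ) + 1 - Q - P)`, `S' = S (2 + 4k - S (1 + δ) - P)`.
Its positive equilibrium `(1 + k, 1 + 2k, 1 + 3k)` has the Lyapunov function
`∑ (X - c - c log (X/c))`, and therefore attracts every positive solution
(`tendsto_lotkaVolterra`). Integrating the limits of the quotients identifies the blow-up solutions
with the solutions asymptotic to the explicit one (`IsBlowUpCurve.tendsto_ratio`,
`isBlowUpCurve_of_tendsto_ratio`).

For the dependence on the data, take `w = ` the logarithms of `P/(1 + k)`, `Q/(1 + 2k)`,
`S/(1 + 3k)` together with `r = f^(-k)` and the position `y`. In these variables the equation is an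
autonomous `C¹` system for which the blow-up at `y₀` has become convergence to the equilibrium
`(0, 0, y₀)`, and the line of these equilibria attracts a whole neighbourhood: `w` decays since the
linear part `logLinear` is dissipative, and `r` decays like `exp (-k s)`. So the blow-up point is
the limit of `y` along the solution. Every solution that starts near the line solves an integral
equation in the Banach space of bounded curves, the implicit function theorem makes the solution a
`C¹` function of its initial value, and the limit of `y` is a `C¹` function of the initial value
which on the line is the identity (`exists_logCurve_family`). This proves openness and regularity
near the blow-up point. The local flow carries both along the orbit
(`IsJetCurve.exists_isRegularBlowUp_transport`). Since the blow-up point is constant along orbits,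
and orbits are transverse to the slices `y = y₁`, its differential does not vanish on a slice
(`exists_contDiffAt_blowUpPoint`). Existence of blow-up solutions comes from the points of small
`r > 0` near the line.

The characteristic equation is a quadratic equation in `(m - 3/2)²`, because `Φ` is symmetric about
`3/2` (`exists_eulerRoots`). The sign `σ = -1` is reduced to `σ = 1` by `f ↦ -f`.
-/

/-! ### Superposition operators and integral equations on spaces of bounded continuous curves -/

noncomputable section BoundedCurves

open BoundedContinuousFunction

section Continuity

variable {E F : Type*} [NormedAddCommGroup E] [NormedAddCommGroup F]

/-- The superposition (Nemytskii) operator `u ↦ N ∘ u` on bounded continuous curves in a proper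
space; `N ∘ u` is bounded because `u` takes values in a compact ball. -/
def superposition [ProperSpace E] (N : E → F) (hN : Continuous N) (u : ℝ →ᵇ E) : ℝ →ᵇ F :=
  ⟨⟨fun s => N (u s), hN.comp u.continuous⟩, by
    obtain ⟨C, hC⟩ := ((isCompact_closedBall (0 : E) ‖u‖).image hN).isBounded.exists_norm_le
    refine ⟨C + C, fun x y => (dist_le_norm_add_norm _ _).trans (add_le_add ?_ ?_)⟩
    · exact hC _ ⟨u x, by simpa using u.norm_coe_le_norm x, rfl⟩
    · exact hC _ ⟨u y, by simpa using u.norm_coe_le_norm y, rfl⟩⟩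

@[simp]
theorem superposition_apply [ProperSpace E] (N : E → F) (hN : Continuous N) (u : ℝ →ᵇ E) (s : ℝ) :
    superposition N hN u s = N (u s) := rfl

/-- A continuous map is uniformly continuous along a bounded curve. -/
theorem exists_dist_lt_of_norm_le [ProperSpace E] {N : E → F} (hN : Continuous N) (R : ℝ) {ε : ℝ}
    (hε : 0 < ε) :
    ∃ δ > 0, ∀ x y : E, ‖x‖ ≤ R → ‖y - x‖ < δ → ‖N y - N x‖ < ε := by
  have hu := (isCompact_closedBall (0 : E) (R + 1)).uniformContinuousOn_of_continuous
    hN.continuousOn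
  obtain ⟨δ, hδ, h⟩ := Metric.uniformContinuousOn_iff.1 hu ε hε
  refine ⟨min δ 1, by positivity, fun x y hx hy => ?_⟩
  have hy1 : ‖y‖ ≤ R + 1 := by
    have := norm_add_le (y - x) x
    rw [sub_add_cancel] at this
    linarith [min_le_right δ 1]
  rw [← dist_eq_norm]
  refine h y (by simpa using hy1) x (by simp; linarith) ?_
  rw [dist_eq_norm]
  exact hy.trans_le (min_le_left _ _)

theorem continuous_superposition [ProperSpace E] (N : E → F) (hN : Continuous N) :
    Continuous (superposition N hN) := by
  rw [Metric.continuous_iff]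
  intro u ε hε
  obtain ⟨δ, hδ, h⟩ := exists_dist_lt_of_norm_le hN ‖u‖ (half_pos hε)
  refine ⟨δ, hδ, fun v hv => lt_of_le_of_lt ?_ (half_lt_self hε)⟩
  rw [dist_le (half_pos hε).le]
  intro s
  rw [dist_eq_norm]
  refine (h (u s) (v s) (u.norm_coe_le_norm s) ?_).le
  rw [← dist_eq_norm]
  exact (dist_coe_le_dist s).trans_lt hv

end Continuity

variable {E F G X : Type*}
  [NormedAddCommGroup E] [NormedSpace ℝ E] [NormedAddCommGroup F] [NormedSpace ℝ F]
  [NormedAddCommGroup G] [NormedSpace ℝ G] [NormedAddCommGroup X] [NormedSpace ℝ X]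

theorem norm_clm_apply_le (B : ℝ →ᵇ (E →L[ℝ] F)) (u : ℝ →ᵇ E) (s : ℝ) :
    ‖B s (u s)‖ ≤ ‖B‖ * ‖u‖ :=
  ((B s).le_opNorm _).trans (by gcongr <;> apply norm_coe_le_norm)

/-- Pointwise application of a bounded curve of operators to a bounded curve of vectors. -/
def pointwiseApply : (ℝ →ᵇ (E →L[ℝ] F)) →L[ℝ] (ℝ →ᵇ E) →L[ℝ] (ℝ →ᵇ F) :=
  LinearMap.mkContinuous₂
    (LinearMap.mk₂ ℝ
      (fun (B : ℝ →ᵇ (E →L[ℝ] F)) (u : ℝ →ᵇ E) =>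
        BoundedContinuousFunction.ofNormedAddCommGroup (fun s => B s (u s))
        (B.continuous.clm_apply u.continuous) (‖B‖ * ‖u‖)
        (fun s => norm_clm_apply_le B u s))
      (by intros; ext; simp) (by intros; ext; simp) (by intros; ext; simp)
      (by intros; ext; simp)) 1
    (fun B u => by
      rw [one_mul]
      exact (norm_le (by positivity)).2 (norm_clm_apply_le B u))

@[simp]
theorem pointwiseApply_apply (B : ℝ →ᵇ (E →L[ℝ] F)) (u : ℝ →ᵇ E) (s : ℝ) :
    pointwiseApply B u s = B s (u s) := rfl

theorem hasFDerivAt_superposition [ProperSpace E] {N : E → F} (hN : ContDiff ℝ 1 N)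
    (u : ℝ →ᵇ E) :
    HasFDerivAt (superposition N hN.continuous)
      (pointwiseApply (superposition (fderiv ℝ N) (hN.continuous_fderiv one_ne_zero) u)) u := by
  rw [hasFDerivAt_iff_isLittleO_nhds_zero, Asymptotics.isLittleO_iff]
  intro ε hε
  obtain ⟨δ, hδ, h⟩ := exists_dist_lt_of_norm_le (hN.continuous_fderiv one_ne_zero) ‖u‖ hε
  filter_upwards [Metric.ball_mem_nhds (0 : ℝ →ᵇ E) hδ] with v hv
  rw [mem_ball_zero_iff] at hv
  rw [norm_le (by positivity)]
  intro s
  have hvs : ‖v s‖ < δ := (v.norm_coe_le_norm s).trans_lt hv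
  have key := (convex_ball (u s) δ).norm_image_sub_le_of_norm_hasFDerivWithin_le'
    (f := N) (f' := fderiv ℝ N) (φ := fderiv ℝ N (u s)) (C := ε)
    (fun x _ => ((hN.differentiable one_ne_zero) x).hasFDerivAt.hasFDerivWithinAt)
    (fun x hx => (h (u s) x (u.norm_coe_le_norm s) (by simpa [dist_eq_norm] using hx)).le)
    (Metric.mem_ball_self hδ) (y := u s + v s) (by simpa using hvs)
  simp only [add_sub_cancel_left] at key
  refine LE.le.trans (b := ε * ‖v s‖) key ?_
  gcongr
  exact v.norm_coe_le_norm s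

theorem contDiff_superposition [ProperSpace E] {N : E → F} (hN : ContDiff ℝ 1 N) :
    ContDiff ℝ 1 (superposition N hN.continuous) :=
  contDiff_one_iff_hasFDerivAt.2 ⟨_, pointwiseApply.continuous.comp
    (continuous_superposition _ _), fun u => hasFDerivAt_superposition hN u⟩

/-- The embedding of vectors as constant curves. -/
def constCurve : E →L[ℝ] (ℝ →ᵇ E) :=
  LinearMap.mkContinuous
    { toFun := fun x => BoundedContinuousFunction.const ℝ x
      map_add' := fun _ _ => rfl
      map_smul' := fun _ _ => rfl } 1 (fun x => by
        rw [one_mul]; exact (norm_le (norm_nonneg x)).2 fun _ => le_rfl)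

@[simp]
theorem constCurve_apply (x : E) (s : ℝ) : constCurve x s = x := rfl

/-- The integral operator `F ↦ (s ↦ B(m(s)) ∫₀^{m(s)} C(τ) F(τ) dτ)` on bounded continuous curves.
The clipping function `m` restricts the integration to the time interval of interest. -/
def integralOperator [CompleteSpace F] (B : ℝ → F →L[ℝ] G) (C : ℝ → F →L[ℝ] F) (m : ℝ → ℝ)
    (hB : Continuous B) (hC : Continuous C) (hm : Continuous m) (K : ℝ)
    (hK : ∀ (s : ℝ) (f : ℝ →ᵇ F), ‖B (m s) (∫ τ in (0 : ℝ)..m s, C τ (f τ))‖ ≤ K * ‖f‖) :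
    (ℝ →ᵇ F) →L[ℝ] (ℝ →ᵇ G) :=
  have hcont : ∀ f : ℝ →ᵇ F, Continuous fun τ => C τ (f τ) := fun f => hC.clm_apply f.continuous
  LinearMap.mkContinuousOfExistsBound
    { toFun := fun f => BoundedContinuousFunction.ofNormedAddCommGroup
        (fun s => B (m s) (∫ τ in (0 : ℝ)..m s, C τ (f τ)))
        ((hB.comp hm).clm_apply ((intervalIntegral.continuous_primitive
          (fun a b => (hcont f).intervalIntegrable a b) 0).comp hm)) (K * ‖f‖) (fun s => hK s f)
      map_add' := fun f g => by
        ext s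
        simp only [coe_add, Pi.add_apply, map_add, coe_ofNormedAddCommGroup]
        rw [intervalIntegral.integral_add ((hcont f).intervalIntegrable _ _)
          ((hcont g).intervalIntegrable _ _), map_add]
      map_smul' := fun c f => by
        ext s
        simp only [coe_smul, map_smul, coe_ofNormedAddCommGroup, RingHom.id_apply]
        rw [intervalIntegral.integral_smul, map_smul] }
    ⟨max K 0, fun f => by
      rw [norm_le (by positivity)]
      exact fun s => (hK s f).trans (mul_le_mul_of_nonneg_right (le_max_left _ _) (norm_nonneg _))⟩

@[simp]
theorem integralOperator_apply [CompleteSpace F] (B : ℝ → F →L[ℝ] G) (C : ℝ → F →L[ℝ] F)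
    (m : ℝ → ℝ) (hB : Continuous B) (hC : Continuous C) (hm : Continuous m) (K : ℝ)
    (hK : ∀ (s : ℝ) (f : ℝ →ᵇ F), ‖B (m s) (∫ τ in (0 : ℝ)..m s, C τ (f τ))‖ ≤ K * ‖f‖)
    (f : ℝ →ᵇ F) (s : ℝ) :
    integralOperator B C m hB hC hm K hK f s = B (m s) (∫ τ in (0 : ℝ)..m s, C τ (f τ)) := rfl

/-- A fixed-point equation `u = H(a, u)` whose derivative in `u` vanishes at a base solution has a
`C¹` family of solutions. -/
theorem exists_contDiffAt_fixedPoint [CompleteSpace X] [CompleteSpace E] {H : E × X → X} {a : E}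
    {u : X} (hH : ContDiffAt ℝ 1 H (a, u)) (hu : H (a, u) = u)
    (hd : ∀ v, fderiv ℝ H (a, u) (0, v) = 0) :
    ∃ ψ : E → X, ψ a = u ∧ ContDiffAt ℝ 1 ψ a ∧ ∀ᶠ b in 𝓝 a, H (b, ψ b) = ψ b := by
  have hf : ContDiffAt ℝ 1 (fun q : E × X => q.2 - H q) (a, u) := contDiffAt_snd.sub hH
  have hfd : fderiv ℝ (fun q : E × X => q.2 - H q) (a, u) ∘L .inr ℝ E X = .id ℝ X := by
    ext v
    have h1 : HasFDerivAt (fun q : E × X => q.2 - H q)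
        (ContinuousLinearMap.snd ℝ E X - fderiv ℝ H (a, u)) (a, u) :=
      hasFDerivAt_snd.sub (hH.differentiableAt one_ne_zero).hasFDerivAt
    simp [h1.fderiv, hd v]
  have hi : (fderiv ℝ (fun q : E × X => q.2 - H q) (a, u) ∘L .inr ℝ E X).IsInvertible := by
    rw [hfd]
    exact ⟨ContinuousLinearEquiv.refl ℝ X, rfl⟩
  refine ⟨hf.implicitFunction one_ne_zero hi, hf.implicitFunction_apply_self one_ne_zero hi,
    hf.contDiffAt_implicitFunction one_ne_zero hi, ?_⟩
  filter_upwards [hf.eventually_apply_implicitFunction one_ne_zero hi] with b hb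
  rw [hu, sub_self, sub_eq_zero] at hb
  exact hb.symm

/-- Integral equations `u = Λ a + S₁(N₁ ∘ u) + ℓ(a) S₂(N₂ ∘ u)` on bounded curves, near a base
solution with `ℓ(a) = 0` along which the derivative of `N₁` vanishes, have a `C¹` family of
solutions. -/
theorem exists_contDiffAt_integralEquation {P : Type*} [NormedAddCommGroup P] [NormedSpace ℝ P]
    [CompleteSpace P] [ProperSpace E]
    {N₁ : E → F} {N₂ : E → G} (h₁ : ContDiff ℝ 1 N₁) (h₂ : ContDiff ℝ 1 N₂)
    (Λ : P →L[ℝ] (ℝ →ᵇ E)) (S₁ : (ℝ →ᵇ F) →L[ℝ] (ℝ →ᵇ E)) (S₂ : (ℝ →ᵇ G) →L[ℝ] (ℝ →ᵇ E))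
    (l : P →L[ℝ] ℝ) {a : P} {u : ℝ →ᵇ E} (hl : l a = 0)
    (hu : Λ a + S₁ (superposition N₁ h₁.continuous u) = u)
    (hd : ∀ s, fderiv ℝ N₁ (u s) = 0) :
    ∃ ψ : P → (ℝ →ᵇ E), ψ a = u ∧ ContDiffAt ℝ 1 ψ a ∧ ∀ᶠ b in 𝓝 a,
      Λ b + S₁ (superposition N₁ h₁.continuous (ψ b))
        + l b • S₂ (superposition N₂ h₂.continuous (ψ b)) = ψ b := by
  have e₁ := contDiff_superposition h₁
  have e₂ := contDiff_superposition h₂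
  refine exists_contDiffAt_fixedPoint (H := fun q : P × (ℝ →ᵇ E) =>
    Λ q.1 + S₁ (superposition N₁ h₁.continuous q.2)
      + l q.1 • S₂ (superposition N₂ h₂.continuous q.2)) ?_ ?_ ?_
  · exact ContDiff.contDiffAt (by fun_prop)
  · simp [hl, hu]
  · intro v
    have d₁ := (S₁.hasFDerivAt (x := superposition N₁ h₁.continuous u)).comp (a, u)
      ((hasFDerivAt_superposition h₁ u).comp (a, u) (hasFDerivAt_snd (𝕜 := ℝ) (E := P)))
    have d₂ := (S₂.hasFDerivAt (x := superposition N₂ h₂.continuous u)).comp (a, u)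
      ((hasFDerivAt_superposition h₂ u).comp (a, u) (hasFDerivAt_snd (𝕜 := ℝ) (E := P)))
    have dl := (l.hasFDerivAt (x := a)).comp (a, u) (hasFDerivAt_fst (𝕜 := ℝ) (F := ℝ →ᵇ E))
    have dΛ := (Λ.hasFDerivAt (x := a)).comp (a, u) (hasFDerivAt_fst (𝕜 := ℝ) (F := ℝ →ᵇ E))
    have d := (dΛ.add d₁).add (dl.smul d₂)
    have hz : pointwiseApply (superposition (fderiv ℝ N₁)
        (h₁.continuous_fderiv one_ne_zero) u) v = 0 := by
      ext s; simp [hd s]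
    have d' := d.fderiv
    simp only [Function.comp_def] at d'
    erw [d']
    simp [hz, hl]

end BoundedCurves

/-! ### The profile equation as a first-order system -/

section FirstOrderSystem

theorem hasDerivAt_signedPow {p : ℝ} (hp : 1 < p) (x : ℝ) :
    HasDerivAt (fun x : ℝ => |x| ^ (p - 1) * x) (p * |x| ^ (p - 1)) x := by
  rcases lt_trichotomy x 0 with hx | rfl | hx
  · have h := ((hasDerivAt_neg x).rpow_const (p := p - 1) (Or.inl (by linarith : -x ≠ 0))).mul
      (hasDerivAt_id x)
    have e : (fun x : ℝ => |x| ^ (p - 1) * x) =ᶠ[𝓝 x] (fun x => (-x) ^ (p - 1)) * id := by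
      filter_upwards [Iio_mem_nhds hx] with t ht
      simp [abs_of_neg (show t < 0 from ht)]
    convert! h.congr_of_eventuallyEq e using 1
    simp only [id]
    rw [abs_of_neg hx, Real.rpow_sub_one (by linarith : -x ≠ 0) (p - 1)]
    have : x ≠ 0 := hx.ne
    field_simp
    ring
  · rw [hasDerivAt_iff_tendsto_slope]
    have hc : ContinuousAt (fun x : ℝ => |x| ^ (p - 1)) 0 :=
      (continuous_abs.rpow_const (fun _ => Or.inr (by linarith))).continuousAt
    have h0 : p * |(0 : ℝ)| ^ (p - 1) = |(0 : ℝ)| ^ (p - 1) := by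
      simp [Real.zero_rpow (by linarith : p - 1 ≠ 0)]
    rw [h0]
    refine (hc.tendsto.mono_left nhdsWithin_le_nhds).congr' ?_
    filter_upwards [self_mem_nhdsWithin] with t ht
    have : t ≠ 0 := ht
    simp [slope_def_field, this]
  · have h := ((hasDerivAt_id x).rpow_const (p := p - 1) (Or.inl hx.ne')).mul (hasDerivAt_id x)
    have e : (fun x : ℝ => |x| ^ (p - 1) * x) =ᶠ[𝓝 x] (fun x => (id x) ^ (p - 1)) * id := by
      filter_upwards [Ioi_mem_nhds hx] with t ht
      simp [abs_of_pos (show 0 < t from ht)]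
    convert! h.congr_of_eventuallyEq e using 1
    simp only [id]
    rw [abs_of_pos hx, Real.rpow_sub_one hx.ne' (p - 1)]
    field_simp
    ring

theorem contDiff_signedPow {p : ℝ} (hp : 1 < p) : ContDiff ℝ 1 fun x : ℝ => |x| ^ (p - 1) * x := by
  rw [contDiff_one_iff_deriv]
  refine ⟨fun x => (hasDerivAt_signedPow hp x).differentiableAt, ?_⟩
  rw [show deriv (fun x : ℝ => |x| ^ (p - 1) * x) = fun x => p * |x| ^ (p - 1) from
    funext fun x => (hasDerivAt_signedPow hp x).deriv]
  exact continuous_const.mul (continuous_abs.rpow_const fun _ => Or.inr (by linarith))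

/-- The profile equation solved for the fourth derivative, `z` being the jet at `y`. -/
noncomputable def profileRHS (p y : ℝ) (z : Fin 4 → ℝ) : ℝ :=
  |z 0| ^ (p - 1) * z 0 - z 0 / (p - 1) - 1 / 4 * y * z 1

/-- The time-dependent vector field of the first-order system for the jets. -/
noncomputable def profileField (p y : ℝ) (z : Fin 4 → ℝ) : Fin 4 → ℝ :=
  ![z 1, z 2, z 3, profileRHS p y z]

/-- The autonomous vector field on the extended phase space of pairs `(y, z)`. -/
noncomputable def extendedField (p : ℝ) (q : ℝ × (Fin 4 → ℝ)) : ℝ × (Fin 4 → ℝ) :=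
  (1, profileField p q.1 q.2)

theorem contDiff_extendedField {p : ℝ} (hp : 1 < p) : ContDiff ℝ 1 (extendedField p) := by
  have h0 : ContDiff ℝ 1 fun q : ℝ × (Fin 4 → ℝ) => |q.2 0| ^ (p - 1) * q.2 0 :=
    (contDiff_signedPow hp).comp (by fun_prop : ContDiff ℝ 1 fun q : ℝ × (Fin 4 → ℝ) => q.2 0)
  refine contDiff_const.prodMk (contDiff_pi.2 fun i => ?_)
  fin_cases i
  · simp [profileField]; fun_prop
  · simp [profileField]; fun_prop
  · simp [profileField]; fun_prop
  · simp only [profileField, profileRHS, Fin.reduceFinMk, Matrix.cons_val]; fun_prop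

/-- `u` is an integral curve on `(a, b)` of the first-order system for the jets. -/
def IsJetCurve (p a b : ℝ) (u : ℝ → Fin 4 → ℝ) : Prop :=
  ∀ t ∈ Ioo a b, HasDerivAt u (profileField p t (u t)) t

theorem IsJetCurve.hasDerivAt_extended {p a b : ℝ} {u : ℝ → Fin 4 → ℝ} (hu : IsJetCurve p a b u)
    {t : ℝ} (ht : t ∈ Ioo a b) :
    HasDerivAt (fun t => (t, u t)) (extendedField p (t, u t)) t :=
  (hasDerivAt_id t).prodMk (hu t ht)

theorem IsJetCurve.mono {p a b a' b' : ℝ} {u : ℝ → Fin 4 → ℝ} (hu : IsJetCurve p a b u)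
    (ha : a ≤ a') (hb : b' ≤ b) : IsJetCurve p a' b' u :=
  fun t ht => hu t (Ioo_subset_Ioo ha hb ht)

theorem IsProfileSolution.isJetCurve {p a b : ℝ} {f : ℝ → ℝ} (hf : IsProfileSolution p a b f) :
    IsJetCurve p a b (jet f) := by
  intro t ht
  have hd : ∀ k : ℕ, k < 4 → HasDerivAt (iteratedDeriv k f) (iteratedDeriv (k + 1) f t) t := by
    intro k hk
    have h1 := (hf.1.differentiableOn_iteratedDerivWithin (m := k) (by exact_mod_cast hk)
      isOpen_Ioo.uniqueDiffOn).differentiableAt (isOpen_Ioo.mem_nhds ht)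
    have h2 : iteratedDeriv k f =ᶠ[𝓝 t] iteratedDerivWithin k f (Ioo a b) :=
      ((iteratedDerivWithin_of_isOpen isOpen_Ioo).symm).eventuallyEq_of_mem
        (isOpen_Ioo.mem_nhds ht)
    rw [iteratedDeriv_succ]
    exact (h2.differentiableAt_iff.2 h1).hasDerivAt
  rw [hasDerivAt_pi]
  intro i
  have h4 := hf.2 t ht
  fin_cases i
  · exact hd 0 (by norm_num)
  · exact hd 1 (by norm_num)
  · exact hd 2 (by norm_num)
  · refine (hd 3 (by norm_num)).congr_deriv ?_
    change iteratedDeriv 4 f t = profileRHS p t (jet f t)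
    simp only [profileRHS, jet, Fin.val_zero, Fin.val_one, iteratedDeriv_zero, iteratedDeriv_one]
    linarith

theorem IsJetCurve.jet_eq {p a b : ℝ} {u : ℝ → Fin 4 → ℝ} (hu : IsJetCurve p a b u) {t : ℝ}
    (ht : t ∈ Ioo a b) : jet (fun s => u s 0) t = u t := by
  have hd : ∀ s ∈ Ioo a b, ∀ i, HasDerivAt (fun s => u s i) (profileField p s (u s) i) s :=
    fun s hs => hasDerivAt_pi.1 (hu s hs)
  have hstep : ∀ (k : ℕ) (i j : Fin 4), (∀ s z, profileField p s z i = z j) →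
      EqOn (iteratedDeriv k fun s => u s 0) (fun s => u s i) (Ioo a b) →
      EqOn (iteratedDeriv (k + 1) fun s => u s 0) (fun s => u s j) (Ioo a b) := by
    intro k i j hij hk s hs
    rw [iteratedDeriv_succ, (hk.eventuallyEq_of_mem (isOpen_Ioo.mem_nhds hs)).deriv_eq,
      (hd s hs i).deriv, hij]
  have h0 : EqOn (iteratedDeriv 0 fun s => u s 0) (fun s => u s 0) (Ioo a b) := by
    intro s _; simp
  have h1 := hstep 0 0 1 (fun _ _ => rfl) h0
  have h2 := hstep 1 1 2 (fun _ _ => rfl) h1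
  have h3 := hstep 2 2 3 (fun _ _ => rfl) h2
  ext i
  fin_cases i
  exacts [h0 ht, h1 ht, h2 ht, h3 ht]

theorem IsJetCurve.iteratedDeriv_four {p a b : ℝ} {u : ℝ → Fin 4 → ℝ} (hu : IsJetCurve p a b u)
    {t : ℝ} (ht : t ∈ Ioo a b) : iteratedDeriv 4 (fun s => u s 0) t = profileRHS p t (u t) := by
  have e : EqOn (iteratedDeriv 3 fun s => u s 0) (fun s => u s 3) (Ioo a b) := fun s hs =>
    congrFun (hu.jet_eq hs) 3
  rw [iteratedDeriv_succ, (e.eventuallyEq_of_mem (isOpen_Ioo.mem_nhds ht)).deriv_eq]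
  exact (hasDerivAt_pi.1 (hu t ht) 3).deriv

theorem IsJetCurve.isProfileSolution {p a b : ℝ} (hp : 1 < p) {u : ℝ → Fin 4 → ℝ}
    (hu : IsJetCurve p a b u) : IsProfileSolution p a b fun s => u s 0 := by
  have hd : ∀ s ∈ Ioo a b, ∀ i, HasDerivAt (fun s => u s i) (profileField p s (u s) i) s :=
    fun s hs => hasDerivAt_pi.1 (hu s hs)
  have hstep : ∀ (n : ℕ) (i : Fin 4), ContDiffOn ℝ n (fun s => profileField p s (u s) i) (Ioo a b)
      → ContDiffOn ℝ (n + 1 : ℕ) (fun s => u s i) (Ioo a b) := by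
    intro n i h
    push_cast
    rw [contDiffOn_succ_iff_deriv_of_isOpen isOpen_Ioo]
    refine ⟨fun s hs => (hd s hs i).differentiableAt.differentiableWithinAt, by simp, ?_⟩
    exact h.congr fun s hs => (hd s hs i).deriv
  have hc : ContinuousOn (fun t => extendedField p (t, u t)) (Ioo a b) :=
    (contDiff_extendedField hp).continuous.comp_continuousOn
      fun t ht => (hu.hasDerivAt_extended ht).continuousAt.continuousWithinAt
  have h0 : ContDiffOn ℝ 0 (fun s => profileField p s (u s) 3) (Ioo a b) := by
    rw [contDiffOn_zero]
    exact (continuous_apply 3).comp_continuousOn (continuous_snd.comp_continuousOn hc)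
  have h4 : ContDiffOn ℝ 4 (fun s => u s 0) (Ioo a b) :=
    hstep 3 0 (hstep 2 1 (hstep 1 2 (hstep 0 3 h0)))
  refine ⟨h4, fun y hy => ?_⟩
  rw [hu.iteratedDeriv_four hy, (hd y hy 0).deriv]
  simp only [profileRHS, profileField, Matrix.cons_val_zero]
  ring

theorem IsJetCurve.eqOn {p a b : ℝ} (hp : 1 < p) {u w : ℝ → Fin 4 → ℝ} (hu : IsJetCurve p a b u)
    (hw : IsJetCurve p a b w) {t₀ : ℝ} (ht₀ : t₀ ∈ Ioo a b) (h₀ : u t₀ = w t₀) :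
    EqOn u w (Ioo a b) := by
  have hloc : ∀ t ∈ Ioo a b, u t = w t → ∀ᶠ s in 𝓝 t, u s = w s := by
    intro t ht h
    obtain ⟨K, N, hN, hK⟩ :=
      ((contDiff_extendedField hp).contDiffAt (x := (t, u t))).exists_lipschitzOnWith
    have hnear : ∀ v : ℝ → Fin 4 → ℝ, IsJetCurve p a b v → v t = u t → ∀ᶠ s in 𝓝 t,
        HasDerivAt (fun s => (s, v s)) (extendedField p (s, v s)) s ∧ (s, v s) ∈ N := by
      intro v hv hvt
      have := (hv.hasDerivAt_extended ht).continuousAt.tendsto.eventually_mem (s := N)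
        (by simpa only [hvt] using hN)
      filter_upwards [this, isOpen_Ioo.mem_nhds ht] with s hs hs'
      exact ⟨hv.hasDerivAt_extended hs', hs⟩
    have := ODE_solution_unique_of_eventually (v := fun _ => extendedField p) (s := fun _ => N)
      (.of_forall fun _ => hK) (hnear u hu rfl) (hnear w hw h.symm) (by rw [h])
    filter_upwards [this] with s hs
    exact congrArg Prod.snd hs
  have hsub := isPreconnected_Ioo.subset_of_closure_inter_subset
    (s := Ioo a b) (u := {t | ∀ᶠ s in 𝓝 t, u s = w s}) isOpen_setOfPred_eventually_nhds
    ⟨t₀, ht₀, hloc t₀ ht₀ h₀⟩ (by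
      rintro t ⟨htc, ht⟩
      refine hloc t ht ?_
      have hfr : ∃ᶠ s in 𝓝 t, u s = w s :=
        (mem_closure_iff_frequently.1 htc).mono fun s hs => hs.self_of_nhds
      by_contra hne
      exact hfr (((hu t ht).continuousAt.ne_iff_eventually_ne (hw t ht).continuousAt).1 hne))
  exact fun t ht => (hsub ht).self_of_nhds

/-- Two jet curves that meet at `c` can be glued there. -/
theorem IsJetCurve.glue {p a b a' b' c : ℝ} {u w : ℝ → Fin 4 → ℝ} (hu : IsJetCurve p a b u)
    (hw : IsJetCurve p a' b' w) (hc : c ∈ Ioo a b) (hc' : c ∈ Ioo a' b') (h : u c = w c) :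
    IsJetCurve p a b' (fun t => if t ≤ c then u t else w t) := by
  intro t ht
  rcases lt_trichotomy t c with htc | rfl | htc <;> beta_reduce
  · rw [if_pos htc.le]
    refine (hu t ⟨ht.1, htc.trans hc.2⟩).congr_of_eventuallyEq ?_
    filter_upwards [Iio_mem_nhds htc] with s hs
    rw [if_pos (le_of_lt hs)]
  · rw [if_pos le_rfl, ← hasDerivWithinAt_univ, ← Iic_union_Ici (a := t)]
    refine HasDerivWithinAt.union ?_ ?_
    · exact (hu t hc).hasDerivWithinAt.congr (fun s hs => if_pos hs) (if_pos le_rfl)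
    · rw [h]
      refine (hw t hc').hasDerivWithinAt.congr (fun s hs => ?_) (by rw [if_pos le_rfl, h])
      rcases eq_or_lt_of_le (show t ≤ s from hs) with rfl | hs
      · rw [if_pos le_rfl, h]
      · rw [if_neg (not_le.2 hs)]
  · rw [if_neg (not_le.2 htc)]
    refine (hw t ⟨hc'.1.trans htc, ht.2⟩).congr_of_eventuallyEq ?_
    filter_upwards [Ioi_mem_nhds htc] with s hs
    rw [if_neg (not_le.2 hs)]

end FirstOrderSystem

/-! ### The local flow as a `C¹` map -/

section LocalFlow

open BoundedContinuousFunction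

/-- The `C¹` local flow `Φ` of a `C¹` vector field. The time `h` enters the integral equation
`u(τ) = x + h ∫₀^τ V(u)` as a parameter, so that at `h = 0` its linearization is the identity. -/
theorem exists_contDiffAt_localFlow {E : Type*} [NormedAddCommGroup E] [NormedSpace ℝ E]
    [ProperSpace E] {V : E → E} (hV : ContDiff ℝ 1 V) (x₀ : E) :
    ∃ Φ : E × ℝ → E, ∀ᶠ q in 𝓝 (x₀, (0 : ℝ)), ContDiffAt ℝ 1 Φ q ∧
      IsUnit (fderiv ℝ Φ q ∘L ContinuousLinearMap.inl ℝ E ℝ) ∧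
      ∃ c : ℝ → E, c 0 = q.1 ∧ c q.2 = Φ q ∧
        ∀ t, |t| < 2 * |q.2| → HasDerivAt c (V (c t)) t := by
  -- The rescaled time `τ` is clipped to `[-2, 2]`, so that the endpoint `τ = 1` is interior.
  let m : ℝ → ℝ := fun s => max (-2) (min 2 s)
  have hm : Continuous m := by fun_prop
  have hm2 : ∀ s, |m s| ≤ 2 := fun s => abs_le.2 ⟨le_max_left _ _, max_le (by norm_num)
    (min_le_left _ _)⟩
  have hms : ∀ s, |s| < 2 → m s = s := fun s hs => by
    rw [abs_lt] at hs
    simp only [m]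
    rw [min_eq_right hs.2.le, max_eq_right hs.1.le]
  let S₂ : (ℝ →ᵇ E) →L[ℝ] (ℝ →ᵇ E) := integralOperator (fun _ => .id ℝ E) (fun _ => .id ℝ E) m
    continuous_const continuous_const hm 2 (fun s f => by
      simp only [ContinuousLinearMap.id_apply]
      refine (intervalIntegral.norm_integral_le_of_norm_le_const
        (fun τ _ => f.norm_coe_le_norm τ)).trans ?_
      rw [sub_zero, mul_comm]
      gcongr
      exact hm2 s)
  let Λ : (E × ℝ) →L[ℝ] (ℝ →ᵇ E) := constCurve.comp (ContinuousLinearMap.fst ℝ E ℝ)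
  have hΛ : ∀ q s, Λ q s = q.1 := fun _ _ => rfl
  obtain ⟨ψ, hψ0, hψ, hψe⟩ := exists_contDiffAt_integralEquation (E := E) (F := E)
    (N₁ := fun _ => 0) contDiff_const hV Λ 0 S₂ (ContinuousLinearMap.snd ℝ E ℝ) (a := (x₀, 0))
    (u := BoundedContinuousFunction.const ℝ x₀) rfl (by ext; simp [hΛ]) (by simp)
  let ev : (ℝ →ᵇ E) →L[ℝ] E := evalCLM ℝ (1 : ℝ)
  have hev : ∀ u : ℝ →ᵇ E, ev u = u 1 := fun _ => rfl
  have hΦ : ContDiffAt ℝ 1 (fun q => ev (ψ q)) (x₀, (0 : ℝ)) :=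
    ev.contDiff.contDiffAt.comp _ hψ
  have hval : ∀ᶠ q in 𝓝 (x₀, (0 : ℝ)), ∀ s,
      ψ q s = q.1 + q.2 • ∫ τ in (0 : ℝ)..m s, V (ψ q τ) := by
    filter_upwards [hψe] with q hq s
    conv_lhs => rw [← hq]
    simp [hΛ, S₂]
  refine ⟨fun q => ev (ψ q), ?_⟩
  have hunit : ∀ᶠ q in 𝓝 (x₀, (0 : ℝ)),
      IsUnit (fderiv ℝ (fun q => ev (ψ q)) q ∘L ContinuousLinearMap.inl ℝ E ℝ) := by
    have hcont : ContinuousAt (fun q => fderiv ℝ (fun q => ev (ψ q)) q ∘L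
        ContinuousLinearMap.inl ℝ E ℝ) (x₀, (0 : ℝ)) :=
      (hΦ.continuousAt_fderiv one_ne_zero).clm_comp continuousAt_const
    refine hcont.eventually (Units.isOpen.mem_nhds ?_)
    have h0 := hasFDerivAt_prodMk_left (𝕜 := ℝ) x₀ (0 : ℝ)
    have h1 : HasFDerivAt (fun x => ev (ψ (x, 0)))
        (fderiv ℝ (fun q => ev (ψ q)) (x₀, 0) ∘L ContinuousLinearMap.inl ℝ E ℝ) x₀ :=
      HasFDerivAt.comp (g := fun q => ev (ψ q)) x₀
        (hΦ.differentiableAt one_ne_zero).hasFDerivAt h0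
    have h2 : (fun x => ev (ψ (x, 0))) =ᶠ[𝓝 x₀] id := by
      have : Tendsto (fun x : E => (x, (0 : ℝ))) (𝓝 x₀) (𝓝 (x₀, 0)) :=
        (Continuous.prodMk_left 0).continuousAt
      filter_upwards [this.eventually hval] with x hx
      simp [hev, hx 1]
    have h3 := h1.unique ((hasFDerivAt_id x₀).congr_of_eventuallyEq h2)
    change IsUnit (fderiv ℝ (fun q => ev (ψ q)) (x₀, 0) ∘L ContinuousLinearMap.inl ℝ E ℝ)
    rw [h3]
    exact isUnit_one
  filter_upwards [hΦ.eventually (by simp), hunit, hval] with q hq hq' hv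
  refine ⟨hq, hq', fun t => ψ q (t / q.2), ?_, ?_, ?_⟩
  · simp [hv 0, hms]
  · by_cases h0 : q.2 = 0
    · simp [h0, hev, hv 0, hv 1]
    · simp [h0, hev]
  · intro t ht
    have h0 : q.2 ≠ 0 := by
      rintro h; simp [h] at ht; linarith [abs_nonneg t]
    have hs : |t / q.2| < 2 := by rwa [abs_div, div_lt_iff₀ (abs_pos.2 h0)]
    have hu : HasDerivAt (ψ q) (q.2 • V (ψ q (t / q.2))) (t / q.2) := by
      have hc : Continuous fun τ => V (ψ q τ) := hV.continuous.comp (ψ q).continuous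
      have hi := ((intervalIntegral.integral_hasDerivAt_right (hc.intervalIntegrable 0 (t / q.2))
        (hc.stronglyMeasurableAtFilter _ _) hc.continuousAt).const_smul q.2).const_add q.1
      refine hi.congr_of_eventuallyEq ?_
      filter_upwards [(continuous_abs.isOpen_preimage _ isOpen_Iio).mem_nhds hs] with s hs'
      rw [hv s, hms s hs']
      rfl
    have hcomp := hu.scomp t ((hasDerivAt_id t).div_const q.2)
    convert! hcomp using 1
    rw [smul_smul, one_div, inv_mul_cancel₀ h0, one_smul]

end LocalFlow

/-! ### The explicit solution and the Euler equation -/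

section Euler

theorem iteratedDeriv_eqOn_of_hasDerivAt {F : Type*} [NormedAddCommGroup F] [NormedSpace ℝ F]
    {s : Set ℝ} (hs : IsOpen s) {g : ℕ → ℝ → F}
    (hg : ∀ k, ∀ x ∈ s, HasDerivAt (g k) (g (k + 1) x) x) (k : ℕ) :
    EqOn (iteratedDeriv k (g 0)) (g k) s := by
  induction k with
  | zero => intro x _; simp
  | succ k ih =>
    intro x hx
    rw [iteratedDeriv_succ, (ih.eventuallyEq_of_mem (hs.mem_nhds hx)).deriv_eq, (hg k x hx).deriv]

theorem iteratedDeriv_cpow (y₀ : ℝ) (m : ℂ) (k : ℕ) {y : ℝ} (hy : y₀ < y) :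
    iteratedDeriv k (fun x : ℝ => ((x - y₀ : ℝ) : ℂ) ^ m) y
      = (∏ i ∈ Finset.range k, (m - i)) * ((y - y₀ : ℝ) : ℂ) ^ (m - k) := by
  have h := iteratedDeriv_eqOn_of_hasDerivAt (s := Ioi y₀) isOpen_Ioi
    (g := fun k x => (∏ i ∈ Finset.range k, (m - i)) * ((x - y₀ : ℝ) : ℂ) ^ (m - k)) (by
      intro k x hx
      have h0 : 0 < x - y₀ := sub_pos.2 hx
      have h1 := (((hasDerivAt_id ((x - y₀ : ℝ) : ℂ)).cpow_const (c := m - k)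
        (Complex.ofReal_mem_slitPlane.2 h0)).comp_ofReal).comp_sub_const x y₀
      have h2 := h1.const_mul (∏ i ∈ Finset.range k, (m - i))
      convert! h2 using 1
      rw [Finset.prod_range_succ, Nat.cast_succ, sub_add_eq_sub_sub, mul_one, mul_assoc]
      rfl) k
  simpa using h (show y ∈ Ioi y₀ from hy)

theorem iteratedDeriv_rpow (y₀ A r : ℝ) (k : ℕ) {y : ℝ} (hy : y₀ < y) :
    iteratedDeriv k (fun x : ℝ => A * (x - y₀) ^ r) y
      = A * (∏ i ∈ Finset.range k, (r - i)) * (y - y₀) ^ (r - k) := by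
  have h := iteratedDeriv_eqOn_of_hasDerivAt (s := Ioi y₀) isOpen_Ioi
    (g := fun k x => A * (∏ i ∈ Finset.range k, (r - i)) * (x - y₀) ^ (r - k)) (by
      intro k x hx
      have h0 : 0 < x - y₀ := sub_pos.2 hx
      have h2 := (((hasDerivAt_id x).sub_const y₀).rpow_const (p := r - k)
        (Or.inl (by simpa using h0.ne'))).const_mul (A * ∏ i ∈ Finset.range k, (r - i))
      convert! h2 using 1
      rw [Finset.prod_range_succ, Nat.cast_succ, sub_add_eq_sub_sub, one_mul]
      simp only [id]
      ring) k
  simpa using h (show y ∈ Ioi y₀ from hy)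

theorem eulerPhi_ofReal (x : ℝ) : eulerPhi (x : ℂ) = ((eulerPhi x : ℝ) : ℂ) := by
  simp [eulerPhi]

theorem eulerPhi_neg_pos {a : ℝ} (ha : 0 < a) : 0 < eulerPhi (-a) := by
  have : eulerPhi (-a) = a * (a + 1) * (a + 2) * (a + 3) := by unfold eulerPhi; ring
  rw [this]; positivity

theorem eulerPhi_exponent_pos {p : ℝ} (hp : 1 < p) : 0 < eulerPhi (-4 / (p - 1)) := by
  rw [neg_div]
  exact eulerPhi_neg_pos (div_pos (by norm_num) (by linarith))

theorem explicitBlowUp_rpow {p : ℝ} (hp : 1 < p) {y₀ y : ℝ} (hy : y₀ < y) :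
    explicitBlowUp p y₀ y ^ (p - 1) = eulerPhi (-4 / (p - 1)) * (y - y₀) ^ (-4 : ℝ) := by
  have h0 : 0 < y - y₀ := sub_pos.2 hy
  have h1 := eulerPhi_exponent_pos hp
  have hp' : p - 1 ≠ 0 := by linarith
  unfold explicitBlowUp
  rw [Real.mul_rpow (by positivity) (by positivity), ← Real.rpow_mul h1.le, ← Real.rpow_mul h0.le,
    one_div_mul_cancel hp', Real.rpow_one, div_mul_cancel₀ _ hp']

theorem isEulerMode_iff {p : ℝ} (hp : 1 < p) (y₀ : ℝ) (m : ℂ) :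
    IsEulerMode p y₀ m ↔ eulerPhi m = (p : ℂ) * eulerPhi (-4 / ((p : ℂ) - 1)) := by
  have hΦ : eulerPhi (-4 / ((p : ℂ) - 1)) = ((eulerPhi (-4 / (p - 1)) : ℝ) : ℂ) := by
    rw [← eulerPhi_ofReal]; push_cast; rfl
  have key : ∀ y, y₀ < y → (iteratedDeriv 4 (fun x : ℝ => ((x - y₀ : ℝ) : ℂ) ^ m) y
      = ((p * explicitBlowUp p y₀ y ^ (p - 1) : ℝ) : ℂ) * ((y - y₀ : ℝ) : ℂ) ^ m ↔
      eulerPhi m = (p : ℂ) * eulerPhi (-4 / ((p : ℂ) - 1))) := by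
    intro y hy
    have h0 : 0 < y - y₀ := sub_pos.2 hy
    have h0' : ((y - y₀ : ℝ) : ℂ) ≠ 0 := by exact_mod_cast h0.ne'
    have hprod : ∏ i ∈ Finset.range 4, (m - i) = eulerPhi m := by
      simp [Finset.prod_range_succ, eulerPhi]
    have h4 : (((y - y₀) ^ (-4 : ℝ) : ℝ) : ℂ) = (((y - y₀ : ℝ) : ℂ) ^ 4)⁻¹ := by
      rw [show (-4 : ℝ) = ((-4 : ℤ) : ℝ) by norm_num, Real.rpow_intCast]
      push_cast
      rfl
    rw [iteratedDeriv_cpow y₀ m 4 hy, explicitBlowUp_rpow hp hy, hprod, hΦ,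
      show ((4 : ℕ) : ℂ) = (4 : ℕ) from rfl, Complex.cpow_sub _ _ h0', Complex.cpow_natCast,
      Complex.ofReal_mul, Complex.ofReal_mul, h4]
    have hm : ((y - y₀ : ℝ) : ℂ) ^ m ≠ 0 := by
      rw [Complex.cpow_def_of_ne_zero h0']; exact Complex.exp_ne_zero _
    field_simp
  constructor
  · exact fun h => (key (y₀ + 1) (by linarith)).1 (h _ (by linarith))
  · exact fun h y hy => (key y hy).2 h

/-- `Φ` is symmetric about `3/2`, and `α = 4/(p-1)` satisfies `p Φ(-α) = Φ(-α-1)`; so `-α-1` and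
`α+4` are roots, and the remaining quadratic factor is `(m - 3/2)² + (α + 5/2)² - 5/2`. -/
theorem exists_eulerRoots {p : ℝ} (hp : 1 < p) :
    ∃ mp mm β : ℝ, 3 < mp ∧ mm < -4 / (p - 1) ∧ 0 < β ∧
      ∀ m : ℂ, eulerPhi m = (p : ℂ) * eulerPhi (-4 / ((p : ℂ) - 1)) ↔
        m = mp ∨ m = mm ∨ m = 3 / 2 + β * Complex.I ∨ m = 3 / 2 - β * Complex.I := by
  obtain ⟨a, ha, hpa⟩ : ∃ a : ℝ, 0 < a ∧ p = 1 + 4 / a :=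
    ⟨4 / (p - 1), div_pos (by norm_num) (by linarith), by
      have : p - 1 ≠ 0 := by linarith
      field_simp; ring⟩
  have hexp : -4 / (p - 1) = -a := by rw [hpa]; field_simp; ring
  have hβ : 0 < (a + 5 / 2) ^ 2 - 5 / 2 := by nlinarith
  refine ⟨a + 4, -a - 1, √((a + 5 / 2) ^ 2 - 5 / 2), by linarith, by rw [hexp]; linarith,
    Real.sqrt_pos.2 hβ, fun m => ?_⟩
  set β := √((a + 5 / 2) ^ 2 - 5 / 2)
  have hβ2 : (β : ℂ) ^ 2 = (a + 5 / 2) ^ 2 - 5 / 2 := by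
    have h : β ^ 2 = (a + 5 / 2) ^ 2 - 5 / 2 := Real.sq_sqrt hβ.le
    rw [← Complex.ofReal_pow, h]
    push_cast
    rfl
  have hrhs : (p : ℂ) * eulerPhi (-4 / ((p : ℂ) - 1)) = (a + 4) * (a + 1) * (a + 2) * (a + 3) := by
    have h1 : (-4 / ((p : ℂ) - 1)) = ((-a : ℝ) : ℂ) := by rw [← hexp]; push_cast; rfl
    have ha' : (a : ℂ) ≠ 0 := by exact_mod_cast ha.ne'
    rw [h1, hpa]
    unfold eulerPhi
    push_cast
    field_simp
    ring
  have hfac : eulerPhi m - (p : ℂ) * eulerPhi (-4 / ((p : ℂ) - 1)) =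
      (m - (a + 4)) * (m - (-a - 1)) * (m - (3 / 2 + β * Complex.I))
        * (m - (3 / 2 - β * Complex.I)) := by
    have : (m - (3 / 2 + β * Complex.I)) * (m - (3 / 2 - β * Complex.I))
        = (m - 3 / 2) ^ 2 + (β : ℂ) ^ 2 := by
      linear_combination -(β : ℂ) ^ 2 * Complex.I_sq
    rw [mul_assoc _ (m - (3 / 2 + β * Complex.I)), this, hβ2, hrhs]
    unfold eulerPhi
    ring
  rw [← sub_eq_zero, hfac]
  simp only [mul_eq_zero, sub_eq_zero, or_assoc]
  push_cast
  rfl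

end Euler

/-! ### Convergence of the scale-invariant quotients -/

section Lyapunov

/-- The Lotka–Volterra entropy of `x` relative to `c` controls the distance of `x` to `c`. -/
theorem sq_sqrt_sub_sqrt_le_entropy {x c : ℝ} (hx : 0 < x) (hc : 0 < c) :
    (√x - √c) ^ 2 ≤ x - c - c * Real.log (x / c) := by
  have hlog : Real.log (x / c) ≤ 2 * (√x / √c - 1) := by
    have h1 : x / c = (√x / √c) ^ 2 := by
      rw [div_pow, Real.sq_sqrt hx.le, Real.sq_sqrt hc.le]
    rw [h1, Real.log_pow]
    push_cast
    have := Real.log_le_sub_one_of_pos (div_pos (Real.sqrt_pos.2 hx) (Real.sqrt_pos.2 hc))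
    linarith
  have h2 : c * (2 * (√x / √c - 1)) = 2 * (√x * √c) - 2 * c := by
    have h3 : c * (√x / √c) = √x * √c := by
      have := Real.sqrt_pos.2 hc
      field_simp
      rw [Real.sq_sqrt hc.le]
    linear_combination 2 * h3
  nlinarith [mul_le_mul_of_nonneg_left hlog hc.le, Real.sq_sqrt hx.le, Real.sq_sqrt hc.le]

theorem hasDerivAt_entropy {X : ℝ → ℝ} {c r t : ℝ} (hc : 0 < c) (hX : 0 < X t)
    (h : HasDerivAt X (X t * r) t) :
    HasDerivAt (fun t => X t - c - c * Real.log (X t / c)) ((X t - c) * r) t := by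
  have h1 := (h.sub_const c).sub (((h.div_const c).log (by positivity)).const_mul c)
  convert! h1 using 1
  field_simp

/-- The quadratic form of the Lyapunov function is definite; the perturbation `d` of the rates is
absorbed. -/
theorem lyapunov_rate_le {c p q s d : ℝ} (hd : |d| ≤ 1 / 16) :
    p * (q - 2 * p) + q * (s - q - p + (c + s) * d) + s * (-s - p - (c + s) * d)
      ≤ -(p ^ 2 + q ^ 2 + s ^ 2) / 8 + |d| * c ^ 2 := by
  have h1 : (c + s) * d * (q - s) ≤ |d| * (c ^ 2 + 2 * (p ^ 2 + q ^ 2 + s ^ 2)) := by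
    have h2 : |(c + s) * (q - s)| ≤ c ^ 2 + 2 * (p ^ 2 + q ^ 2 + s ^ 2) := by
      rw [abs_le]
      constructor <;>
        nlinarith [sq_nonneg (c + s - (q - s)), sq_nonneg (c + s + (q - s)), sq_nonneg (c - s),
          sq_nonneg (q + s), sq_nonneg p, sq_nonneg c, sq_nonneg q]
    calc (c + s) * d * (q - s) = d * ((c + s) * (q - s)) := by ring
      _ ≤ |d * ((c + s) * (q - s))| := le_abs_self _
      _ = |d| * |(c + s) * (q - s)| := abs_mul _ _
      _ ≤ _ := mul_le_mul_of_nonneg_left h2 (abs_nonneg d)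
  have h3 : |d| * (2 * (p ^ 2 + q ^ 2 + s ^ 2)) ≤ 1 / 16 * (2 * (p ^ 2 + q ^ 2 + s ^ 2)) :=
    mul_le_mul_of_nonneg_right hd (by positivity)
  nlinarith [sq_nonneg (3 * q - 2 * s), sq_nonneg (7 * p + 2 * s), sq_nonneg s]

/-- If `V` decreases at a uniform rate with respect to the clock `L → ∞` as long as `V ≥ η`, then
`V < η` eventually. Time runs to the left, towards `a`. -/
theorem eventually_lt_of_decay {a : ℝ} {V W L l : ℝ → ℝ} {η c : ℝ} (hc : 0 < c)
    (hV : ∀ᶠ t in 𝓝[>] a, HasDerivAt V (l t * W t) t) (hV0 : ∀ᶠ t in 𝓝[>] a, 0 ≤ V t)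
    (hL : ∀ᶠ t in 𝓝[>] a, HasDerivAt L (l t) t) (hl : ∀ᶠ t in 𝓝[>] a, l t < 0)
    (hLt : Tendsto L (𝓝[>] a) atTop) (hW : ∀ᶠ t in 𝓝[>] a, η ≤ V t → W t ≤ -c) :
    ∀ᶠ t in 𝓝[>] a, V t < η := by
  obtain ⟨b, hb, hsub⟩ := mem_nhdsGT_iff_exists_Ioo_subset.1
    (hV.and (hV0.and (hL.and (hl.and hW))))
  have hsub' : ∀ t ∈ Ioo a b, HasDerivAt V (l t * W t) t ∧ 0 ≤ V t ∧ HasDerivAt L (l t) t ∧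
    l t < 0 ∧ (η ≤ V t → W t ≤ -c) := fun t ht => hsub ht
  obtain ⟨t₁, ht₁, hVt₁⟩ : ∃ t₁ ∈ Ioo a b, V t₁ < η := by
    by_contra! hcon
    have hmono : MonotoneOn (fun t => V t + c * L t) (Ioo a b) := by
      refine monotoneOn_of_hasDerivWithinAt_nonneg (f' := fun t => l t * W t + c * l t)
        (convex_Ioo a b) ?_ ?_ ?_
      · intro t ht
        exact ((hsub' t ht).1.add ((hsub' t ht).2.2.1.const_mul c)).continuousAt.continuousWithinAt
      · intro t ht
        rw [interior_Ioo] at ht ⊢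
        exact ((hsub' t ht).1.add ((hsub' t ht).2.2.1.const_mul c)).hasDerivWithinAt
      · intro t ht
        rw [interior_Ioo] at ht
        have h1 := (hsub' t ht).2.2.2.2 (hcon t ht)
        nlinarith [(hsub' t ht).2.2.2.1]
    obtain ⟨m, hm⟩ := exists_between (show a < b from hb)
    obtain ⟨t, htL, ht⟩ := ((hLt.eventually_gt_atTop ((V m + c * L m) / c)).and
      (Ioo_mem_nhdsGT hm.1)).exists
    have h1 := hmono ⟨ht.1, ht.2.trans hm.2⟩ hm ht.2.le
    rw [div_lt_iff₀ hc] at htL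
    have := (hsub' t ⟨ht.1, ht.2.trans hm.2⟩).2.1
    simp only at h1
    linarith
  filter_upwards [Ioo_mem_nhdsGT ht₁.1] with t ht
  by_contra! hVt
  have hIcc : ∀ x ∈ Icc t t₁, x ∈ Ioo a b := fun x hx =>
    ⟨ht.1.trans_le hx.1, hx.2.trans_lt ht₁.2⟩
  have := image_le_of_deriv_right_lt_deriv_boundary (f := fun x => -V x)
    (f' := fun x => -(l x * W x)) (B := fun _ => -η) (B' := fun _ => 0) (a := t) (b := t₁)
    (fun x hx => (hsub' x (hIcc x hx)).1.neg.continuousAt.continuousWithinAt)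
    (fun x hx => (hsub' x (hIcc x ⟨hx.1, hx.2.le⟩)).1.neg.hasDerivWithinAt)
    (neg_le_neg hVt) (fun x => hasDerivAt_const _ _)
    (fun x hx hxη => by
      have hx' := hsub' x (hIcc x ⟨hx.1, hx.2.le⟩)
      have := hx'.2.2.2.2 (neg_inj.1 hxη).ge
      nlinarith [hx'.2.2.2.1])
    (right_mem_Icc.2 ht.2.le)
  linarith

/-- Convergence of the perturbed Lotka–Volterra system satisfied by the quotients
`f f''/f'²`, `f f'''/(f' f'')`, `f^(p+1)/(f' f''')` in the clock `L = log f`, where `p = 1 + 4k`. -/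
theorem tendsto_lotkaVolterra {a k : ℝ} (hk : 0 < k) {L l P Q S d : ℝ → ℝ}
    (hL : ∀ᶠ t in 𝓝[>] a, HasDerivAt L (l t) t) (hl : ∀ᶠ t in 𝓝[>] a, l t < 0)
    (hLt : Tendsto L (𝓝[>] a) atTop) (hd : Tendsto d (𝓝[>] a) (𝓝 0))
    (hP0 : ∀ᶠ t in 𝓝[>] a, 0 < P t) (hQ0 : ∀ᶠ t in 𝓝[>] a, 0 < Q t)
    (hS0 : ∀ᶠ t in 𝓝[>] a, 0 < S t)
    (hP : ∀ᶠ t in 𝓝[>] a, HasDerivAt P (P t * (l t * (1 + Q t - 2 * P t))) t)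
    (hQ : ∀ᶠ t in 𝓝[>] a,
      HasDerivAt Q (Q t * (l t * (S t * (1 + d t) + 1 - Q t - P t))) t)
    (hS : ∀ᶠ t in 𝓝[>] a,
      HasDerivAt S (S t * (l t * (2 + 4 * k - S t * (1 + d t) - P t))) t) :
    Tendsto P (𝓝[>] a) (𝓝 (1 + k)) ∧ Tendsto Q (𝓝[>] a) (𝓝 (1 + 2 * k)) ∧
      Tendsto S (𝓝[>] a) (𝓝 (1 + 3 * k)) := by
  have c1 : 0 < 1 + k := by linarith
  have c2 : 0 < 1 + 2 * k := by linarith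
  have c3 : 0 < 1 + 3 * k := by linarith
  let φ : ℝ → ℝ → ℝ := fun c x => x - c - c * Real.log (x / c)
  have hφ0 : ∀ {c x}, 0 < c → 0 < x → (√x - √c) ^ 2 ≤ φ c x := fun hc hx =>
    sq_sqrt_sub_sqrt_le_entropy hx hc
  let V : ℝ → ℝ := fun t => φ (1 + k) (P t) + φ (1 + 2 * k) (Q t) + φ (1 + 3 * k) (S t)
  have hV : ∀ η > 0, ∀ᶠ t in 𝓝[>] a, V t < η := by
    intro η hη
    obtain ⟨r, hr, hrV⟩ : ∃ r > 0, ∀ x : ℝ × ℝ × ℝ,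
        (x.1 - (1 + k)) ^ 2 + (x.2.1 - (1 + 2 * k)) ^ 2 + (x.2.2 - (1 + 3 * k)) ^ 2 < r ^ 2 →
        φ (1 + k) x.1 + φ (1 + 2 * k) x.2.1 + φ (1 + 3 * k) x.2.2 < η := by
      have hφc : ∀ {c : ℝ}, 0 < c → ContinuousAt (φ c) c := by
        intro c hc
        have : c / c ≠ 0 := by rw [div_self hc.ne']; exact one_ne_zero
        have h1 : ContinuousAt (fun x => Real.log (x / c)) c :=
          ContinuousAt.log (by fun_prop) this
        fun_prop
      have hcont : ContinuousAt (fun x : ℝ × ℝ × ℝ =>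
          φ (1 + k) x.1 + φ (1 + 2 * k) x.2.1 + φ (1 + 3 * k) x.2.2)
          (1 + k, 1 + 2 * k, 1 + 3 * k) := by
        have e1 := ContinuousAt.comp (x := (1 + k, 1 + 2 * k, 1 + 3 * k)) (hφc c1)
          (f := fun x : ℝ × ℝ × ℝ => x.1) (by fun_prop)
        have e2 := ContinuousAt.comp (x := (1 + k, 1 + 2 * k, 1 + 3 * k)) (hφc c2)
          (f := fun x : ℝ × ℝ × ℝ => x.2.1) (by fun_prop)
        have e3 := ContinuousAt.comp (x := (1 + k, 1 + 2 * k, 1 + 3 * k)) (hφc c3)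
          (f := fun x : ℝ × ℝ × ℝ => x.2.2) (by fun_prop)
        exact (e1.add e2).add e3
      have hφ1 : ∀ {c : ℝ}, 0 < c → φ c c = 0 := fun hc => by simp [φ, div_self hc.ne']
      have := hcont.eventually_lt continuousAt_const (g := fun _ => η)
        (by simpa [hφ1 c1, hφ1 c2, hφ1 c3] using hη)
      obtain ⟨r, hr, h⟩ := Metric.eventually_nhds_iff.1 this
      refine ⟨r, hr, fun x hx => h ?_⟩
      rw [Prod.dist_eq, Prod.dist_eq, max_lt_iff, max_lt_iff]
      simp only [Real.dist_eq]
      refine ⟨?_, ?_, ?_⟩ <;>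
      · apply abs_lt_of_sq_lt_sq _ hr.le
        nlinarith [sq_nonneg (x.1 - (1 + k)), sq_nonneg (x.2.1 - (1 + 2 * k)),
          sq_nonneg (x.2.2 - (1 + 3 * k))]
    refine eventually_lt_of_decay (a := a) (V := V) (L := L) (l := l) (η := η) (c := r ^ 2 / 16)
      (W := fun t => (P t - (1 + k)) * (1 + Q t - 2 * P t)
        + (Q t - (1 + 2 * k)) * (S t * (1 + d t) + 1 - Q t - P t)
        + (S t - (1 + 3 * k)) * (2 + 4 * k - S t * (1 + d t) - P t)) (by positivity)
      ?_ ?_ hL hl hLt ?_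
    · filter_upwards [hP, hQ, hS, hP0, hQ0, hS0] with t h1 h2 h3 p1 p2 p3
      convert! ((hasDerivAt_entropy c1 p1 h1).add (hasDerivAt_entropy c2 p2 h2)).add
        (hasDerivAt_entropy c3 p3 h3) using 1
      ring
    · filter_upwards [hP0, hQ0, hS0] with t p1 p2 p3
      exact add_nonneg (add_nonneg ((sq_nonneg _).trans (hφ0 c1 p1))
        ((sq_nonneg _).trans (hφ0 c2 p2))) ((sq_nonneg _).trans (hφ0 c3 p3))
    · have hd' : Tendsto (fun t => |d t|) (𝓝[>] a) (𝓝 0) := by simpa using hd.abs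
      filter_upwards [hd'.eventually_le_const (show (0 : ℝ) < 1 / 16 by norm_num),
        hd'.eventually_le_const (show 0 < r ^ 2 / (16 * (1 + 3 * k) ^ 2) by positivity)]
        with t h1 h2 hηV
      have hD : r ^ 2 ≤
          (P t - (1 + k)) ^ 2 + (Q t - (1 + 2 * k)) ^ 2 + (S t - (1 + 3 * k)) ^ 2 := by
        by_contra! hlt
        exact absurd (hrV (P t, Q t, S t) hlt) (not_lt.2 hηV)
      have h3 := lyapunov_rate_le (c := 1 + 3 * k) (p := P t - (1 + k)) (q := Q t - (1 + 2 * k))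
        (s := S t - (1 + 3 * k)) h1
      rw [le_div_iff₀ (by positivity)] at h2
      linarith
  have hlim : ∀ {c : ℝ} {X : ℝ → ℝ}, 0 < c → (∀ᶠ t in 𝓝[>] a, 0 < X t) →
      (∀ᶠ t in 𝓝[>] a, (√(X t) - √c) ^ 2 ≤ V t) → Tendsto X (𝓝[>] a) (𝓝 c) := by
    intro c X hc hX hXV
    have h1 : Tendsto (fun t => √(X t)) (𝓝[>] a) (𝓝 √c) := by
      rw [Metric.tendsto_nhds]
      intro ε hε
      filter_upwards [hXV, hV (ε ^ 2) (by positivity)] with t h1 h2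
      rw [Real.dist_eq]
      exact abs_lt_of_sq_lt_sq (h1.trans_lt h2) hε.le
    have h2 := h1.pow 2
    rw [Real.sq_sqrt hc.le] at h2
    refine h2.congr' ?_
    filter_upwards [hX] with t ht
    exact Real.sq_sqrt ht.le
  refine ⟨hlim c1 hP0 ?_, hlim c2 hQ0 ?_, hlim c3 hS0 ?_⟩ <;>
  · filter_upwards [hP0, hQ0, hS0] with t p1 p2 p3
    have h1 := hφ0 c1 p1
    have h2 := hφ0 c2 p2
    have h3 := hφ0 c3 p3
    have e1 := sq_nonneg (√(P t) - √(1 + k))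
    have e2 := sq_nonneg (√(Q t) - √(1 + 2 * k))
    have e3 := sq_nonneg (√(S t) - √(1 + 3 * k))
    simp only [V]
    linarith

end Lyapunov

/-! ### Asymptotics of the blow-up solutions -/

section Asymptotics

/-- A jet curve on `(y₀, b)` whose first component is a positive blow-up solution at `y₀`. -/
def IsBlowUpCurve (p y₀ b : ℝ) (u : ℝ → Fin 4 → ℝ) : Prop :=
  IsJetCurve p y₀ b u ∧ Tendsto (fun y => u y 0) (𝓝[>] y₀) atTop ∧
    Tendsto (fun y => profileRHS p y (u y) / u y 0 ^ p) (𝓝[>] y₀) (𝓝 1)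

theorem abs_rpow_mul_self {p x : ℝ} (hx : 0 < x) : |x| ^ (p - 1) * x = x ^ p := by
  rw [abs_of_pos hx, Real.rpow_sub_one hx.ne', div_mul_cancel₀ _ hx.ne']

theorem IsBlowUpSolution.isBlowUpCurve {p y₀ b : ℝ} (hb : y₀ < b) {f : ℝ → ℝ}
    (hf : IsBlowUpSolution p 1 y₀ b f) : IsBlowUpCurve p y₀ b (jet f) := by
  have hf0 : Tendsto (fun y => jet f y 0) (𝓝[>] y₀) atTop := by simpa [jet] using hf.2.1
  refine ⟨hf.1.isJetCurve, hf0, hf.2.2.congr' ?_⟩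
  filter_upwards [hf0.eventually_gt_atTop 0, Ioo_mem_nhdsGT hb] with y hy hyb
  have h0 : 0 < f y := by simpa [jet] using hy
  have h4 := hf.1.2 y hyb
  rw [abs_rpow_mul_self h0]
  simp only [profileRHS, jet, Fin.val_zero, Fin.val_one, iteratedDeriv_zero, iteratedDeriv_one]
  congr 1
  linarith

theorem IsBlowUpCurve.isBlowUpSolution {p y₀ b : ℝ} (hp : 1 < p) (hb : y₀ < b)
    {u : ℝ → Fin 4 → ℝ} (hu : IsBlowUpCurve p y₀ b u) :
    IsBlowUpSolution p 1 y₀ b (fun y => u y 0) := by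
  refine ⟨hu.1.isProfileSolution hp, by simpa using hu.2.1, hu.2.2.congr' ?_⟩
  filter_upwards [hu.2.1.eventually_gt_atTop 0, Ioo_mem_nhdsGT hb] with y hy hyb
  rw [abs_rpow_mul_self hy, hu.1.iteratedDeriv_four hyb]

theorem eventually_neg_of_deriv_pos {a : ℝ} {g g' : ℝ → ℝ}
    (hg : ∀ᶠ t in 𝓝[>] a, HasDerivAt g (g' t) t) (hg' : ∀ᶠ t in 𝓝[>] a, 0 < g' t)
    (hneg : ∃ᶠ t in 𝓝[>] a, g t < 0) : ∀ᶠ t in 𝓝[>] a, g t < 0 := by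
  obtain ⟨b, hb, hsub⟩ := mem_nhdsGT_iff_exists_Ioo_subset.1 (hg.and hg')
  have hsub' : ∀ t ∈ Ioo a b, HasDerivAt g (g' t) t ∧ 0 < g' t := fun t ht => hsub ht
  obtain ⟨c, hc, hcb⟩ := (hneg.and_eventually (Ioo_mem_nhdsGT hb)).exists
  filter_upwards [Ioo_mem_nhdsGT hcb.1] with t ht
  have hmono : MonotoneOn g (Ioo a b) :=
    monotoneOn_of_hasDerivWithinAt_nonneg (f' := g') (convex_Ioo a b)
      (fun t ht => (hsub' t ht).1.continuousAt.continuousWithinAt)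
      (fun t ht => (hsub' t (interior_subset ht)).1.hasDerivWithinAt)
      (fun t ht => (hsub' t (interior_subset ht)).2.le)
  exact (hmono ⟨ht.1, ht.2.trans hcb.2⟩ hcb ht.2.le).trans_lt hc

theorem exists_le_of_deriv_bounded_below {a : ℝ} {g g' : ℝ → ℝ}
    (hg : ∀ᶠ t in 𝓝[>] a, HasDerivAt g (g' t) t) (hg' : ∃ C, ∀ᶠ t in 𝓝[>] a, -C ≤ g' t) :
    ∃ C, ∀ᶠ t in 𝓝[>] a, g t ≤ C := by
  obtain ⟨C, hC⟩ := hg'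
  obtain ⟨b, hb, hsub⟩ := mem_nhdsGT_iff_exists_Ioo_subset.1 (hg.and hC)
  have hsub' : ∀ t ∈ Ioo a b, HasDerivAt g (g' t) t ∧ -C ≤ g' t := fun t ht => hsub ht
  have hd : ∀ t ∈ Ioo a b, HasDerivAt (fun t => g t + C * t) (g' t + C) t := fun t ht => by
    convert! (hsub' t ht).1.add ((hasDerivAt_id t).const_mul C) using 1
    rw [mul_one]
  have hmono : MonotoneOn (fun t => g t + C * t) (Ioo a b) :=
    monotoneOn_of_hasDerivWithinAt_nonneg (f' := fun t => g' t + C) (convex_Ioo a b)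
      (fun t ht => (hd t ht).continuousAt.continuousWithinAt)
      (fun t ht => (hd t (interior_subset ht)).hasDerivWithinAt)
      (fun t ht => by linarith [(hsub' t (interior_subset ht)).2])
  obtain ⟨c, hc⟩ := exists_between (show a < b from hb)
  refine ⟨g c + C * c + |C| * (|a| + |c|), ?_⟩
  filter_upwards [Ioo_mem_nhdsGT hc.1] with t ht
  have h1 := hmono ⟨ht.1, ht.2.trans hc.2⟩ hc ht.2.le
  simp only at h1
  have h2 : |t| ≤ |a| + |c| := by
    rw [abs_le]
    constructor
    · linarith [ht.1, neg_abs_le a, abs_nonneg c]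
    · linarith [ht.2, le_abs_self c, abs_nonneg a]
  have h3 : -(C * t) ≤ |C| * (|a| + |c|) :=
    (neg_le_abs _).trans ((abs_mul C t).le.trans (mul_le_mul_of_nonneg_left h2 (abs_nonneg C)))
  linarith

theorem IsJetCurve.eventually_hasDerivAt {p y₀ b : ℝ} (hb : y₀ < b) {u : ℝ → Fin 4 → ℝ}
    (hu : IsJetCurve p y₀ b u) (i : Fin 4) :
    ∀ᶠ t in 𝓝[>] y₀, HasDerivAt (fun t => u t i) (profileField p t (u t) i) t := by
  filter_upwards [Ioo_mem_nhdsGT hb] with t ht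
  exact hasDerivAt_pi.1 (hu t ht) i

theorem IsBlowUpCurve.eventually_profileRHS_pos {p y₀ b : ℝ}
    {u : ℝ → Fin 4 → ℝ} (hu : IsBlowUpCurve p y₀ b u) :
    ∀ᶠ t in 𝓝[>] y₀, 0 < u t 0 ∧ 0 < profileRHS p t (u t) := by
  filter_upwards [hu.2.1.eventually_gt_atTop 0, hu.2.2.eventually_const_lt one_pos] with t h0 h1
  refine ⟨h0, ?_⟩
  have h2 := Real.rpow_pos_of_pos h0 p
  rw [lt_div_iff₀ h2] at h1
  simpa using h1

/-- Near the blow-up point the derivatives alternate in sign: each is monotone, and if it were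
bounded on the relevant side, then `f` would be bounded. -/
theorem IsBlowUpCurve.eventually_signs {p y₀ b : ℝ} (hb : y₀ < b)
    {u : ℝ → Fin 4 → ℝ} (hu : IsBlowUpCurve p y₀ b u) :
    ∀ᶠ t in 𝓝[>] y₀, 0 < u t 0 ∧ u t 1 < 0 ∧ 0 < u t 2 ∧ u t 3 < 0 := by
  have d0 : ∀ᶠ t in 𝓝[>] y₀, HasDerivAt (fun t => u t 0) (u t 1) t :=
    hu.1.eventually_hasDerivAt hb 0
  have d1 : ∀ᶠ t in 𝓝[>] y₀, HasDerivAt (fun t => u t 1) (u t 2) t :=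
    hu.1.eventually_hasDerivAt hb 1
  have d2 : ∀ᶠ t in 𝓝[>] y₀, HasDerivAt (fun t => u t 2) (u t 3) t :=
    hu.1.eventually_hasDerivAt hb 2
  have d3 : ∀ᶠ t in 𝓝[>] y₀, HasDerivAt (fun t => u t 3) (profileRHS p t (u t)) t :=
    hu.1.eventually_hasDerivAt hb 3
  have b0 : ¬ ∃ C, ∀ᶠ t in 𝓝[>] y₀, u t 0 ≤ C := by
    rintro ⟨C, hC⟩
    obtain ⟨t, h1, h2⟩ := (hC.and (hu.2.1.eventually_gt_atTop C)).exists
    linarith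
  have b1 : ¬ ∃ C, ∀ᶠ t in 𝓝[>] y₀, -C ≤ u t 1 := fun h =>
    b0 (exists_le_of_deriv_bounded_below d0 h)
  have b2 : ¬ ∃ C, ∀ᶠ t in 𝓝[>] y₀, u t 2 ≤ C := by
    rintro ⟨C, hC⟩
    obtain ⟨C', hC'⟩ := exists_le_of_deriv_bounded_below (g := fun t => -u t 1)
      (d1.mono fun t ht => ht.neg) ⟨C, hC.mono fun t ht => neg_le_neg ht⟩
    exact b1 ⟨C', hC'.mono fun t ht => by linarith⟩
  have b3 : ¬ ∃ C, ∀ᶠ t in 𝓝[>] y₀, -C ≤ u t 3 := fun h =>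
    b2 (exists_le_of_deriv_bounded_below d2 h)
  have s3 : ∀ᶠ t in 𝓝[>] y₀, u t 3 < 0 := by
    refine eventually_neg_of_deriv_pos d3 (hu.eventually_profileRHS_pos.mono fun t h => h.2) ?_
    by_contra hcon
    exact b3 ⟨0, (not_frequently.1 hcon).mono fun t ht => by linarith⟩
  have s2 : ∀ᶠ t in 𝓝[>] y₀, -u t 2 < 0 := by
    refine eventually_neg_of_deriv_pos (d2.mono fun t ht => ht.neg)
      (s3.mono fun t ht => neg_pos.2 ht) ?_
    by_contra hcon
    exact b2 ⟨0, (not_frequently.1 hcon).mono fun t ht => by linarith⟩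
  have s1 : ∀ᶠ t in 𝓝[>] y₀, u t 1 < 0 := by
    refine eventually_neg_of_deriv_pos d1 (s2.mono fun t ht => neg_lt_zero.1 ht) ?_
    by_contra hcon
    exact b1 ⟨0, (not_frequently.1 hcon).mono fun t ht => by linarith⟩
  filter_upwards [hu.eventually_profileRHS_pos, s1, s2, s3] with t h0 h1 h2 h3
  exact ⟨h0.1, h1, neg_lt_zero.1 h2, h3⟩

/-- The scale-invariant quotients converge to their values on the explicit solution. -/
theorem IsBlowUpCurve.tendsto_quotients {p y₀ b : ℝ} (hp : 1 < p) (hb : y₀ < b)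
    {u : ℝ → Fin 4 → ℝ} (hu : IsBlowUpCurve p y₀ b u) :
    Tendsto (fun t => u t 0 * u t 2 / u t 1 ^ 2) (𝓝[>] y₀) (𝓝 (1 + (p - 1) / 4)) ∧
    Tendsto (fun t => u t 0 * u t 3 / (u t 1 * u t 2)) (𝓝[>] y₀) (𝓝 (1 + 2 * ((p - 1) / 4))) ∧
    Tendsto (fun t => u t 0 ^ (p + 1) / (u t 1 * u t 3)) (𝓝[>] y₀)
      (𝓝 (1 + 3 * ((p - 1) / 4))) := by
  have hs := hu.eventually_signs hb
  have d0 : ∀ᶠ t in 𝓝[>] y₀, HasDerivAt (fun t => u t 0) (u t 1) t :=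
    hu.1.eventually_hasDerivAt hb 0
  have d1 : ∀ᶠ t in 𝓝[>] y₀, HasDerivAt (fun t => u t 1) (u t 2) t :=
    hu.1.eventually_hasDerivAt hb 1
  have d2 : ∀ᶠ t in 𝓝[>] y₀, HasDerivAt (fun t => u t 2) (u t 3) t :=
    hu.1.eventually_hasDerivAt hb 2
  have d3 : ∀ᶠ t in 𝓝[>] y₀, HasDerivAt (fun t => u t 3) (profileRHS p t (u t)) t :=
    hu.1.eventually_hasDerivAt hb 3
  refine tendsto_lotkaVolterra (L := fun t => Real.log (u t 0)) (l := fun t => u t 1 / u t 0)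
    (d := fun t => profileRHS p t (u t) / u t 0 ^ p - 1) (by linarith) ?_ ?_
    (Real.tendsto_log_atTop.comp hu.2.1) (by simpa using hu.2.2.sub_const 1) ?_ ?_ ?_ ?_ ?_ ?_
  · filter_upwards [hs, d0] with t h e0
    exact e0.log h.1.ne'
  · filter_upwards [hs] with t h
    exact div_neg_of_neg_of_pos h.2.1 h.1
  · filter_upwards [hs] with t ⟨h0, h1, h2, h3⟩
    exact div_pos (mul_pos h0 h2) (sq_pos_of_neg h1)
  · filter_upwards [hs] with t ⟨h0, h1, h2, h3⟩
    exact div_pos_of_neg_of_neg (mul_neg_of_pos_of_neg h0 h3) (mul_neg_of_neg_of_pos h1 h2)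
  · filter_upwards [hs] with t ⟨h0, h1, h2, h3⟩
    exact div_pos (by positivity) (mul_pos_of_neg_of_neg h1 h3)
  · filter_upwards [hs, d0, d1, d2] with t ⟨h0, h1, h2, h3⟩ e0 e1 e2
    have := h1.ne
    convert! (e0.mul e2).div (e1.pow 2) (pow_ne_zero 2 this) using 1
    simp only [Pi.mul_apply, Pi.pow_apply]
    field_simp
    ring
  · filter_upwards [hs, d0, d1, d2, d3] with t ⟨h0, h1, h2, h3⟩ e0 e1 e2 e3
    have h1' := h1.ne
    have h3' := h3.ne
    have hA := Real.rpow_pos_of_pos h0 p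
    have hA1 := Real.rpow_add_one h0.ne' p
    convert! (e0.mul e3).div (e1.mul e2) (mul_ne_zero h1' h2.ne') using 1
    rw [hA1]
    simp only [Pi.mul_apply]
    field_simp
    ring
  · filter_upwards [hs, d0, d1, d2, d3] with t ⟨h0, h1, h2, h3⟩ e0 e1 e2 e3
    have h1' := h1.ne
    have h3' := h3.ne
    have hA := Real.rpow_pos_of_pos h0 p
    have hA1 := Real.rpow_add_one h0.ne' p
    convert! (e0.rpow_const (p := p + 1) (Or.inl h0.ne')).div (e1.mul e3)
      (mul_ne_zero h1' h3') using 1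
    simp only [Pi.mul_apply]
    rw [hA1, add_sub_cancel_right]
    field_simp
    ring

end Asymptotics

/-! ### The stable set of the explicit solution -/

section StableSet

theorem tendsto_sub_nhdsGT (a : ℝ) : Tendsto (fun t => t - a) (𝓝[>] a) (𝓝[>] 0) := by
  refine tendsto_nhdsWithin_iff.2 ⟨?_, ?_⟩
  · have : Tendsto (fun t => t - a) (𝓝 a) (𝓝 (a - a)) := tendsto_id.sub_const a
    rw [sub_self] at this
    exact this.mono_left nhdsWithin_le_nhds
  · filter_upwards [self_mem_nhdsWithin] with t ht
    exact sub_pos.2 (show a < t from ht)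

/-- The limit of the derivative of `f^(-(p-1)/4)` at a blow-up point. -/
noncomputable def blowUpSlope (p : ℝ) : ℝ :=
  (p - 1) / 4 * ((1 + (p - 1) / 4) * (1 + 2 * ((p - 1) / 4)) * (1 + 3 * ((p - 1) / 4))) ^
    (-(1 / 4) : ℝ)

theorem blowUpSlope_pos {p : ℝ} (hp : 1 < p) : 0 < blowUpSlope p := by
  have : 0 < (p - 1) / 4 := by linarith
  unfold blowUpSlope
  positivity

theorem eulerPhi_rpow_eq {p : ℝ} (hp : 1 < p) :
    eulerPhi (-4 / (p - 1)) ^ (1 / (p - 1)) = blowUpSlope p ^ (-4 / (p - 1)) := by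
  have hc := blowUpSlope_pos hp
  have hp' : p - 1 ≠ 0 := by linarith
  have hk : 0 < (p - 1) / 4 := by linarith
  have h1 : eulerPhi (-4 / (p - 1)) = blowUpSlope p ^ (-4 : ℝ) := by
    unfold blowUpSlope
    rw [Real.mul_rpow hk.le (by positivity), ← Real.rpow_mul (by positivity),
      show (-(1 / 4) : ℝ) * -4 = 1 by norm_num, Real.rpow_one,
      show (-4 : ℝ) = ((-4 : ℤ) : ℝ) by norm_num, Real.rpow_intCast]
    unfold eulerPhi
    field_simp
    push_cast
    ring
  rw [h1, ← Real.rpow_mul hc.le, mul_one_div]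

/-- `f^(-(p-1)/4)` vanishes linearly at a blow-up point, with the slope of the explicit solution. -/
theorem IsBlowUpCurve.tendsto_slope {p y₀ b : ℝ} (hp : 1 < p) (hb : y₀ < b)
    {u : ℝ → Fin 4 → ℝ} (hu : IsBlowUpCurve p y₀ b u) :
    Tendsto (fun t => -((p - 1) / 4) * u t 0 ^ (-((p - 1) / 4) - 1) * u t 1) (𝓝[>] y₀)
      (𝓝 (blowUpSlope p)) ∧
    Tendsto (fun t => u t 0 ^ (-((p - 1) / 4)) / (t - y₀)) (𝓝[>] y₀) (𝓝 (blowUpSlope p)) := by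
  have hk : 0 < (p - 1) / 4 := by linarith
  have hs := hu.eventually_signs hb
  obtain ⟨hP, hQ, hS⟩ := hu.tendsto_quotients hp hb
  have h1 : Tendsto (fun t => -((p - 1) / 4) * u t 0 ^ (-((p - 1) / 4) - 1) * u t 1) (𝓝[>] y₀)
      (𝓝 (blowUpSlope p)) := by
    have hlim := (((hP.mul hQ).mul hS).rpow_const (p := (-(1 / 4) : ℝ))
      (Or.inl (by positivity))).const_mul ((p - 1) / 4)
    refine hlim.congr' ?_
    filter_upwards [hs] with t ⟨h0, h1, h2, h3⟩
    have hA1 : u t 0 ^ (p + 1) * u t 0 ^ 2 = u t 0 ^ (p + 3) := by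
      rw [← Real.rpow_natCast, ← Real.rpow_add h0]; norm_num [add_assoc]
    have hprod : u t 0 * u t 2 / u t 1 ^ 2 * (u t 0 * u t 3 / (u t 1 * u t 2))
        * (u t 0 ^ (p + 1) / (u t 1 * u t 3)) = u t 0 ^ (p + 3) * ((-u t 1) ^ 4)⁻¹ := by
      rw [← hA1]
      have := h1.ne
      have := h3.ne
      field_simp
    have hroot : (((-u t 1) ^ 4)⁻¹) ^ (-(1 / 4) : ℝ) = -u t 1 := by
      rw [Real.rpow_neg (by positivity), Real.inv_rpow (by positivity), inv_inv,
        show (1 / 4 : ℝ) = ((4 : ℕ) : ℝ)⁻¹ by norm_num,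
        Real.pow_rpow_inv_natCast (by linarith) (by norm_num)]
    rw [hprod, Real.mul_rpow (by positivity) (by positivity), hroot, ← Real.rpow_mul h0.le,
      show (p + 3) * (-(1 / 4)) = -((p - 1) / 4) - 1 by ring]
    ring
  refine ⟨h1, ?_⟩
  refine HasDerivAt.lhopital_zero_nhdsGT
    (f' := fun t => -((p - 1) / 4) * u t 0 ^ (-((p - 1) / 4) - 1) * u t 1) (g' := fun _ => 1)
    ?_ (.of_forall fun t => (hasDerivAt_id t).sub_const y₀) (by simp) ?_ ?_ (by simpa using h1)
  · filter_upwards [hs, hu.1.eventually_hasDerivAt hb 0] with t h e0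
    convert! e0.rpow_const (p := -((p - 1) / 4)) (Or.inl h.1.ne') using 1
    simp only [profileField, Matrix.cons_val_zero]
    ring
  · exact (tendsto_rpow_neg_atTop hk).comp hu.2.1
  · exact (tendsto_sub_nhdsGT y₀).mono_right nhdsWithin_le_nhds

theorem iteratedDeriv_explicitBlowUp (p y₀ : ℝ) (k : ℕ) {y : ℝ} (hy : y₀ < y) :
    iteratedDeriv k (explicitBlowUp p y₀) y = eulerPhi (-4 / (p - 1)) ^ (1 / (p - 1)) *
      (∏ i ∈ Finset.range k, (-4 / (p - 1) - i)) *
        ((y - y₀) ^ (-4 / (p - 1)) / (y - y₀) ^ k) := by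
  rw [← Real.rpow_sub_natCast (sub_pos.2 hy).ne']
  exact iteratedDeriv_rpow y₀ _ _ k hy

theorem IsBlowUpCurve.tendsto_ratio {p y₀ b : ℝ} (hp : 1 < p) (hb : y₀ < b)
    {u : ℝ → Fin 4 → ℝ} (hu : IsBlowUpCurve p y₀ b u) (k : Fin 4) :
    Tendsto (fun y => u y k / iteratedDeriv k (explicitBlowUp p y₀) y) (𝓝[>] y₀) (𝓝 1) := by
  have hp' : p - 1 ≠ 0 := by linarith
  have hk : 0 < (p - 1) / 4 := by linarith
  have hc := blowUpSlope_pos hp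
  have hs := hu.eventually_signs hb
  obtain ⟨hP, hQ, hS⟩ := hu.tendsto_quotients hp hb
  obtain ⟨hθ', hθ⟩ := hu.tendsto_slope hp hb
  set A := eulerPhi (-4 / (p - 1)) ^ (1 / (p - 1)) with hA
  have hA0 : A ≠ 0 := (Real.rpow_pos_of_pos (eulerPhi_exponent_pos hp) _).ne'
  have hgt : ∀ᶠ y in 𝓝[>] y₀, y₀ < y := self_mem_nhdsWithin
  have r0 : Tendsto (fun y => u y 0 / iteratedDeriv 0 (explicitBlowUp p y₀) y) (𝓝[>] y₀)
      (𝓝 1) := by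
    have h1 := (hθ.rpow_const (p := -4 / (p - 1)) (Or.inl hc.ne')).div_const A
    rw [hA, eulerPhi_rpow_eq hp, div_self (by positivity)] at h1
    refine h1.congr' ?_
    filter_upwards [hs, hgt] with y ⟨h0, _⟩ hy
    rw [iteratedDeriv_explicitBlowUp _ _ _ hy, Real.div_rpow (by positivity) (sub_pos.2 hy).le,
      ← Real.rpow_mul h0.le, show -((p - 1) / 4) * (-4 / (p - 1)) = 1 by field_simp, Real.rpow_one,
      eulerPhi_rpow_eq hp]
    simp only [Finset.range_zero, Finset.prod_empty, pow_zero, div_one, mul_one]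
    rw [div_div, mul_comm]
  have r1 : Tendsto (fun y => u y 1 / iteratedDeriv 1 (explicitBlowUp p y₀) y) (𝓝[>] y₀)
      (𝓝 1) := by
    have h1 := r0.mul (hθ'.div hθ hc.ne')
    rw [div_self hc.ne', mul_one] at h1
    refine h1.congr' ?_
    filter_upwards [hs, hgt] with y ⟨h0, _⟩ hy
    have hx := (sub_pos.2 hy).ne'
    have hX := (Real.rpow_pos_of_pos (sub_pos.2 hy) (-4 / (p - 1))).ne'
    have hU := (Real.rpow_pos_of_pos h0 (-((p - 1) / 4))).ne'
    simp only [Pi.div_apply]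
    rw [iteratedDeriv_explicitBlowUp _ _ _ hy, iteratedDeriv_explicitBlowUp _ _ _ hy, ← hA,
      Real.rpow_sub_one h0.ne']
    simp only [Finset.prod_range_succ, Finset.range_zero, Finset.prod_empty, Nat.cast_zero]
    field_simp
    ring
  have r2 : Tendsto (fun y => u y 2 / iteratedDeriv 2 (explicitBlowUp p y₀) y) (𝓝[>] y₀)
      (𝓝 1) := by
    have h1 := ((hP.mul (r1.pow 2)).div r0 one_ne_zero).div_const (1 + (p - 1) / 4)
    rw [one_pow, mul_one, div_one, div_self (by positivity)] at h1
    refine h1.congr' ?_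
    filter_upwards [hs, hgt] with y ⟨h0, h1, _⟩ hy
    have hx := (sub_pos.2 hy).ne'
    have h1' := h1.ne
    have hX := (Real.rpow_pos_of_pos (sub_pos.2 hy) (-4 / (p - 1))).ne'
    have e1 : -4 / (p - 1) - 1 ≠ 0 := by
      have : 0 < 4 / (p - 1) := by apply div_pos <;> linarith
      rw [neg_div]; linarith
    have e2 : (1 + (p - 1) / 4) = -(p - 1) / 4 * (-4 / (p - 1) - 1) := by field_simp; ring
    simp only [Pi.div_apply]
    rw [iteratedDeriv_explicitBlowUp _ _ _ hy, iteratedDeriv_explicitBlowUp _ _ _ hy,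
      iteratedDeriv_explicitBlowUp _ _ _ hy, ← hA, e2]
    simp only [Finset.prod_range_succ, Finset.range_zero, Finset.prod_empty, Nat.cast_zero,
      Nat.cast_one]
    generalize -4 / (p - 1) - 1 = E at *
    field_simp
    ring
  have r3 : Tendsto (fun y => u y 3 / iteratedDeriv 3 (explicitBlowUp p y₀) y) (𝓝[>] y₀)
      (𝓝 1) := by
    have h1 := ((hQ.mul (r1.mul r2)).div r0 one_ne_zero).div_const (1 + 2 * ((p - 1) / 4))
    rw [one_mul, mul_one, div_one, div_self (by positivity)] at h1
    refine h1.congr' ?_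
    filter_upwards [hs, hgt] with y ⟨h0, h1, h2, _⟩ hy
    have hx := (sub_pos.2 hy).ne'
    have h1' := h1.ne
    have hX := (Real.rpow_pos_of_pos (sub_pos.2 hy) (-4 / (p - 1))).ne'
    have : 0 < 4 / (p - 1) := by apply div_pos <;> linarith
    have e1 : -4 / (p - 1) - 1 ≠ 0 := by rw [neg_div]; linarith
    have e2 : -4 / (p - 1) - 2 ≠ 0 := by rw [neg_div]; linarith
    have e3 : (1 + 2 * ((p - 1) / 4)) = -(p - 1) / 4 * (-4 / (p - 1) - 2) := by field_simp; ring
    simp only [Pi.div_apply]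
    rw [iteratedDeriv_explicitBlowUp _ _ _ hy, iteratedDeriv_explicitBlowUp _ _ _ hy,
      iteratedDeriv_explicitBlowUp _ _ _ hy, iteratedDeriv_explicitBlowUp _ _ _ hy, ← hA, e3]
    simp only [Finset.prod_range_succ, Finset.range_zero, Finset.prod_empty, Nat.cast_zero,
      Nat.cast_one, Nat.cast_ofNat]
    generalize -4 / (p - 1) - 1 = E at *
    generalize -4 / (p - 1) - 2 = E' at *
    field_simp
    ring
  fin_cases k
  exacts [r0, r1, r2, r3]

theorem isBlowUpCurve_of_tendsto_ratio {p y₀ b : ℝ} (hp : 1 < p)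
    {u : ℝ → Fin 4 → ℝ} (hu : IsJetCurve p y₀ b u)
    (h0 : Tendsto (fun y => u y 0 / iteratedDeriv 0 (explicitBlowUp p y₀) y) (𝓝[>] y₀) (𝓝 1))
    (h1 : Tendsto (fun y => u y 1 / iteratedDeriv 1 (explicitBlowUp p y₀) y) (𝓝[>] y₀) (𝓝 1)) :
    IsBlowUpCurve p y₀ b u := by
  have hp' : p - 1 ≠ 0 := by linarith
  have hr : 0 < 4 / (p - 1) := by apply div_pos <;> linarith
  have hΦ := eulerPhi_exponent_pos hp
  set A := eulerPhi (-4 / (p - 1)) ^ (1 / (p - 1)) with hA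
  have hA0 : 0 < A := Real.rpow_pos_of_pos hΦ _
  have hgt : ∀ᶠ y in 𝓝[>] y₀, y₀ < y := self_mem_nhdsWithin
  have hu0 : Tendsto (fun y => u y 0) (𝓝[>] y₀) atTop := by
    have h2 : Tendsto (fun y => A * (y - y₀) ^ (-4 / (p - 1))) (𝓝[>] y₀) atTop := by
      rw [neg_div]
      exact ((tendsto_rpow_neg_nhdsGT_zero (neg_lt_zero.2 hr)).comp
        (tendsto_sub_nhdsGT y₀)).const_mul_atTop hA0
    refine (h0.pos_mul_atTop one_pos h2).congr' ?_
    filter_upwards [hgt] with y hy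
    have hX := Real.rpow_pos_of_pos (sub_pos.2 hy) (-4 / (p - 1))
    rw [iteratedDeriv_explicitBlowUp _ _ _ hy, ← hA]
    simp only [Finset.range_zero, Finset.prod_empty, pow_zero, div_one, mul_one]
    rw [div_mul_cancel₀ _ (by positivity)]
  refine ⟨hu, hu0, ?_⟩
  have l1 : Tendsto (fun y => u y 0 ^ (-(p - 1))) (𝓝[>] y₀) (𝓝 0) :=
    (tendsto_rpow_neg_atTop (by linarith)).comp hu0
  have l2 : Tendsto (fun y => u y 1 / u y 0 ^ p) (𝓝[>] y₀) (𝓝 0) := by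
    have hx3 : Tendsto (fun y => (y - y₀) ^ 3) (𝓝[>] y₀) (𝓝 0) := by
      have := ((tendsto_sub_nhdsGT y₀).mono_right nhdsWithin_le_nhds).pow 3
      simpa using this
    have h2 := ((h1.div (h0.rpow_const (p := p) (Or.inl one_ne_zero)) (by simp)).mul hx3).const_mul
      (-4 / (p - 1) * (A / A ^ p))
    rw [mul_zero, mul_zero] at h2
    refine h2.congr' ?_
    filter_upwards [hgt, hu0.eventually_gt_atTop 0] with y hy hy0
    have hx := sub_pos.2 hy
    have hX := Real.rpow_pos_of_pos hx (-4 / (p - 1))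
    have hXp : ((y - y₀) ^ (-4 / (p - 1))) ^ p = (y - y₀) ^ (-4 / (p - 1)) / (y - y₀) ^ 4 := by
      rw [← Real.rpow_mul hx.le, ← Real.rpow_sub_natCast hx.ne']
      congr 1
      push_cast
      field_simp
      ring
    simp only [Pi.div_apply]
    rw [iteratedDeriv_explicitBlowUp _ _ _ hy, iteratedDeriv_explicitBlowUp _ _ _ hy, ← hA]
    simp only [Finset.prod_range_succ, Finset.range_zero, Finset.prod_empty, pow_zero, div_one,
      mul_one, one_mul, pow_one, Nat.cast_zero, sub_zero]
    rw [Real.div_rpow hy0.le (by positivity), Real.mul_rpow hA0.le hX.le, hXp]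
    have hAp := Real.rpow_pos_of_pos hA0 p
    have hup := Real.rpow_pos_of_pos hy0 p
    have : (-4 : ℝ) / (p - 1) ≠ 0 := by rw [neg_div]; linarith
    generalize (-4 : ℝ) / (p - 1) = r at *
    field_simp
  have hy : Tendsto (fun y : ℝ => y) (𝓝[>] y₀) (𝓝 y₀) := tendsto_id.mono_left nhdsWithin_le_nhds
  have l3 := (l1.div_const (p - 1)).const_sub 1 |>.sub ((hy.const_mul (1 / 4)).mul l2)
  rw [zero_div, sub_zero, mul_zero, sub_zero] at l3
  refine l3.congr' ?_
  filter_upwards [hu0.eventually_gt_atTop 0] with y hy0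
  have hup := Real.rpow_pos_of_pos hy0 p
  rw [profileRHS, abs_rpow_mul_self hy0, neg_sub, Real.rpow_sub hy0, Real.rpow_one]
  field_simp

end StableSet

/-! ### The logarithmic system near its line of equilibria -/

noncomputable section LogSystem

open BoundedContinuousFunction NormedSpace

/-- The linear part at the origin of the system for `w`, the logarithms of the quotients
`f f''/f'²`, `f f'''/(f' f'')`, `f^(p+1)/(f' f''')` divided by their limits `1 + k`, `1 + 2k`,
`1 + 3k`, where `k = (p-1)/4`. -/
def logLinear (k : ℝ) : (ℝ × ℝ × ℝ) →L[ℝ] (ℝ × ℝ × ℝ) :=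
  let w₁ := ContinuousLinearMap.fst ℝ ℝ (ℝ × ℝ)
  let w₂ := (ContinuousLinearMap.fst ℝ ℝ ℝ).comp (ContinuousLinearMap.snd ℝ ℝ (ℝ × ℝ))
  let w₃ := (ContinuousLinearMap.snd ℝ ℝ ℝ).comp (ContinuousLinearMap.snd ℝ ℝ (ℝ × ℝ))
  ((1 + 2 * k) • w₂ - (2 * (1 + k)) • w₁).prod
    (((1 + 3 * k) • w₃ - (1 + 2 * k) • w₂ - (1 + k) • w₁).prod
      (-((1 + 3 * k) • w₃) - (1 + k) • w₁))

theorem logLinear_apply (k : ℝ) (w : ℝ × ℝ × ℝ) :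
    logLinear k w = ((1 + 2 * k) * w.2.1 - 2 * (1 + k) * w.1,
      (1 + 3 * k) * w.2.2 - (1 + 2 * k) * w.2.1 - (1 + k) * w.1,
      -((1 + 3 * k) * w.2.2) - (1 + k) * w.1) := rfl

/-- The quadratic form `∑ (1 + i k) wᵢ²` decays along the linear flow: it is the Hessian of the
Lotka–Volterra Lyapunov function. -/
theorem norm_exp_logLinear_le {k : ℝ} (hk : 0 < k) {s : ℝ} (hs : 0 ≤ s) :
    ‖exp (s • logLinear k)‖ ≤ √(3 * (1 + 3 * k)) * Real.exp (-(1 / 4) * s) := by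
  refine ContinuousLinearMap.opNorm_le_bound _ (by positivity) fun w => ?_
  let q : ℝ × ℝ × ℝ → ℝ := fun w =>
    (1 + k) * w.1 ^ 2 + (1 + 2 * k) * w.2.1 ^ 2 + (1 + 3 * k) * w.2.2 ^ 2
  have hq1 : ∀ w, ‖w‖ ^ 2 ≤ q w := by
    intro w
    have h1 : ‖w‖ ^ 2 ≤ w.1 ^ 2 + w.2.1 ^ 2 + w.2.2 ^ 2 := by
      rw [Prod.norm_def, Prod.norm_def]
      rcases max_cases ‖w.1‖ (max ‖w.2.1‖ ‖w.2.2‖) with h | h <;> rw [h.1]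
      · rw [Real.norm_eq_abs, sq_abs]; nlinarith
      · rcases max_cases ‖w.2.1‖ ‖w.2.2‖ with h | h <;> rw [h.1] <;>
          rw [Real.norm_eq_abs, sq_abs] <;> nlinarith
    simp only [q]
    nlinarith [mul_nonneg hk.le (sq_nonneg w.1), mul_nonneg hk.le (sq_nonneg w.2.1),
      mul_nonneg hk.le (sq_nonneg w.2.2)]
  have hq2 : ∀ w, q w ≤ 3 * (1 + 3 * k) * ‖w‖ ^ 2 := by
    intro w
    have h1 : w.1 ^ 2 ≤ ‖w‖ ^ 2 := by
      rw [← sq_abs]; gcongr; exact norm_fst_le w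
    have h2 : w.2.1 ^ 2 ≤ ‖w‖ ^ 2 := by
      rw [← sq_abs]; gcongr; exact (norm_fst_le w.2).trans (norm_snd_le w)
    have h3 : w.2.2 ^ 2 ≤ ‖w‖ ^ 2 := by
      rw [← sq_abs]; gcongr; exact (norm_snd_le w.2).trans (norm_snd_le w)
    simp only [q]
    nlinarith [mul_nonneg hk.le (sq_nonneg w.1), mul_nonneg hk.le (sq_nonneg w.2.1),
      mul_nonneg hk.le (sub_nonneg.2 h1), mul_nonneg hk.le (sub_nonneg.2 h2),
      mul_nonneg hk.le (sub_nonneg.2 h3)]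
  let v : ℝ → ℝ × ℝ × ℝ := fun s => exp (s • logLinear k) w
  have hv : ∀ s, HasDerivAt v (logLinear k (v s)) s := fun s =>
    (ContinuousLinearMap.apply ℝ (ℝ × ℝ × ℝ) w).hasFDerivAt.comp_hasDerivAt s
      (hasDerivAt_exp_smul_const' (𝕂 := ℝ) (logLinear k) s)
  have hanti : Antitone fun s => Real.exp (s / 2) * q (v s) := by
    refine antitone_of_hasDerivAt_nonpos (f' := fun s => Real.exp (s / 2) *
      (1 / 2 * q (v s) + 2 * ((1 + k) * (v s).1 * (logLinear k (v s)).1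
        + (1 + 2 * k) * (v s).2.1 * (logLinear k (v s)).2.1
        + (1 + 3 * k) * (v s).2.2 * (logLinear k (v s)).2.2))) (fun s => ?_) (fun s => ?_)
    · have h1 : HasDerivAt (fun s => (v s).1) (logLinear k (v s)).1 s := (hv s).fst
      have h2 : HasDerivAt (fun s => (v s).2.1) (logLinear k (v s)).2.1 s :=
        (hv s).snd.fst
      have h3 : HasDerivAt (fun s => (v s).2.2) (logLinear k (v s)).2.2 s :=
        (hv s).snd.snd
      have h4 := ((((h1.pow 2).const_mul (1 + k)).add ((h2.pow 2).const_mul (1 + 2 * k))).add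
        ((h3.pow 2).const_mul (1 + 3 * k)))
      have h5 := ((hasDerivAt_id s).div_const 2).exp
      convert! h5.mul h4 using 1
      simp only [q, Pi.add_apply, Pi.pow_apply, id]
      ring
    · refine mul_nonpos_of_nonneg_of_nonpos (Real.exp_pos _).le ?_
      rw [logLinear_apply]
      simp only [q]
      generalize (v s).1 = a
      generalize (v s).2.1 = b
      generalize (v s).2.2 = c
      nlinarith [sq_nonneg (3 * ((1 + 2 * k) * b) - 2 * ((1 + 3 * k) * c)),
        sq_nonneg (7 * ((1 + k) * a) + 2 * ((1 + 3 * k) * c)), sq_nonneg ((1 + 3 * k) * c),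
        mul_nonneg (mul_nonneg hk.le (by linarith : 0 ≤ 1 + k)) (sq_nonneg a),
        mul_nonneg (mul_nonneg hk.le (by linarith : 0 ≤ 1 + 2 * k)) (sq_nonneg b),
        mul_nonneg (mul_nonneg hk.le (by linarith : 0 ≤ 1 + 3 * k)) (sq_nonneg c)]
  have h0 : v 0 = w := by simp [v]
  have h1 := hanti hs
  simp only [zero_div, Real.exp_zero, one_mul, h0] at h1
  have h2 : ‖v s‖ ^ 2 ≤ (√(3 * (1 + 3 * k)) * Real.exp (-(1 / 4) * s) * ‖w‖) ^ 2 := by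
    rw [mul_pow, mul_pow, Real.sq_sqrt (by positivity), ← Real.exp_nat_mul]
    have h3 : Real.exp (s / 2) * Real.exp (((2 : ℕ) : ℝ) * (-(1 / 4) * s)) = 1 := by
      rw [← Real.exp_add, Real.exp_eq_one_iff]
      push_cast; ring
    calc ‖v s‖ ^ 2 ≤ q (v s) := hq1 _
      _ = Real.exp (((2 : ℕ) : ℝ) * (-(1 / 4) * s)) * (Real.exp (s / 2) * q (v s)) := by
        linear_combination -(q (v s)) * h3
      _ ≤ Real.exp (((2 : ℕ) : ℝ) * (-(1 / 4) * s)) * (3 * (1 + 3 * k) * ‖w‖ ^ 2) :=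
        mul_le_mul_of_nonneg_left (h1.trans (hq2 w)) (Real.exp_pos _).le
      _ = _ := by ring
  exact le_of_sq_le_sq h2 (by positivity)

theorem continuous_exp_smul (k : ℝ) : Continuous fun s : ℝ => exp (s • logLinear k) :=
  continuous_iff_continuousAt.2 fun s =>
    (hasDerivAt_exp_smul_const (𝕂 := ℝ) (logLinear k) s).continuousAt

theorem exists_norm_exp_logLinear_le {k : ℝ} (hk : 0 < k) :
    ∃ C, 0 ≤ C ∧ ∀ s, -1 ≤ s → ‖exp (s • logLinear k)‖ ≤ C * Real.exp (-(1 / 4) * s) := by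
  obtain ⟨M, hM⟩ := (isCompact_Icc (a := (-1 : ℝ)) (b := 0)).exists_bound_of_continuousOn
    (continuous_exp_smul k).continuousOn
  refine ⟨max M √(3 * (1 + 3 * k)), le_max_of_le_right (Real.sqrt_nonneg _), fun s hs => ?_⟩
  rcases le_total 0 s with h | h
  · refine (norm_exp_logLinear_le hk h).trans ?_
    gcongr
    exact le_max_right _ _
  · have h1 : 1 ≤ Real.exp (-(1 / 4) * s) := Real.one_le_exp (by linarith)
    have h2 : 0 ≤ max M √(3 * (1 + 3 * k)) := le_max_of_le_right (Real.sqrt_nonneg _)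
    calc _ ≤ M := hM s ⟨hs, h⟩
      _ ≤ max M √(3 * (1 + 3 * k)) := le_max_left _ _
      _ ≤ _ := le_mul_of_one_le_right h2 h1

/-- The clipped time of the integral equation: it runs over `[-1, ∞)`, so that the initial time `0`
is interior and the solution extends to both sides of the initial point. -/
def clip (s : ℝ) : ℝ := max s (-1)

theorem continuous_clip : Continuous clip := by unfold clip; fun_prop

theorem neg_one_le_clip (s : ℝ) : -1 ≤ clip s := le_max_right _ _

theorem clip_of_le {s : ℝ} (hs : -1 ≤ s) : clip s = s := max_eq_left hs

theorem abs_integral_exp_le {c s : ℝ} (hc : 0 < c) (hs : -1 ≤ s) :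
    |∫ τ in (0 : ℝ)..s, Real.exp (-c * τ)| ≤ Real.exp c / c := by
  have h1 : ∫ τ in (0 : ℝ)..s, Real.exp (-c * τ) = (1 - Real.exp (-c * s)) / c := by
    rw [intervalIntegral.integral_eq_sub_of_hasDerivAt
      (f := fun τ => -(Real.exp (-c * τ)) / c) (fun τ _ => ?_)
      (by apply Continuous.intervalIntegrable; fun_prop)]
    · simp; ring
    · have h := ((((hasDerivAt_id τ).const_mul (-c)).exp).neg).div_const c
      convert! h using 1
      field_simp
      simp
  rw [h1, abs_div, abs_of_pos hc]
  gcongr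
  have h2 := Real.exp_pos (-c * s)
  have h3 : Real.exp (-c * s) ≤ Real.exp c := Real.exp_le_exp.2 (by nlinarith)
  have h4 : 1 ≤ Real.exp c := Real.one_le_exp hc.le
  rw [abs_le]
  constructor <;> linarith

end LogSystem

/-! ### The integral equation of the logarithmic system -/

noncomputable section LogFamily

open BoundedContinuousFunction NormedSpace

/-- One quarter of the logarithm of the product of the three quotients. -/
def logSum (k : ℝ) (w : ℝ × ℝ × ℝ) : ℝ :=
  (Real.log (1 + k) + Real.log (1 + 2 * k) + Real.log (1 + 3 * k) + w.1 + w.2.1 + w.2.2) / 4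

/-- The relative perturbation `f''''/f^p - 1` in the coordinates `(w, r, y)`, `r = f^(-k)`. -/
def logPert (k : ℝ) (q : (ℝ × ℝ × ℝ) × ℝ × ℝ) : ℝ :=
  -(q.2.1 ^ 4) / (4 * k) + q.2.2 / 4 * q.2.1 ^ 3 * Real.exp (-logSum k q.1)

/-- The part of the field of the `w`-equations that vanishes to second order at the equilibria. -/
def logRemainder (k : ℝ) (q : (ℝ × ℝ × ℝ) × ℝ × ℝ) : ℝ × ℝ × ℝ :=
  let e : ℝ → ℝ := fun x => Real.exp x - 1 - x
  ((1 + 2 * k) * e q.1.2.1 - 2 * (1 + k) * e q.1.1,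
    (1 + 3 * k) * e q.1.2.2 - (1 + 2 * k) * e q.1.2.1 - (1 + k) * e q.1.1
      + (1 + 3 * k) * Real.exp q.1.2.2 * logPert k q,
    -((1 + 3 * k) * e q.1.2.2) - (1 + k) * e q.1.1
      - (1 + 3 * k) * Real.exp q.1.2.2 * logPert k q)

/-- The equation in the coordinates `(w, r, y)`, with `log f` as time. -/
def logField (k : ℝ) (q : (ℝ × ℝ × ℝ) × ℝ × ℝ) : (ℝ × ℝ × ℝ) × ℝ × ℝ :=
  (logLinear k q.1 + logRemainder k q, -k * q.2.1, -(q.2.1 * Real.exp (logSum k q.1)))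

theorem contDiff_logSum (k : ℝ) : ContDiff ℝ 1 (logSum k) := by
  unfold logSum; fun_prop

theorem contDiff_logPert (k : ℝ) : ContDiff ℝ 1 (logPert k) := by
  have := contDiff_logSum k
  unfold logPert; fun_prop

theorem contDiff_logRemainder (k : ℝ) : ContDiff ℝ 1 (logRemainder k) := by
  have := contDiff_logPert k
  unfold logRemainder; fun_prop

theorem logRemainder_equilibrium (k y : ℝ) : logRemainder k (0, 0, y) = 0 := by
  simp [logRemainder, logPert]

theorem hasFDerivAt_mul_zero {E : Type*} [NormedAddCommGroup E] [NormedSpace ℝ E] {f g : E → ℝ}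
    {x : E} (hf : DifferentiableAt ℝ f x) (hg : HasFDerivAt g (0 : E →L[ℝ] ℝ) x) (h : g x = 0) :
    HasFDerivAt (fun x => f x * g x) (0 : E →L[ℝ] ℝ) x := by
  exact (hf.hasFDerivAt.mul hg).congr_fderiv (by simp [h])

theorem fderiv_logRemainder_equilibrium (k y : ℝ) : fderiv ℝ (logRemainder k) (0, 0, y) = 0 := by
  have he : HasDerivAt (fun x : ℝ => Real.exp x - 1 - x) 0 0 := by
    exact (((Real.hasDerivAt_exp 0).sub_const 1).sub (hasDerivAt_id 0)).congr_deriv (by simp)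
  have hcomp : ∀ π : ((ℝ × ℝ × ℝ) × ℝ × ℝ) →L[ℝ] ℝ, π (0, 0, y) = 0 →
      HasFDerivAt (fun q => Real.exp (π q) - 1 - π q)
        (0 : ((ℝ × ℝ × ℝ) × ℝ × ℝ) →L[ℝ] ℝ) (0, 0, y) := by
    intro π hπ
    have he' : HasDerivAt (fun x : ℝ => Real.exp x - 1 - x) 0 (π (0, 0, y)) := by
      rw [hπ]; exact he
    exact (he'.comp_hasFDerivAt (0, 0, y) π.hasFDerivAt).congr_fderiv (by simp)
  have hsum := (contDiff_logSum k).differentiable one_ne_zero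
  have hpow : ∀ n : ℕ, HasFDerivAt (fun q : (ℝ × ℝ × ℝ) × ℝ × ℝ => q.2.1 ^ (n + 2))
      (0 : ((ℝ × ℝ × ℝ) × ℝ × ℝ) →L[ℝ] ℝ) (0, 0, y) := by
    intro n
    have h := (((ContinuousLinearMap.fst ℝ ℝ ℝ).comp
      (ContinuousLinearMap.snd ℝ (ℝ × ℝ × ℝ) (ℝ × ℝ))).hasFDerivAt (x := (0, 0, y))).pow (n + 2)
    exact h.congr_fderiv (by simp)
  have hpert : HasFDerivAt (logPert k) (0 : ((ℝ × ℝ × ℝ) × ℝ × ℝ) →L[ℝ] ℝ) (0, 0, y) := by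
    have h1 := hasFDerivAt_mul_zero (f := fun _ => -1 / (4 * k)) (by fun_prop) (hpow 2) (by simp)
    have h2 := hasFDerivAt_mul_zero (f := fun q : (ℝ × ℝ × ℝ) × ℝ × ℝ =>
      q.2.2 / 4 * Real.exp (-logSum k q.1)) (x := (0, 0, y)) (by fun_prop) (hpow 1) (by simp)
    convert! h1.add h2 using 1
    · ext q; simp only [logPert, Pi.add_apply]; ring
    · simp
  have p1 := hcomp ((ContinuousLinearMap.fst ℝ ℝ (ℝ × ℝ)).comp
    (ContinuousLinearMap.fst ℝ (ℝ × ℝ × ℝ) (ℝ × ℝ))) (by simp)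
  have p2 := hcomp (((ContinuousLinearMap.fst ℝ ℝ ℝ).comp
    (ContinuousLinearMap.snd ℝ ℝ (ℝ × ℝ))).comp
    (ContinuousLinearMap.fst ℝ (ℝ × ℝ × ℝ) (ℝ × ℝ))) (by simp)
  have p3 := hcomp (((ContinuousLinearMap.snd ℝ ℝ ℝ).comp
    (ContinuousLinearMap.snd ℝ ℝ (ℝ × ℝ))).comp
    (ContinuousLinearMap.fst ℝ (ℝ × ℝ × ℝ) (ℝ × ℝ))) (by simp)
  have p4 := hasFDerivAt_mul_zero (f := fun q : (ℝ × ℝ × ℝ) × ℝ × ℝ =>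
      (1 + 3 * k) * Real.exp q.1.2.2) (x := (0, 0, y)) (by fun_prop) hpert (by simp [logPert])
  have h1 := (p2.const_mul (1 + 2 * k)).sub (p1.const_mul (2 * (1 + k)))
  have h2 := (((p3.const_mul (1 + 3 * k)).sub (p2.const_mul (1 + 2 * k))).sub
    (p1.const_mul (1 + k))).add p4
  have h3 := ((p3.const_mul (1 + 3 * k)).neg.sub (p1.const_mul (1 + k))).sub p4
  have h := (h1.prodMk (h2.prodMk h3)).fderiv
  have e : fderiv ℝ (logRemainder k) (0, 0, y) = _ := h
  rw [e]
  refine ContinuousLinearMap.ext fun v => ?_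
  simp

/-- The linear flow on bounded curves: the term of the integral equation coming from the initial
values. -/
theorem exists_linearFlow {k : ℝ} (hk : 0 < k) :
    ∃ Λ : ((ℝ × ℝ × ℝ) × ℝ × ℝ) →L[ℝ] (ℝ →ᵇ ((ℝ × ℝ × ℝ) × ℝ × ℝ)), ∀ b s,
      Λ b s = (exp (clip s • logLinear k) b.1, Real.exp (-k * clip s) * b.2.1, b.2.2) := by
  obtain ⟨C, hC0, hC⟩ := exists_norm_exp_logLinear_le hk
  have hbound : ∀ (b : (ℝ × ℝ × ℝ) × ℝ × ℝ) (s : ℝ),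
      ‖(exp (clip s • logLinear k) b.1, Real.exp (-k * clip s) * b.2.1, b.2.2)‖
        ≤ (C * Real.exp (1 / 4) + Real.exp k + 1) * ‖b‖ := by
    intro b s
    have hs := neg_one_le_clip s
    have h1 : ‖exp (clip s • logLinear k) b.1‖ ≤ C * Real.exp (1 / 4) * ‖b‖ := by
      refine (ContinuousLinearMap.le_opNorm _ _).trans ?_
      gcongr
      · refine (hC _ hs).trans ?_
        gcongr
        linarith
      · exact norm_fst_le b
    have h2 : ‖Real.exp (-k * clip s) * b.2.1‖ ≤ Real.exp k * ‖b‖ := by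
      rw [norm_mul, Real.norm_of_nonneg (Real.exp_pos _).le]
      gcongr
      · nlinarith
      · exact (norm_fst_le b.2).trans (norm_snd_le b)
    have h3 : ‖b.2.2‖ ≤ ‖b‖ := (norm_snd_le b.2).trans (norm_snd_le b)
    have h4 := norm_nonneg b
    have h5 : 0 ≤ C * Real.exp (1 / 4) * ‖b‖ := by positivity
    have h6 : 0 ≤ Real.exp k * ‖b‖ := by positivity
    refine max_le (by linarith) (max_le ?_ ?_)
    · simp only; linarith
    · simp only; linarith
  let Λ : ((ℝ × ℝ × ℝ) × ℝ × ℝ) →ₗ[ℝ] (ℝ →ᵇ ((ℝ × ℝ × ℝ) × ℝ × ℝ)) :=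
    { toFun := fun b => BoundedContinuousFunction.ofNormedAddCommGroup
        (fun s => (exp (clip s • logLinear k) b.1, Real.exp (-k * clip s) * b.2.1, b.2.2))
        (by
          have h1 := ((continuous_exp_smul k).comp continuous_clip).clm_apply
            (continuous_const (y := b.1))
          have h2 := continuous_clip
          exact h1.prodMk ((by fun_prop : Continuous fun s =>
            Real.exp (-k * clip s) * b.2.1).prodMk continuous_const))
        _ (hbound b)
      map_add' := fun b c => by ext s <;> simp [mul_add]
      map_smul' := fun a b => by ext s <;> simp; ring }
  exact ⟨Λ.mkContinuousOfExistsBound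
    ⟨_, fun b => (norm_le (by positivity)).2 (hbound b)⟩, fun b s => rfl⟩

theorem exp_add_smul_clm {V : Type*} [NormedAddCommGroup V] [NormedSpace ℝ V] [CompleteSpace V]
    (A : V →L[ℝ] V) (s t : ℝ) (v : V) :
    exp ((s + t) • A) v = exp (s • A) (exp (t • A) v) := by
  let _ : NormedAlgebra ℚ (V →L[ℝ] V) := NormedAlgebra.restrictScalars ℚ ℝ _
  have hc : Commute (s • A) (t • A) := ((Commute.refl A).smul_left s).smul_right t
  rw [add_smul, exp_add_of_commute hc]
  rfl

/-- The Duhamel operator of the `w`-equations is bounded on bounded curves. -/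
theorem exists_duhamelOperator {k : ℝ} (hk : 0 < k) :
    ∃ S : (ℝ →ᵇ (ℝ × ℝ × ℝ)) →L[ℝ] (ℝ →ᵇ ((ℝ × ℝ × ℝ) × ℝ × ℝ)), ∀ f s,
      S f s = (exp (clip s • logLinear k)
        (∫ τ in (0 : ℝ)..clip s, exp ((-τ) • logLinear k) (f τ)), 0) := by
  obtain ⟨C, hC0, hC⟩ := exists_norm_exp_logLinear_le hk
  refine ⟨integralOperator
    (fun s => (ContinuousLinearMap.inl ℝ (ℝ × ℝ × ℝ) (ℝ × ℝ)).comp (exp (s • logLinear k)))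
    (fun τ => exp ((-τ) • logLinear k)) clip
    (continuous_const.clm_comp (continuous_exp_smul k))
    ((continuous_exp_smul k).comp continuous_neg) continuous_clip
    (C * (Real.exp (1 / 4) / (1 / 4))) (fun s f => ?_), fun f s => rfl⟩
  have hs := neg_one_le_clip s
  generalize clip s = t at hs
  have hcont : Continuous fun τ => exp ((-τ) • logLinear k) (f τ) :=
    ((continuous_exp_smul k).comp continuous_neg).clm_apply f.continuous
  have h1 : exp (t • logLinear k) (∫ τ in (0 : ℝ)..t, exp ((-τ) • logLinear k) (f τ))
      = ∫ τ in (0 : ℝ)..t, exp ((t - τ) • logLinear k) (f τ) := by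
    rw [← ContinuousLinearMap.intervalIntegral_comp_comm _ (hcont.intervalIntegrable _ _)]
    refine intervalIntegral.integral_congr fun τ _ => ?_
    simp only [sub_eq_add_neg, exp_add_smul_clm]
  have h2 : ‖∫ τ in (0 : ℝ)..t, exp ((t - τ) • logLinear k) (f τ)‖
      ≤ |∫ τ in (0 : ℝ)..t, C * ‖f‖ * Real.exp (-(1 / 4) * (t - τ))| := by
    refine intervalIntegral.norm_integral_le_abs_of_norm_le ?_
      (by apply Continuous.intervalIntegrable; fun_prop)
    refine MeasureTheory.ae_restrict_of_forall_mem measurableSet_uIoc fun τ hτ => ?_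
    have hτ' : -1 ≤ t - τ := by
      rcases le_total 0 t with h | h
      · rw [uIoc_of_le h] at hτ; linarith [hτ.2]
      · rw [uIoc_of_ge h] at hτ; linarith [hτ.2]
    refine (ContinuousLinearMap.le_opNorm _ _).trans ?_
    calc _ ≤ C * Real.exp (-(1 / 4) * (t - τ)) * ‖f‖ := by
          gcongr
          · exact hC _ hτ'
          · exact f.norm_coe_le_norm τ
      _ = _ := by ring
  have h3 : ‖ContinuousLinearMap.inl ℝ (ℝ × ℝ × ℝ) (ℝ × ℝ)
      (∫ τ in (0 : ℝ)..t, exp ((t - τ) • logLinear k) (f τ))‖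
      = ‖∫ τ in (0 : ℝ)..t, exp ((t - τ) • logLinear k) (f τ)‖ := by
    simp [Prod.norm_def]
  rw [ContinuousLinearMap.comp_apply, h1, h3]
  refine h2.trans ?_
  rw [intervalIntegral.integral_const_mul, abs_mul, abs_of_nonneg (by positivity),
    intervalIntegral.integral_comp_sub_left (fun τ => Real.exp (-(1 / 4) * τ)) t, sub_self,
    sub_zero]
  calc _ ≤ C * ‖f‖ * (Real.exp (1 / 4) / (1 / 4)) := by
        gcongr
        exact abs_integral_exp_le (by norm_num) hs
    _ = _ := by ring

/-- The integral operator of the `y`-equation, whose right-hand side carries the factor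
`exp (-k τ)`. -/
theorem exists_weightedIntegral {k : ℝ} (hk : 0 < k) :
    ∃ S : (ℝ →ᵇ ℝ) →L[ℝ] (ℝ →ᵇ ((ℝ × ℝ × ℝ) × ℝ × ℝ)), ∀ f s,
      S f s = (0, 0, ∫ τ in (0 : ℝ)..clip s, Real.exp (-k * τ) * f τ) := by
  refine ⟨integralOperator
    (fun _ => (ContinuousLinearMap.inr ℝ (ℝ × ℝ × ℝ) (ℝ × ℝ)).comp
      (ContinuousLinearMap.inr ℝ ℝ ℝ))
    (fun τ => Real.exp (-k * τ) • ContinuousLinearMap.id ℝ ℝ) clip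
    continuous_const (by fun_prop) continuous_clip
    (Real.exp k / k) (fun s f => ?_), fun f s => rfl⟩
  have hs := neg_one_le_clip s
  generalize clip s = t at hs
  have h2 : ‖∫ τ in (0 : ℝ)..t, (Real.exp (-k * τ) • ContinuousLinearMap.id ℝ ℝ) (f τ)‖
      ≤ |∫ τ in (0 : ℝ)..t, ‖f‖ * Real.exp (-k * τ)| := by
    refine intervalIntegral.norm_integral_le_abs_of_norm_le ?_
      (by apply Continuous.intervalIntegrable; fun_prop)
    refine MeasureTheory.ae_restrict_of_forall_mem measurableSet_uIoc fun τ hτ => ?_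
    simp only [_root_.smul_apply, ContinuousLinearMap.id_apply, smul_eq_mul, norm_mul,
      Real.norm_of_nonneg (Real.exp_pos _).le]
    rw [mul_comm]
    gcongr
    exact f.norm_coe_le_norm τ
  have h3 : ∀ x : ℝ, ‖(ContinuousLinearMap.inr ℝ (ℝ × ℝ × ℝ) (ℝ × ℝ)).comp
      (ContinuousLinearMap.inr ℝ ℝ ℝ) x‖ = ‖x‖ := by
    intro x; simp [Prod.norm_def]
  rw [h3]
  refine h2.trans ?_
  rw [intervalIntegral.integral_const_mul, abs_mul, abs_of_nonneg (by positivity), mul_comm]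
  gcongr
  exact abs_integral_exp_le hk hs

/-- Variation of constants. -/
theorem hasDerivAt_variationOfConstants {V : Type*} [NormedAddCommGroup V] [NormedSpace ℝ V]
    [CompleteSpace V] (A : V →L[ℝ] V) {f : ℝ → V} (hf : Continuous f) (v : V) (s : ℝ) :
    HasDerivAt (fun s => exp (s • A) v + exp (s • A) (∫ τ in (0 : ℝ)..s, exp ((-τ) • A) (f τ)))
      (A (exp (s • A) v + exp (s • A) (∫ τ in (0 : ℝ)..s, exp ((-τ) • A) (f τ))) + f s) s := by
  have hexp : Continuous fun s : ℝ => exp (s • A) := continuous_iff_continuousAt.2 fun s =>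
    (hasDerivAt_exp_smul_const (𝕂 := ℝ) A s).continuousAt
  have hcont : Continuous fun τ => exp ((-τ) • A) (f τ) :=
    (hexp.comp continuous_neg).clm_apply hf
  have h1 := hasDerivAt_exp_smul_const' (𝕂 := ℝ) A s
  have h2 := intervalIntegral.integral_hasDerivAt_right (hcont.intervalIntegrable 0 s)
    (hcont.stronglyMeasurableAtFilter _ _) hcont.continuousAt
  have h3 := (h1.clm_apply (hasDerivAt_const s v)).add (h1.clm_apply h2)
  refine h3.congr_deriv ?_
  have h4 : exp (s • A) (exp ((-s) • A) (f s)) = f s := by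
    rw [← exp_add_smul_clm]
    simp
  rw [h4]
  simp [add_assoc]

/-- The integral `∫₀^∞ exp (-k τ) f(τ) dτ` as a continuous functional of the bounded curve `f`. -/
theorem exists_laplaceFunctional {k : ℝ} (hk : 0 < k) :
    ∃ J : (ℝ →ᵇ ℝ) →L[ℝ] ℝ, ∀ f : ℝ →ᵇ ℝ,
      Tendsto (fun s => ∫ τ in (0 : ℝ)..s, Real.exp (-k * τ) * f τ) atTop (𝓝 (J f)) := by
  have hint : ∀ f : ℝ →ᵇ ℝ, MeasureTheory.IntegrableOn (fun τ => Real.exp (-k * τ) * f τ)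
      (Ioi 0) := fun f =>
    (exp_neg_integrableOn_Ioi 0 hk).mul_bdd (c := ‖f‖) f.continuous.aestronglyMeasurable
      (Eventually.of_forall f.norm_coe_le_norm)
  let J : (ℝ →ᵇ ℝ) →ₗ[ℝ] ℝ :=
    { toFun := fun f => ∫ τ in Ioi (0 : ℝ), Real.exp (-k * τ) * f τ
      map_add' := fun f g => by
        rw [← MeasureTheory.integral_add (hint f) (hint g)]
        simp [mul_add]
      map_smul' := fun c f => by
        simp only [RingHom.id_apply, smul_eq_mul]
        rw [← MeasureTheory.integral_const_mul]
        refine MeasureTheory.integral_congr_ae (Eventually.of_forall fun τ => ?_)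
        simp only [BoundedContinuousFunction.coe_smul, smul_eq_mul]
        ring }
  refine ⟨J.mkContinuousOfExistsBound ⟨∫ τ in Ioi (0 : ℝ), Real.exp (-k * τ), fun f => ?_⟩,
    fun f => MeasureTheory.intervalIntegral_tendsto_integral_Ioi 0 (hint f) tendsto_id⟩
  change ‖∫ τ in Ioi (0 : ℝ), Real.exp (-k * τ) * f τ‖ ≤ _
  rw [← MeasureTheory.integral_mul_const]
  refine MeasureTheory.norm_integral_le_of_norm_le
    ((exp_neg_integrableOn_Ioi 0 hk).mul_const _) (Eventually.of_forall fun τ => ?_)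
  rw [norm_mul, Real.norm_of_nonneg (Real.exp_pos _).le]
  gcongr
  exact f.norm_coe_le_norm τ

/-- Near every equilibrium `(0, 0, η)`, the solutions of the logarithmic system exist for all
positive times and stay bounded, and the limit of their `y`-component is a `C¹` function of the
initial value. -/
theorem exists_logCurve_family {k : ℝ} (hk : 0 < k) (η : ℝ) :
    ∃ T : (ℝ × ℝ × ℝ) × ℝ × ℝ → ℝ, ContDiffAt ℝ 1 T (0, 0, η) ∧ (∀ y, T (0, 0, y) = y) ∧
      ∀ᶠ b in 𝓝 ((0, 0, η) : (ℝ × ℝ × ℝ) × ℝ × ℝ), ∃ U : ℝ → (ℝ × ℝ × ℝ) × ℝ × ℝ, U 0 = b ∧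
        (∀ s, -1 < s → HasDerivAt U (logField k (U s)) s) ∧ (∃ C, ∀ s, ‖U s‖ ≤ C) ∧
        Tendsto (fun s => (U s).2.2) atTop (𝓝 (T b)) ∧
        ∀ s, -1 < s → (U s).2.1 = b.2.1 * Real.exp (-k * s) := by
  obtain ⟨Λ, hΛ⟩ := exists_linearFlow hk
  obtain ⟨S₁, hS₁⟩ := exists_duhamelOperator hk
  obtain ⟨S₂, hS₂⟩ := exists_weightedIntegral hk
  obtain ⟨J, hJ⟩ := exists_laplaceFunctional hk
  have h₁ := contDiff_logRemainder k
  have h₂ : ContDiff ℝ 1 fun q : (ℝ × ℝ × ℝ) × ℝ × ℝ => -Real.exp (logSum k q.1) := by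
    have := contDiff_logSum k
    fun_prop
  let l : ((ℝ × ℝ × ℝ) × ℝ × ℝ) →L[ℝ] ℝ :=
    (ContinuousLinearMap.fst ℝ ℝ ℝ).comp (ContinuousLinearMap.snd ℝ (ℝ × ℝ × ℝ) (ℝ × ℝ))
  obtain ⟨ψ, -, hψ, hfix⟩ := exists_contDiffAt_integralEquation h₁ h₂ Λ S₁ S₂ l
    (a := (0, 0, η)) (u := constCurve (0, 0, η)) rfl (by
      ext s : 1
      have h0 : superposition (logRemainder k) h₁.continuous (constCurve (0, 0, η)) = 0 := by
        ext s : 1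
        exact logRemainder_equilibrium k η
      rw [h0]
      simp [hΛ]) (fun s => fderiv_logRemainder_equilibrium k η)
  refine ⟨fun b => b.2.2 + l b * J (superposition _ h₂.continuous (ψ b)), ?_, ?_, ?_⟩
  · have h3 := ((contDiff_superposition h₂).contDiffAt (x := ψ (0, 0, η))).comp (0, 0, η) hψ
    exact (contDiff_snd.comp contDiff_snd).contDiffAt.add
      (l.contDiff.contDiffAt.mul (J.contDiff.contDiffAt.comp _ h3))
  · intro y
    simp [l]
  filter_upwards [hfix] with b hb
  have hval : ∀ s, ψ b s = (exp (clip s • logLinear k) b.1 + exp (clip s • logLinear k)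
      (∫ τ in (0 : ℝ)..clip s, exp ((-τ) • logLinear k) (logRemainder k (ψ b τ))),
      Real.exp (-k * clip s) * b.2.1, b.2.2 + b.2.1 * ∫ τ in (0 : ℝ)..clip s,
        Real.exp (-k * τ) * -Real.exp (logSum k (ψ b τ).1)) := by
    intro s
    conv_lhs => rw [← hb]
    simp only [BoundedContinuousFunction.coe_add, Pi.add_apply, BoundedContinuousFunction.coe_smul,
      hΛ, hS₁, hS₂, superposition_apply, Prod.mk_add_mk, Prod.smul_mk, smul_zero, add_zero,
      Prod.mk.injEq, true_and]
    rfl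
  have hcl : ∀ s, -1 < s → clip s = s := fun s hs => clip_of_le hs.le
  refine ⟨ψ b, ?_, fun s hs => ?_, ⟨‖ψ b‖, (ψ b).norm_coe_le_norm⟩, ?_, fun s hs => ?_⟩
  · rw [hval, hcl 0 (by norm_num)]
    simp
  · have hev : (fun s => (exp (s • logLinear k) b.1 + exp (s • logLinear k)
      (∫ τ in (0 : ℝ)..s, exp ((-τ) • logLinear k) (logRemainder k (ψ b τ))),
      Real.exp (-k * s) * b.2.1, b.2.2 + b.2.1 * ∫ τ in (0 : ℝ)..s,
        Real.exp (-k * τ) * -Real.exp (logSum k (ψ b τ).1))) =ᶠ[𝓝 s] ψ b := by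
      filter_upwards [lt_mem_nhds hs] with t ht
      rw [hval t, hcl t ht]
    refine HasDerivAt.congr_of_eventuallyEq ?_ hev.symm
    have d1 := hasDerivAt_variationOfConstants (logLinear k)
      (h₁.continuous.comp (ψ b).continuous) b.1 s
    have d2 := (((hasDerivAt_id s).const_mul (-k)).exp).mul_const b.2.1
    have hc2 : Continuous fun τ => Real.exp (-k * τ) * -Real.exp (logSum k (ψ b τ).1) :=
      (by fun_prop : Continuous fun τ : ℝ => Real.exp (-k * τ)).mul
        (h₂.continuous.comp (ψ b).continuous)
    have d3 := ((intervalIntegral.integral_hasDerivAt_right (hc2.intervalIntegrable 0 s)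
      (hc2.stronglyMeasurableAtFilter _ _) hc2.continuousAt).const_mul b.2.1).const_add b.2.2
    refine (d1.prodMk (d2.prodMk d3)).congr_deriv ?_
    have hv := hval s
    rw [hcl s hs] at hv
    simp only [logField]
    have hv1 := congrArg Prod.fst hv
    have hv2 := congrArg (fun q => q.2.1) hv
    simp only at hv1 hv2
    rw [hv2]
    simp only [Function.comp_apply]
    rw [← hv1]
    refine Prod.ext rfl (Prod.ext ?_ ?_)
    · simp only [id]; ring
    · simp only; ring
  · have h := ((hJ (superposition _ h₂.continuous (ψ b))).const_mul b.2.1).const_add b.2.2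
    refine h.congr' ?_
    filter_upwards [eventually_gt_atTop (-1)] with s hs
    rw [hval s, hcl s hs]
    rfl
  · rw [hval s, hcl s hs, mul_comm]

end LogFamily

/-! ### From the logarithmic system back to the profile equation -/

section LogCoordinates

/-- The derivatives `(f, f', f'', f''')` in terms of the logarithmic coordinates `(w, r, y)`. -/
noncomputable def expCoord (k : ℝ) (q : (ℝ × ℝ × ℝ) × ℝ × ℝ) : Fin 4 → ℝ :=
  let a₀ := -Real.log q.2.1 / k
  let a₁ := (1 + k) * a₀ - logSum k q.1
  let a₂ := Real.log (1 + k) + q.1.1 + 2 * a₁ - a₀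
  let a₃ := Real.log (1 + 2 * k) + q.1.2.1 - a₀ + a₂ + a₁
  ![Real.exp a₀, -Real.exp a₁, Real.exp a₂, -Real.exp a₃]

/-- The logarithmic coordinates `(w, r, y)` of a jet at the point `y`. Since `Real.log x = log |x|`,
the logarithms of the negative derivatives `f'`, `f'''` are those of their absolute values. -/
noncomputable def logCoord (k : ℝ) (q : ℝ × (Fin 4 → ℝ)) : (ℝ × ℝ × ℝ) × ℝ × ℝ :=
  ((Real.log (q.2 0) + Real.log (q.2 2) - 2 * Real.log (q.2 1) - Real.log (1 + k),
    Real.log (q.2 0) + Real.log (q.2 3) - Real.log (q.2 1) - Real.log (q.2 2)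
      - Real.log (1 + 2 * k),
    (4 * k + 2) * Real.log (q.2 0) - Real.log (q.2 1) - Real.log (q.2 3) - Real.log (1 + 3 * k)),
    Real.exp (-k * Real.log (q.2 0)), q.1)

theorem expCoord_logCoord {k : ℝ} (hk : 0 < k) {q : ℝ × (Fin 4 → ℝ)} (h0 : 0 < q.2 0)
    (h1 : q.2 1 < 0) (h2 : 0 < q.2 2) (h3 : q.2 3 < 0) : expCoord k (logCoord k q) = q.2 := by
  have e0 : -Real.log (logCoord k q).2.1 / k = Real.log (q.2 0) := by
    simp only [logCoord, Real.log_exp]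
    field_simp
  have e1 : (1 + k) * Real.log (q.2 0) - logSum k (logCoord k q).1 = Real.log (q.2 1) := by
    simp only [logCoord, logSum]
    ring
  have e2 : Real.log (1 + k) + (logCoord k q).1.1 + 2 * Real.log (q.2 1) - Real.log (q.2 0)
      = Real.log (q.2 2) := by
    simp only [logCoord]
    ring
  have e3 : Real.log (1 + 2 * k) + (logCoord k q).1.2.1 - Real.log (q.2 0) + Real.log (q.2 2)
      + Real.log (q.2 1) = Real.log (q.2 3) := by
    simp only [logCoord]
    ring
  ext i
  fin_cases i <;> simp only [expCoord, e0, e1, e2, e3]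
  · exact Real.exp_log h0
  · change -Real.exp (Real.log (q.2 1)) = q.2 1
    rw [Real.exp_log_of_neg h1, neg_neg]
  · exact Real.exp_log h2
  · change -Real.exp (Real.log (q.2 3)) = q.2 3
    rw [Real.exp_log_of_neg h3, neg_neg]

theorem contDiffAt_logCoord (k : ℝ) {q : ℝ × (Fin 4 → ℝ)} (hq : ∀ i, q.2 i ≠ 0) :
    ContDiffAt ℝ 1 (logCoord k) q := by
  have h : ∀ i, ContDiffAt ℝ 1 (fun q : ℝ × (Fin 4 → ℝ) => Real.log (q.2 i)) q := fun i =>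
    (by fun_prop : ContDiffAt ℝ 1 (fun q : ℝ × (Fin 4 → ℝ) => q.2 i) q).log (hq i)
  have := h 0
  have := h 1
  have := h 2
  have := h 3
  unfold logCoord
  fun_prop

/-- In logarithmic coordinates the relative size of the lower order terms is `logPert`. -/
theorem profileRHS_expCoord {k : ℝ} (hk : 0 < k) {q : (ℝ × ℝ × ℝ) × ℝ × ℝ} (hr : 0 < q.2.1) :
    profileRHS (1 + 4 * k) q.2.2 (expCoord k q)
      = expCoord k q 0 ^ (1 + 4 * k) * (1 + logPert k q) := by
  have h0 : 0 < expCoord k q 0 := Real.exp_pos _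
  have hp : expCoord k q 0 ^ (1 + 4 * k) = expCoord k q 0 / q.2.1 ^ 4 := by
    have : expCoord k q 0 ^ (4 * k) = (q.2.1 ^ 4)⁻¹ := by
      change Real.exp (-Real.log q.2.1 / k) ^ (4 * k) = _
      rw [← Real.exp_mul, ← Real.exp_log hr, ← Real.exp_nat_mul, ← Real.exp_neg, Real.log_exp]
      congr 1
      field_simp
      norm_num
    rw [Real.rpow_add h0, Real.rpow_one, this]
    rfl
  have h1 : expCoord k q 1 = -(expCoord k q 0 / (q.2.1 * Real.exp (logSum k q.1))) := by
    change -Real.exp ((1 + k) * (-Real.log q.2.1 / k) - logSum k q.1)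
      = -(Real.exp (-Real.log q.2.1 / k) / _)
    rw [show (1 + k) * (-Real.log q.2.1 / k) - logSum k q.1
      = -Real.log q.2.1 / k - (Real.log q.2.1 + logSum k q.1) by field_simp; ring,
      Real.exp_sub, Real.exp_add, Real.exp_log hr]
  rw [profileRHS, abs_rpow_mul_self h0, hp, h1, logPert, Real.exp_neg]
  field_simp
  ring

/-- A solution of the logarithmic system is, up to the change `dy/ds = -r exp (logSum)` of the
independent variable, a jet curve. -/
theorem hasDerivAt_expCoord {k : ℝ} (hk : 0 < k) {U : ℝ → (ℝ × ℝ × ℝ) × ℝ × ℝ} {s : ℝ}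
    (hU : HasDerivAt U (logField k (U s)) s) (hr : 0 < (U s).2.1) :
    HasDerivAt (fun s => expCoord k (U s))
      (-((U s).2.1 * Real.exp (logSum k (U s).1)) •
        profileField (1 + 4 * k) (U s).2.2 (expCoord k (U s))) s := by
  have hRHS := profileRHS_expCoord hk hr
  set δ := logPert k (U s) with hδ
  have dw : HasDerivAt (fun s => (U s).1) (logField k (U s)).1 s := hU.fst
  have dw1 : HasDerivAt (fun s => (U s).1.1)
      ((1 + 2 * k) * (Real.exp (U s).1.2.1 - 1) - 2 * (1 + k) * (Real.exp (U s).1.1 - 1)) s := by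
    have h : HasDerivAt (fun s => (U s).1.1) (logField k (U s)).1.1 s := dw.fst
    refine h.congr_deriv ?_
    simp only [logField, logRemainder, logLinear_apply, Prod.fst_add]
    ring
  have dw2 : HasDerivAt (fun s => (U s).1.2.1)
      ((1 + 3 * k) * (Real.exp (U s).1.2.2 * (1 + δ) - 1) - (1 + 2 * k) * (Real.exp (U s).1.2.1 - 1)
        - (1 + k) * (Real.exp (U s).1.1 - 1)) s := by
    have h : HasDerivAt (fun s => (U s).1.2.1) (logField k (U s)).1.2.1 s := dw.snd.fst
    refine h.congr_deriv ?_
    simp only [logField, logRemainder, logLinear_apply, Prod.fst_add, Prod.snd_add, hδ]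
    ring
  have dw3 : HasDerivAt (fun s => (U s).1.2.2)
      (-((1 + 3 * k) * (Real.exp (U s).1.2.2 * (1 + δ) - 1))
        - (1 + k) * (Real.exp (U s).1.1 - 1)) s := by
    have h : HasDerivAt (fun s => (U s).1.2.2) (logField k (U s)).1.2.2 s := dw.snd.snd
    refine h.congr_deriv ?_
    simp only [logField, logRemainder, logLinear_apply, Prod.snd_add, hδ]
    ring
  have dr : HasDerivAt (fun s => (U s).2.1) (-k * (U s).2.1) s := hU.snd.fst
  have da0 : HasDerivAt (fun s => -Real.log (U s).2.1 / k) 1 s := by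
    refine ((dr.log hr.ne').neg.div_const k).congr_deriv ?_
    field_simp
  have da1 : HasDerivAt (fun s => (1 + k) * (-Real.log (U s).2.1 / k) - logSum k (U s).1)
      ((1 + k) * Real.exp (U s).1.1) s := by
    have h := (da0.const_mul (1 + k)).sub (((((dw1.const_add (Real.log (1 + k) +
      Real.log (1 + 2 * k) + Real.log (1 + 3 * k)))).add dw2).add dw3).div_const 4)
    refine h.congr_deriv ?_
    ring
  have da2 : HasDerivAt (fun s => Real.log (1 + k) + (U s).1.1 +
      2 * ((1 + k) * (-Real.log (U s).2.1 / k) - logSum k (U s).1) - -Real.log (U s).2.1 / k)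
      ((1 + 2 * k) * Real.exp (U s).1.2.1) s := by
    refine (((dw1.const_add (Real.log (1 + k))).add (da1.const_mul 2)).sub da0).congr_deriv ?_
    ring
  have da3 : HasDerivAt (fun s => Real.log (1 + 2 * k) + (U s).1.2.1 - -Real.log (U s).2.1 / k +
      (Real.log (1 + k) + (U s).1.1 +
        2 * ((1 + k) * (-Real.log (U s).2.1 / k) - logSum k (U s).1) - -Real.log (U s).2.1 / k) +
      ((1 + k) * (-Real.log (U s).2.1 / k) - logSum k (U s).1))
      ((1 + 3 * k) * Real.exp (U s).1.2.2 * (1 + δ)) s := by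
    refine ((((dw2.const_add (Real.log (1 + 2 * k))).sub da0).add da2).add da1).congr_deriv ?_
    ring
  have hkk : k * k⁻¹ = 1 := mul_inv_cancel₀ hk.ne'
  have g1 : 1 + k = Real.exp (Real.log (1 + k)) := (Real.exp_log (by linarith)).symm
  have g2 : 1 + 2 * k = Real.exp (Real.log (1 + 2 * k)) := (Real.exp_log (by linarith)).symm
  have g3 : 1 + 3 * k = Real.exp (Real.log (1 + 3 * k)) := (Real.exp_log (by linarith)).symm
  have gr : (U s).2.1 = Real.exp (Real.log (U s).2.1) := (Real.exp_log hr).symm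
  rw [hasDerivAt_pi]
  intro i
  fin_cases i
  · refine da0.exp.congr_deriv ?_
    change _ = -((U s).2.1 * _) * -Real.exp _
    generalize Real.log (U s).2.1 = ℓ at gr ⊢
    rw [gr, mul_one, neg_mul_neg, ← Real.exp_add, ← Real.exp_add]
    congr 1
    field_simp
    ring
  · refine da1.exp.neg.congr_deriv ?_
    change _ = -((U s).2.1 * _) * Real.exp (Real.log (1 + k) + _ + _ - _)
    generalize Real.log (U s).2.1 = ℓ at gr ⊢
    rw [gr, neg_mul]
    congr 1
    have h : ∀ x, (1 + k) * x = Real.exp (Real.log (1 + k)) * x := fun x => by rw [← g1]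
    rw [h (Real.exp _)]
    simp only [← Real.exp_add]
    congr 1
    linear_combination ℓ * hkk
  · refine da2.exp.congr_deriv ?_
    change _ = -((U s).2.1 * _) * -Real.exp (Real.log (1 + 2 * k) + _ - _ + _ + _)
    generalize Real.log (U s).2.1 = ℓ at gr ⊢
    have h : ∀ x, (1 + 2 * k) * x = Real.exp (Real.log (1 + 2 * k)) * x := fun x => by rw [← g2]
    rw [gr, neg_mul_neg, h (Real.exp _)]
    simp only [← Real.exp_add]
    congr 1
    linear_combination ℓ * hkk
  · refine da3.exp.neg.congr_deriv ?_
    change _ = -((U s).2.1 * _) * profileRHS _ _ _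
    rw [hRHS]
    change -(Real.exp (Real.log (1 + 2 * k) + _ - _ + _ + _) * _)
      = -((U s).2.1 * _) * (Real.exp (-Real.log (U s).2.1 / k) ^ (1 + 4 * k) * _)
    generalize Real.log (U s).2.1 = ℓ at gr ⊢
    have h : ∀ x, (1 + 3 * k) * x = Real.exp (Real.log (1 + 3 * k)) * x := fun x => by rw [← g3]
    rw [gr, h (Real.exp _), neg_mul, ← Real.exp_mul]
    simp only [← mul_assoc, ← Real.exp_add]
    congr 3
    simp only [logSum]
    field_simp
    ring

/-- A decreasing curve with nonzero speed and limit `T` at infinity has a differentiable inverse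
near `T`, which tends to infinity at `T`. -/
theorem exists_inverse_of_tendsto {y g : ℝ → ℝ} {s₀ T : ℝ}
    (hy : ∀ s, s₀ ≤ s → HasDerivAt y (g s) s) (hg : ∀ s, s₀ ≤ s → g s < 0)
    (hT : Tendsto y atTop (𝓝 T)) :
    ∃ τ : ℝ → ℝ, (∀ s, s₀ < s → y s ∈ Ioo T (y s₀) ∧ τ (y s) = s) ∧
      (∀ t ∈ Ioo T (y s₀), s₀ < τ t ∧ y (τ t) = t ∧ HasDerivAt τ (g (τ t))⁻¹ t) ∧
      Tendsto τ (𝓝[>] T) atTop := by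
  have hcont : ContinuousOn y (Ici s₀) := fun s hs => (hy s hs).continuousAt.continuousWithinAt
  have hanti : StrictAntiOn y (Ici s₀) := by
    refine strictAntiOn_of_deriv_neg (convex_Ici s₀) hcont fun s hs => ?_
    have hs' : s₀ ≤ s := interior_subset hs
    rw [(hy s hs').deriv]
    exact hg s hs'
  have hgt : ∀ s, s₀ ≤ s → T < y s := by
    intro s hs
    have h1 : T ≤ y (s + 1) := by
      refine le_of_tendsto hT ?_
      filter_upwards [eventually_ge_atTop (s + 1)] with t ht
      exact hanti.antitoneOn (show s₀ ≤ s + 1 by linarith) (show s₀ ≤ t by linarith) ht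
    exact h1.trans_lt (hanti hs (show s₀ ≤ s + 1 by linarith) (by linarith))
  have hsurj : ∀ t, ∃ s, t ∈ Ioo T (y s₀) → s₀ < s ∧ y s = t := by
    intro t
    by_cases ht : t ∈ Ioo T (y s₀)
    · obtain ⟨m, hm, hms⟩ :=
        ((hT.eventually_lt_const ht.1).and (eventually_gt_atTop s₀)).exists
      obtain ⟨s, hs, hst⟩ := intermediate_value_Ioo' hms.le
        (hcont.mono Icc_subset_Ici_self) ⟨hm, ht.2⟩
      exact ⟨s, fun _ => ⟨hs.1, hst⟩⟩
    · exact ⟨0, fun h => absurd h ht⟩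
  choose τ hτ using hsurj
  have hlt : ∀ t ∈ Ioo T (y s₀), ∀ m, s₀ ≤ m → (m < τ t ↔ t < y m) := by
    intro t ht m hm
    obtain ⟨h1, h2⟩ := hτ t ht
    conv_rhs => rw [← h2]
    exact (hanti.lt_iff_gt (show s₀ ≤ τ t from h1.le) hm).symm
  have hgt' : ∀ t ∈ Ioo T (y s₀), ∀ m, s₀ ≤ m → (τ t < m ↔ y m < t) := by
    intro t ht m hm
    obtain ⟨h1, h2⟩ := hτ t ht
    conv_rhs => rw [← h2]
    exact (hanti.lt_iff_gt hm (show s₀ ≤ τ t from h1.le)).symm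
  refine ⟨τ, fun s hs => ?_, fun t ht => ?_, ?_⟩
  · have hm : y s ∈ Ioo T (y s₀) := ⟨hgt s hs.le, hanti self_mem_Ici hs.le hs⟩
    obtain ⟨h1, h2⟩ := hτ _ hm
    exact ⟨hm, hanti.injOn h1.le hs.le h2⟩
  · obtain ⟨h1, h2⟩ := hτ t ht
    refine ⟨h1, h2, ?_⟩
    have hc : ContinuousAt τ t := by
      refine tendsto_order.2 ⟨fun a ha => ?_, fun a ha => ?_⟩
      · have hm : s₀ ≤ max a s₀ := le_max_right _ _
        have h3 : t < y (max a s₀) := (hlt t ht _ hm).1 (max_lt ha h1)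
        filter_upwards [isOpen_Ioo.mem_nhds ht, Iio_mem_nhds h3] with x hx hx'
        exact (le_max_left _ _).trans_lt ((hlt x hx _ hm).2 hx')
      · have hm : s₀ ≤ a := (h1.trans ha).le
        have h3 : y a < t := (hgt' t ht _ hm).1 ha
        filter_upwards [isOpen_Ioo.mem_nhds ht, Ioi_mem_nhds h3] with x hx hx'
        exact (hgt' x hx _ hm).2 hx'
    refine HasDerivAt.of_local_left_inverse hc (hy _ h1.le) (hg _ h1.le).ne ?_
    filter_upwards [isOpen_Ioo.mem_nhds ht] with x hx
    exact (hτ x hx).2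
  · refine tendsto_atTop.2 fun m => ?_
    have hm : s₀ ≤ max m s₀ := le_max_right _ _
    filter_upwards [Ioo_mem_nhdsGT (hgt _ hm), Ioo_mem_nhdsGT (hgt s₀ le_rfl)] with t ht ht'
    exact (le_max_left _ _).trans ((hlt t ht' _ hm).2 ht.2).le

/-- A bounded solution of the logarithmic system, parametrized by its `y`-component, is a blow-up
curve whose blow-up point is the limit of the `y`-component. -/
theorem exists_isBlowUpCurve_of_logCurve {k : ℝ} (hk : 0 < k) {U : ℝ → (ℝ × ℝ × ℝ) × ℝ × ℝ}
    {T : ℝ} (hU : ∀ s, -1 < s → HasDerivAt U (logField k (U s)) s) (hbdd : ∃ C, ∀ s, ‖U s‖ ≤ C)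
    (hT : Tendsto (fun s => (U s).2.2) atTop (𝓝 T)) (hr₀ : 0 < (U 0).2.1)
    (hr : ∀ s, -1 < s → (U s).2.1 = (U 0).2.1 * Real.exp (-k * s)) :
    ∃ b u, (U 0).2.2 ∈ Ioo T b ∧ IsBlowUpCurve (1 + 4 * k) T b u ∧
      u (U 0).2.2 = expCoord k (U 0) := by
  have hrpos : ∀ s, -1 < s → 0 < (U s).2.1 := fun s hs => by rw [hr s hs]; positivity
  -- The parametrization starts at `s = -1/2 < 0`, so that `(U 0).2.2` is interior.
  have hs₀ : ∀ s : ℝ, -1 / 2 ≤ s → -1 < s := fun s hs => by linarith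
  obtain ⟨τ, hτ1, hτ2, hτ3⟩ := exists_inverse_of_tendsto (s₀ := -1 / 2)
    (y := fun s => (U s).2.2) (g := fun s => -((U s).2.1 * Real.exp (logSum k (U s).1))) (T := T)
    (fun s hs => (hU s (hs₀ s hs)).snd.snd)
    (fun s hs => neg_neg_of_pos (mul_pos (hrpos s (hs₀ s hs)) (Real.exp_pos _))) hT
  obtain ⟨h1, h2⟩ := hτ1 0 (by norm_num)
  have hev : ∀ᶠ t in 𝓝[>] T, t ∈ Ioo T (U (-1 / 2)).2.2 := Ioo_mem_nhdsGT (h1.1.trans h1.2)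
  refine ⟨_, fun t => expCoord k (U (τ t)), h1, ⟨fun t ht => ?_, ?_, ?_⟩, ?_⟩
  · obtain ⟨ht1, ht2, ht3⟩ := hτ2 t ht
    have hs := hs₀ _ ht1.le
    have hd := (hasDerivAt_expCoord hk (hU _ hs) (hrpos _ hs)).scomp t ht3
    refine hd.congr_deriv ?_
    have hne : -((U (τ t)).2.1 * Real.exp (logSum k (U (τ t)).1)) ≠ 0 :=
      (neg_neg_of_pos (mul_pos (hrpos _ hs) (Real.exp_pos _))).ne
    rw [smul_smul, inv_mul_cancel₀ hne, one_smul, ht2]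
  · have hlim : Tendsto (fun s => -Real.log (U 0).2.1 / k + s) atTop atTop :=
      tendsto_atTop_add_const_left _ _ tendsto_id
    refine (Real.tendsto_exp_atTop.comp (hlim.comp hτ3)).congr' ?_
    filter_upwards [hev] with t ht
    obtain ⟨ht1, ht2, ht3⟩ := hτ2 t ht
    change Real.exp _ = Real.exp _
    simp only [Function.comp_apply]
    rw [hr (τ t) (hs₀ _ ht1.le), Real.log_mul hr₀.ne' (Real.exp_pos _).ne', Real.log_exp]
    congr 1
    field_simp
    ring
  · obtain ⟨C, hC⟩ := hbdd
    have hcont : Continuous fun q : (ℝ × ℝ × ℝ) × ℝ × ℝ =>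
        q.2.2 / 4 * Real.exp (-logSum k q.1) := by
      have := (contDiff_logSum k).continuous
      fun_prop
    obtain ⟨M, hM⟩ :=
      (isCompact_closedBall (0 : (ℝ × ℝ × ℝ) × ℝ × ℝ) C).exists_bound_of_continuousOn
        hcont.continuousOn
    have hr0 : Tendsto (fun s => (U 0).2.1 * Real.exp (-k * s)) atTop (𝓝 0) := by
      have h : Tendsto (fun s => -k * s) atTop atBot :=
        tendsto_id.const_mul_atTop_of_neg (neg_lt_zero.2 hk)
      simpa using (Real.tendsto_exp_atBot.comp h).const_mul (U 0).2.1
    have hδ : Tendsto (fun s => 1 + logPert k (U s)) atTop (𝓝 1) := by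
      have l1 := ((hr0.pow 4).neg.div_const (4 * k))
      have l2 : Tendsto (fun s => (U s).2.2 / 4 * Real.exp (-logSum k (U s).1)
          * ((U 0).2.1 * Real.exp (-k * s)) ^ 3) atTop (𝓝 0) := by
        have l3 := hr0.pow 3
        rw [zero_pow (by norm_num)] at l3
        refine bdd_le_mul_tendsto_zero' M (.of_forall fun s => ?_) l3
        exact hM (U s) (mem_closedBall_zero_iff.2 (hC s))
      have l4 := (l1.add l2).const_add 1
      rw [zero_pow (by norm_num), neg_zero, zero_div, add_zero, add_zero] at l4
      refine l4.congr' ?_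
      filter_upwards [eventually_gt_atTop (-1)] with s hs
      rw [logPert, hr s hs]
      ring
    refine (hδ.comp hτ3).congr' ?_
    filter_upwards [hev] with t ht
    obtain ⟨ht1, ht2, ht3⟩ := hτ2 t ht
    have h0 : 0 < expCoord k (U (τ t)) 0 := Real.exp_pos _
    have h := profileRHS_expCoord hk (hrpos _ (hs₀ _ ht1.le))
    rw [ht2] at h
    rw [h, mul_div_cancel_left₀ _ (Real.rpow_pos_of_pos h0 _).ne']
    rfl
  · change expCoord k (U (τ (U 0).2.2)) = _
    rw [h2]

/-- Along a blow-up curve the logarithmic coordinates converge to an equilibrium. -/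
theorem IsBlowUpCurve.tendsto_logCoord {p y₀ b : ℝ} (hp : 1 < p) (hb : y₀ < b)
    {u : ℝ → Fin 4 → ℝ} (hu : IsBlowUpCurve p y₀ b u) :
    Tendsto (fun t => logCoord ((p - 1) / 4) (t, u t)) (𝓝[>] y₀) (𝓝 (0, 0, y₀)) := by
  have hs := hu.eventually_signs hb
  obtain ⟨hP, hQ, hS⟩ := hu.tendsto_quotients hp hb
  set k := (p - 1) / 4 with hk
  have hk0 : 0 < k := by simp only [hk]; linarith
  have e1 := (hP.log (by positivity)).sub_const (Real.log (1 + k))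
  have e2 := (hQ.log (by positivity)).sub_const (Real.log (1 + 2 * k))
  have e3 := (hS.log (by positivity)).sub_const (Real.log (1 + 3 * k))
  rw [sub_self] at e1 e2 e3
  have e4 : Tendsto (fun t => Real.exp (-k * Real.log (u t 0))) (𝓝[>] y₀) (𝓝 0) :=
    Real.tendsto_exp_atBot.comp ((Real.tendsto_log_atTop.comp hu.2.1).const_mul_atTop_of_neg
      (neg_lt_zero.2 hk0))
  have e5 : Tendsto (fun t : ℝ => t) (𝓝[>] y₀) (𝓝 y₀) := tendsto_id.mono_left nhdsWithin_le_nhds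
  refine ((e1.prodMk_nhds (e2.prodMk_nhds e3)).prodMk_nhds (e4.prodMk_nhds e5)).congr' ?_
  filter_upwards [hs] with t ⟨h0, h1, h2, h3⟩
  have h3' := h3.ne
  have h1' := h1.ne
  have hz := h0.ne'
  have hz2 := h2.ne'
  simp only [logCoord]
  rw [Real.log_div (by positivity) (by positivity), Real.log_div (by positivity) (by positivity),
    Real.log_div (by positivity) (by positivity), Real.log_mul hz hz2, Real.log_mul hz h3',
    Real.log_mul h1' hz2, Real.log_mul h1' h3', Real.log_rpow h0, Real.log_pow]
  refine Prod.ext (Prod.ext ?_ (Prod.ext ?_ ?_)) rfl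
  · push_cast; ring
  · ring
  · ring

end LogCoordinates

/-! ### The blow-up point as a function of the Cauchy data -/

section BlowUpPoint

/-- Near the point `ξ = (y, z)` of the extended phase space, every point lies on a blow-up curve
whose blow-up point is a regular `C¹` function. -/
def IsRegularBlowUp (p : ℝ) (ξ : ℝ × (Fin 4 → ℝ)) : Prop :=
  ∃ T : ℝ × (Fin 4 → ℝ) → ℝ, ContDiffAt ℝ 1 T ξ ∧ fderiv ℝ T ξ ≠ 0 ∧
    ∀ᶠ ζ in 𝓝 ξ, ∃ b u, ζ.1 ∈ Ioo (T ζ) b ∧ IsBlowUpCurve p (T ζ) b u ∧ u ζ.1 = ζ.2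

/-- The blow-up point of an orbit is unique. -/
theorem IsBlowUpCurve.blowUpPoint_unique {p y₀ b y₀' b' t : ℝ} (hp : 1 < p)
    {u w : ℝ → Fin 4 → ℝ} (hu : IsBlowUpCurve p y₀ b u) (hw : IsBlowUpCurve p y₀' b' w)
    (ht : t ∈ Ioo y₀ b) (ht' : t ∈ Ioo y₀' b') (h : u t = w t) : y₀ = y₀' := by
  have key : ∀ {y₀ b y₀' b' : ℝ} {u w : ℝ → Fin 4 → ℝ}, IsBlowUpCurve p y₀ b u →
      IsBlowUpCurve p y₀' b' w → t ∈ Ioo y₀ b → t ∈ Ioo y₀' b' → u t = w t → ¬ y₀ < y₀' := by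
    intro y₀ b y₀' b' u w hu hw ht ht' h hlt
    have hm : t ∈ Ioo y₀' (min b b') := ⟨ht'.1, lt_min ht.2 ht'.2⟩
    have he := (hu.1.mono hlt.le (min_le_left b b')).eqOn hp
      (hw.1.mono le_rfl (min_le_right b b')) hm h
    have h1 : Tendsto (fun s => u s 0) (𝓝[>] y₀') (𝓝 (u y₀' 0)) :=
      (hasDerivAt_pi.1 (hu.1 y₀' ⟨hlt, ht'.1.trans ht.2⟩) 0).continuousAt.tendsto.mono_left
        nhdsWithin_le_nhds
    refine not_tendsto_nhds_of_tendsto_atTop hw.2.1 _ (h1.congr' ?_)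
    filter_upwards [Ioo_mem_nhdsGT (hm.1.trans hm.2)] with s hs
    rw [he hs]
  rcases lt_trichotomy y₀ y₀' with h1 | h1 | h1
  · exact absurd h1 (key hu hw ht ht' h)
  · exact h1
  · exact absurd h1 (key hw hu ht' ht h.symm)

/-- Close to the blow-up point, the regular blow-up function comes from the attracting line of
equilibria of the logarithmic system. -/
theorem IsBlowUpCurve.eventually_isRegularBlowUp {p y₀ b : ℝ} (hp : 1 < p) (hb : y₀ < b)
    {u : ℝ → Fin 4 → ℝ} (hu : IsBlowUpCurve p y₀ b u) :
    ∀ᶠ t in 𝓝[>] y₀, IsRegularBlowUp p (t, u t) := by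
  have hk : 0 < (p - 1) / 4 := by linarith
  have hpk : 1 + 4 * ((p - 1) / 4) = p := by ring
  set k := (p - 1) / 4
  obtain ⟨T, hT, hTy, hfam⟩ := exists_logCurve_family hk y₀
  have hbase : fderiv ℝ T (0, 0, y₀) (0, 0, 1) = 1 := by
    have h1 : HasDerivAt (fun y : ℝ => ((0, 0, y) : (ℝ × ℝ × ℝ) × ℝ × ℝ)) (0, 0, 1) y₀ :=
      (hasDerivAt_const y₀ (0 : ℝ × ℝ × ℝ)).prodMk
        ((hasDerivAt_const y₀ (0 : ℝ)).prodMk (hasDerivAt_id y₀))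
    have h2 := (hT.differentiableAt one_ne_zero).hasFDerivAt.comp_hasDerivAt y₀ h1
    have h3 : (T ∘ fun y : ℝ => ((0, 0, y) : (ℝ × ℝ × ℝ) × ℝ × ℝ)) = id := funext hTy
    rw [h3] at h2
    exact h2.unique (hasDerivAt_id y₀)
  have hne : ∀ᶠ q in 𝓝 ((0, 0, y₀) : (ℝ × ℝ × ℝ) × ℝ × ℝ), fderiv ℝ T q (0, 0, 1) ≠ 0 := by
    have h1 : ContinuousAt (fun q => fderiv ℝ T q (0, 0, 1)) (0, 0, y₀) :=
      (hT.continuousAt_fderiv one_ne_zero).clm_apply continuousAt_const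
    exact h1.eventually_ne (by rw [hbase]; exact one_ne_zero)
  have hlog := hu.tendsto_logCoord hp hb
  filter_upwards [hu.eventually_signs hb, hlog.eventually (hT.eventually (by simp)),
    hlog.eventually hne, hlog.eventually hfam.eventually_nhds] with t ⟨h0, h1, h2, h3⟩ hTt hnet hft
  have hΘ : ContDiffAt ℝ 1 (logCoord k) (t, u t) := by
    refine contDiffAt_logCoord k fun i => ?_
    fin_cases i
    exacts [h0.ne', h1.ne, h2.ne', h3.ne]
  refine ⟨T ∘ logCoord k, hTt.comp _ hΘ, fun hz => hnet ?_, ?_⟩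
  · have d1 : HasDerivAt (fun y : ℝ => (y, u t)) (1, 0) t :=
      (hasDerivAt_id t).prodMk (hasDerivAt_const t (u t))
    have d2 := (hΘ.differentiableAt one_ne_zero).hasFDerivAt.comp_hasDerivAt t d1
    have d3 : HasDerivAt
        (fun y : ℝ => ((logCoord k (t, u t)).1, (logCoord k (t, u t)).2.1, y)) (0, 0, 1) t :=
      (hasDerivAt_const t _).prodMk ((hasDerivAt_const t _).prodMk (hasDerivAt_id t))
    have d3 : HasDerivAt (logCoord k ∘ fun y : ℝ => (y, u t)) (0, 0, 1) t := d3
    rw [← d2.unique d3]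
    have d4 := ((hTt.differentiableAt one_ne_zero).hasFDerivAt.comp (t, u t)
      (hΘ.differentiableAt one_ne_zero).hasFDerivAt).fderiv
    rw [hz] at d4
    exact (DFunLike.congr_fun d4 (1, 0)).symm
  · have hc : ∀ i : Fin 4, ContinuousAt (fun ζ : ℝ × (Fin 4 → ℝ) => ζ.2 i) (t, u t) := fun i => by
      fun_prop
    filter_upwards [hΘ.continuousAt.tendsto.eventually hft, (hc 0).eventually_const_lt h0,
      (hc 1).eventually_lt_const h1, (hc 2).eventually_const_lt h2,
      (hc 3).eventually_lt_const h3] with ζ ⟨U, hU0, hU, hbdd, hlim, hr⟩ z0 z1 z2 z3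
    have hr0 : 0 < (U 0).2.1 := by rw [hU0]; exact Real.exp_pos _
    obtain ⟨b', w, hmem, hw, hwe⟩ := exists_isBlowUpCurve_of_logCurve hk hU hbdd hlim hr0
      (fun s hs => by rw [hr s hs, hU0])
    rw [hU0] at hmem hwe
    rw [hpk] at hw
    exact ⟨b', w, hmem, hw, hwe.trans (expCoord_logCoord hk z0 z1 z2 z3)⟩

/-- An integral curve of the extended field projects to a jet curve. -/
theorem isJetCurve_of_extended {p δ : ℝ} {c : ℝ → ℝ × (Fin 4 → ℝ)}
    (hc : ∀ t, |t| < δ → HasDerivAt c (extendedField p (c t)) t) :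
    (∀ t, |t| < δ → (c t).1 = (c 0).1 + t) ∧
      IsJetCurve p ((c 0).1 - δ) ((c 0).1 + δ) fun t => (c (t - (c 0).1)).2 := by
  have h1 : ∀ t, |t| < δ → (c t).1 = (c 0).1 + t := by
    intro t ht
    have hδ : 0 < δ := (abs_nonneg t).trans_lt ht
    have hd : ∀ s ∈ Ioo (-δ) δ, HasDerivAt (fun s => (c s).1 - s) 0 s := by
      intro s hs
      have h : HasDerivAt (fun s => (c s).1) 1 s := (hc s (abs_lt.2 hs)).fst
      exact (h.sub (hasDerivAt_id s)).congr_deriv (sub_self 1)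
    have h := isOpen_Ioo.is_const_of_deriv_eq_zero isPreconnected_Ioo
      (fun s hs => (hd s hs).differentiableAt.differentiableWithinAt)
      (fun s hs => (hd s hs).deriv) (abs_lt.1 ht) (show (0 : ℝ) ∈ Ioo (-δ) δ from ⟨by linarith, hδ⟩)
    simp only [sub_zero] at h
    linarith
  refine ⟨h1, fun t ht => ?_⟩
  have ht' : |t - (c 0).1| < δ := abs_lt.2 ⟨by linarith [ht.1], by linarith [ht.2]⟩
  have h2 : HasDerivAt (fun s => (c s).2) (profileField p (c (t - (c 0).1)).1 (c (t - (c 0).1)).2)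
      (t - (c 0).1) := (hc _ ht').snd
  have h3 := h2.scomp t ((hasDerivAt_id t).sub_const (c 0).1)
  rw [one_smul, h1 _ ht', add_sub_cancel] at h3
  exact h3

/-- Regularity is carried forward along an orbit by the local flow. -/
theorem IsJetCurve.exists_isRegularBlowUp_transport {p a b s : ℝ} (hp : 1 < p)
    {u : ℝ → Fin 4 → ℝ} (hu : IsJetCurve p a b u) (hs : s ∈ Ioo a b) :
    ∃ ε > 0, ∀ t ∈ Ioo (s - ε) (s + ε), ∀ t' ∈ Ioo (s - ε) (s + ε), t ≤ t' → t ∈ Ioo a b →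
      t' ∈ Ioo a b → IsRegularBlowUp p (t, u t) → IsRegularBlowUp p (t', u t') := by
  obtain ⟨Φ, hΦ⟩ := exists_contDiffAt_localFlow (contDiff_extendedField hp) (s, u s)
  have hcont : ContinuousAt (fun x : ℝ × ℝ => ((x.2, u x.2), x.1 - x.2)) (s, s) := by
    have h1 : ContinuousAt (fun x : ℝ × ℝ => u x.2) (s, s) :=
      ContinuousAt.comp (f := Prod.snd) (g := u) (hu s hs).continuousAt continuousAt_snd
    exact (continuousAt_snd.prodMk h1).prodMk (continuousAt_fst.sub continuousAt_snd)
  have hev : ∀ᶠ x : ℝ × ℝ in 𝓝 (s, s),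
      ∀ᶠ q in 𝓝 (((x.2, u x.2), x.1 - x.2) : (ℝ × (Fin 4 → ℝ)) × ℝ), _ :=
    hcont.tendsto.eventually (by simpa only [sub_self] using hΦ.eventually_nhds)
  obtain ⟨ε, hε, hball⟩ := Metric.eventually_nhds_iff_ball.1 hev
  refine ⟨ε, hε, fun t ht t' ht' htt' hta hta' hreg => ?_⟩
  rcases eq_or_lt_of_le htt' with rfl | hlt
  · exact hreg
  obtain ⟨T, hT, hTne, hTev⟩ := hreg
  have hq := hball (t, t') (by
    rw [← ball_prod_same, Real.ball_eq_Ioo]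
    exact ⟨ht, ht'⟩)
  simp only at hq
  obtain ⟨hC1, hunit, c, hc0, hch, hc⟩ := hq.self_of_nhds
  simp only at hc0 hch hc
  have habs : |t - t'| = t' - t := by rw [abs_of_neg (by linarith)]; ring
  rw [habs] at hc
  obtain ⟨hfst, hjet⟩ := isJetCurve_of_extended hc
  have hval : Φ ((t', u t'), t - t') = (t, u t) := by
    rw [← hch]
    refine Prod.ext ?_ ?_
    · rw [hfst _ (by rw [habs]; linarith), hc0]; ring
    · rw [hc0] at hjet
      have he := (hjet.mono (le_max_right a _) (min_le_right b _)).eqOn hp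
        (hu.mono (le_max_left a _) (min_le_left b _)) (t₀ := t')
        ⟨max_lt hta'.1 (by simp only; linarith), lt_min hta'.2 (by simp only; linarith)⟩
        (by simp [hc0])
      exact he (x := t)
        ⟨max_lt hta.1 (by simp only; linarith), lt_min hta.2 (by simp only; linarith)⟩
  have hin := hasFDerivAt_prodMk_left (𝕜 := ℝ) (t', u t') (t - t')
  have hΨ : ContDiffAt ℝ 1 (fun ζ => Φ (ζ, t - t')) (t', u t') :=
    hC1.comp (t', u t') (by fun_prop)
  have hΨd : HasFDerivAt (fun ζ => Φ (ζ, t - t')) _ (t', u t') :=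
    HasFDerivAt.comp (g := Φ) (t', u t') (hC1.differentiableAt one_ne_zero).hasFDerivAt hin
  rw [← hval] at hT hTne hTev
  refine ⟨fun ζ => T (Φ (ζ, t - t')), hT.comp (t', u t') hΨ, fun hz => hTne ?_, ?_⟩
  · have hd := (HasFDerivAt.comp (g := T) (t', u t')
      (hT.differentiableAt one_ne_zero).hasFDerivAt hΨd).fderiv
    have hz' : fderiv ℝ T (Φ ((t', u t'), t - t')) ∘L
        (fderiv ℝ Φ ((t', u t'), t - t') ∘L ContinuousLinearMap.inl ℝ (ℝ × (Fin 4 → ℝ)) ℝ) = 0 :=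
      hd.symm.trans hz
    obtain ⟨A, hA⟩ := hunit
    refine ContinuousLinearMap.ext fun v => ?_
    have h1 := DFunLike.congr_fun hz' ((A⁻¹ : (_ →L[ℝ] _)ˣ).val v)
    have h2 : A.val ((A⁻¹ : (_ →L[ℝ] _)ˣ).val v) = v := DFunLike.congr_fun A.mul_inv v
    rwa [← hA, ContinuousLinearMap.comp_apply, h2] at h1
  · have hcont' : ContinuousAt (fun ζ : ℝ × (Fin 4 → ℝ) => (ζ, t - t')) (t', u t') := by fun_prop
    filter_upwards [hΨ.continuousAt.tendsto.eventually hTev, hcont'.tendsto.eventually hq]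
      with ζ ⟨b', w, hm, hw, hwe⟩ ⟨_, _, c, hc0, hch, hc⟩
    rw [habs] at hc
    obtain ⟨hfst, hjet⟩ := isJetCurve_of_extended hc
    have h1 : (Φ (ζ, t - t')).1 = ζ.1 + (t - t') := by
      rw [← hch, hfst _ (by rw [habs]; linarith), hc0]
    rw [hc0] at hjet
    rw [h1] at hm hwe
    have hg := hw.1.glue hjet hm (by constructor <;> linarith)
      (by rw [hwe, add_sub_cancel_left, hch])
    have hev : ∀ᶠ x in 𝓝[>] (T (Φ (ζ, t - t'))), x ≤ ζ.1 + (t - t') := by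
      filter_upwards [Ioo_mem_nhdsGT hm.1] with x hx using hx.2.le
    refine ⟨_, _, ⟨by linarith [hm.1], by linarith⟩, ⟨hg, hw.2.1.congr' ?_, hw.2.2.congr' ?_⟩, ?_⟩
    · filter_upwards [hev] with x hx using by rw [if_pos hx]
    · filter_upwards [hev] with x hx using by rw [if_pos hx]
    · rw [if_neg (by linarith), sub_self, hc0]

theorem IsBlowUpCurve.isRegularBlowUp {p y₀ b t : ℝ} (hp : 1 < p)
    {u : ℝ → Fin 4 → ℝ} (hu : IsBlowUpCurve p y₀ b u) (ht : t ∈ Ioo y₀ b) :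
    IsRegularBlowUp p (t, u t) := by
  obtain ⟨s, hs, hst⟩ := ((hu.eventually_isRegularBlowUp hp (ht.1.trans ht.2)).and
    (Ioo_mem_nhdsGT ht.1)).exists
  have hsub : Icc s t ⊆ Ioo y₀ b := Icc_subset_Ioo hst.1 ht.2
  choose! ε hε htr using fun (r : ℝ) (hr : r ∈ Ioo y₀ b) =>
    hu.1.exists_isRegularBlowUp_transport hp hr
  obtain ⟨x, hx0, hmono, ⟨m, hm⟩, hx⟩ := exists_monotone_Icc_subset_open_cover_Icc hst.2.le
    (c := fun r : Icc s t => {x | (x : ℝ) ∈ Ioo ((r : ℝ) - ε r) ((r : ℝ) + ε r)})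
    (fun r => isOpen_Ioo.preimage continuous_subtype_val)
    (fun r _ => mem_iUnion.2 ⟨r, by
      have := hε r (hsub r.2)
      exact ⟨by linarith, by linarith⟩⟩)
  have hreg : ∀ n, IsRegularBlowUp p ((x n : ℝ), u (x n)) := by
    intro n
    induction n with
    | zero => rw [hx0]; exact hs
    | succ n ih =>
      obtain ⟨r, hr⟩ := hx n
      have hle : x n ≤ x (n + 1) := hmono n.le_succ
      exact htr r (hsub r.2) _ (hr ⟨le_rfl, hle⟩) _ (hr ⟨hle, le_rfl⟩) hle (hsub (x n).2)
        (hsub (x (n + 1)).2) ih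
  have h := hreg m
  rwa [hm m le_rfl] at h

theorem mem_blowUpFibre_iff {p y₀ y₁ : ℝ} (hp : 1 < p) {z : Fin 4 → ℝ} :
    z ∈ blowUpFibre p 1 y₀ y₁ ↔ ∃ b u, y₁ ∈ Ioo y₀ b ∧ IsBlowUpCurve p y₀ b u ∧ u y₁ = z := by
  constructor
  · rintro ⟨b, f, hy, hf, rfl⟩
    exact ⟨b, jet f, hy, hf.isBlowUpCurve (hy.1.trans hy.2), rfl⟩
  · rintro ⟨b, u, hy, hu, rfl⟩
    exact ⟨b, _, hy, hu.isBlowUpSolution hp (hy.1.trans hy.2), hu.1.jet_eq hy⟩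

theorem blowUpFibre_unique {p y₀ y₀' y₁ : ℝ} (hp : 1 < p) {z : Fin 4 → ℝ}
    (h : z ∈ blowUpFibre p 1 y₀ y₁) (h' : z ∈ blowUpFibre p 1 y₀' y₁) : y₀ = y₀' := by
  obtain ⟨b, u, hy, hu, rfl⟩ := (mem_blowUpFibre_iff hp).1 h
  obtain ⟨b', w, hy', hw, hwe⟩ := (mem_blowUpFibre_iff hp).1 h'
  exact hu.blowUpPoint_unique hp hw hy hy' hwe.symm

/-- Near the Cauchy data of a blow-up solution the blow-up point is a regular `C¹` function of the
data. Its differential does not vanish, since the blow-up point is constant along orbits and orbits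
are transverse to the slices of constant `y`. -/
theorem exists_contDiffAt_blowUpPoint {p y₀ y₁ : ℝ} (hp : 1 < p) {z : Fin 4 → ℝ}
    (hz : z ∈ blowUpFibre p 1 y₀ y₁) :
    ∃ T : (Fin 4 → ℝ) → ℝ, ContDiffAt ℝ 1 T z ∧ fderiv ℝ T z ≠ 0 ∧
      ∀ᶠ z' in 𝓝 z, z' ∈ blowUpFibre p 1 (T z') y₁ := by
  obtain ⟨b, u, hy, hu, rfl⟩ := (mem_blowUpFibre_iff hp).1 hz
  obtain ⟨T, hT, hTne, hTev⟩ := hu.isRegularBlowUp hp hy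
  have hin : HasFDerivAt (fun z' : Fin 4 → ℝ => (y₁, z')) (ContinuousLinearMap.inr ℝ ℝ (Fin 4 → ℝ))
      (u y₁) := hasFDerivAt_prodMk_right y₁ (u y₁)
  have hcurve := hu.1.hasDerivAt_extended hy
  have hTd := (hT.differentiableAt one_ne_zero).hasFDerivAt
  have hcomp := hTd.comp (u y₁) hin
  refine ⟨fun z' => T (y₁, z'), hT.comp (u y₁) (by fun_prop), fun h0 => hTne ?_, ?_⟩
  · have hconst : (fun t => T (t, u t)) =ᶠ[𝓝 y₁] fun _ => y₀ := by
      filter_upwards [hcurve.continuousAt.tendsto.eventually hTev, isOpen_Ioo.mem_nhds hy]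
        with t ⟨b', w, hm, hw, hwe⟩ ht
      exact hw.blowUpPoint_unique hp hu hm ht hwe
    have hd1 : fderiv ℝ T (y₁, u y₁) (extendedField p (y₁, u y₁)) = 0 :=
      (hTd.comp_hasDerivAt y₁ hcurve).unique ((hasDerivAt_const y₁ y₀).congr_of_eventuallyEq hconst)
    have hd2 : ∀ v, fderiv ℝ T (y₁, u y₁) (0, v) = 0 := fun v =>
      DFunLike.congr_fun (hcomp.fderiv.symm.trans h0) v
    have hd3 : fderiv ℝ T (y₁, u y₁) (1, 0) = 0 := by
      have h : ((1, 0) : ℝ × (Fin 4 → ℝ)) = extendedField p (y₁, u y₁)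
          - (0, profileField p y₁ (u y₁)) := by simp [extendedField]
      rw [h, map_sub, hd1, hd2, sub_zero]
    refine ContinuousLinearMap.ext fun v => ?_
    have h : v = v.1 • ((1, 0) : ℝ × (Fin 4 → ℝ)) + (0, v.2) := by ext <;> simp
    rw [h, map_add, map_smul, hd2, hd3]
    simp
  · filter_upwards [hin.continuousAt.tendsto.eventually hTev] with z' h
    exact (mem_blowUpFibre_iff hp).2 h

/-- On the line `w = 0` near every point there are data of blow-up solutions. -/
theorem exists_contDiffAt_blowUpFamily {p : ℝ} (hp : 1 < p) (η : ℝ) :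
    ∃ T : ℝ × ℝ → ℝ, ContDiffAt ℝ 1 T (0, η) ∧ (∀ y, T (0, y) = y) ∧
      ∀ᶠ q in 𝓝 ((0, η) : ℝ × ℝ), 0 < q.1 → ∃ z, z ∈ blowUpFibre p 1 (T q) q.2 := by
  have hk : 0 < (p - 1) / 4 := by linarith
  have hpk : 1 + 4 * ((p - 1) / 4) = p := by ring
  obtain ⟨T, hT, hTy, hfam⟩ := exists_logCurve_family hk η
  refine ⟨fun q => T (0, q), hT.comp (0, η) (by fun_prop), hTy, ?_⟩
  have hc : ContinuousAt (fun q : ℝ × ℝ => ((0, q) : (ℝ × ℝ × ℝ) × ℝ × ℝ)) (0, η) := by fun_prop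
  filter_upwards [hc.tendsto.eventually hfam] with q ⟨U, hU0, hU, hbdd, hlim, hr⟩ hq
  obtain ⟨b, w, hm, hw, -⟩ := exists_isBlowUpCurve_of_logCurve hk hU hbdd hlim (by rwa [hU0])
    (fun s hs => by rw [hr s hs, hU0])
  rw [hU0] at hm
  rw [hpk] at hw
  exact ⟨_, (mem_blowUpFibre_iff hp).2 ⟨b, w, hm, hw, rfl⟩⟩

theorem exists_mem_blowUpFibre {p : ℝ} (hp : 1 < p) (y₁ : ℝ) :
    ∃ y₀ z, z ∈ blowUpFibre p 1 y₀ y₁ := by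
  obtain ⟨T, -, -, hT⟩ := exists_contDiffAt_blowUpFamily hp y₁
  have hc : Tendsto (fun r : ℝ => (r, y₁)) (𝓝[>] 0) (𝓝 (0, y₁)) :=
    ((Continuous.prodMk_left y₁).tendsto 0).mono_left nhdsWithin_le_nhds
  obtain ⟨r, h, hr⟩ := ((hc.eventually hT).and self_mem_nhdsWithin).exists
  exact ⟨_, h hr⟩

/-- Every point is a blow-up point: the blow-up point of the data `(0, r, y)` depends continuously
on `y` and is close to `y` for small `r`. -/
theorem exists_isBlowUpSolution {p : ℝ} (hp : 1 < p) (y₀ : ℝ) :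
    ∃ b, y₀ < b ∧ ∃ f, IsBlowUpSolution p 1 y₀ b f := by
  obtain ⟨T, hT, hTy, hfam⟩ := exists_contDiffAt_blowUpFamily hp y₀
  obtain ⟨ε, hε, hball⟩ := Metric.eventually_nhds_iff_ball.1
    ((hT.eventually (by simp)).and hfam)
  have hmem : ∀ r y, |r| < ε → |y - y₀| < ε → (r, y) ∈ Metric.ball ((0, y₀) : ℝ × ℝ) ε := by
    intro r y h1 h2
    rw [← ball_prod_same]
    exact ⟨by simpa using h1, by simpa [Real.dist_eq] using h2⟩
  have hlim : ∀ y, |y - y₀| < ε → Tendsto (fun r => T (r, y)) (𝓝[>] 0) (𝓝 y) := by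
    intro y hy
    have h1 := (hball _ (hmem 0 y (by simpa using hε) hy)).1.continuousAt
    have h2 : ContinuousAt (fun r : ℝ => T (r, y)) 0 :=
      ContinuousAt.comp (g := T) (f := fun r : ℝ => (r, y)) h1 (by fun_prop)
    have h3 := h2.tendsto
    rw [hTy] at h3
    exact h3.mono_left nhdsWithin_le_nhds
  have e1 : |y₀ - ε / 2 - y₀| < ε := by
    rw [sub_sub_cancel_left, abs_neg, abs_of_pos (by linarith)]; linarith
  have e2 : |y₀ + ε / 2 - y₀| < ε := by
    rw [add_sub_cancel_left, abs_of_pos (by linarith)]; linarith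
  obtain ⟨r, ⟨h1, h2⟩, hr⟩ := (((hlim _ e1).eventually_lt_const
    (show y₀ - ε / 2 < y₀ by linarith)).and ((hlim _ e2).eventually_const_lt
    (show y₀ < y₀ + ε / 2 by linarith)) |>.and (Ioo_mem_nhdsGT hε)).exists
  have hr' : |r| < ε := by rw [abs_of_pos hr.1]; exact hr.2
  have hcont : ContinuousOn (fun y => T (r, y)) (Icc (y₀ - ε / 2) (y₀ + ε / 2)) := by
    intro y hy
    have h := (hball _ (hmem r y hr'
      (abs_lt.2 ⟨by linarith [hy.1], by linarith [hy.2]⟩))).1.continuousAt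
    exact (ContinuousAt.comp (g := T) (f := fun y : ℝ => (r, y)) h
      (by fun_prop)).continuousWithinAt
  obtain ⟨y, hy, hTy0⟩ := intermediate_value_Icc (by linarith) hcont ⟨h1.le, h2.le⟩
  obtain ⟨z, b, f, hb, hf, -⟩ :=
    (hball _ (hmem r y hr' (abs_lt.2 ⟨by linarith [hy.1], by linarith [hy.2]⟩))).2 hr.1
  simp only at hTy0
  rw [hTy0] at hb hf
  exact ⟨b, hb.1.trans hb.2, f, hf⟩

/-- A set `D` covered by disjoint fibres, whose parameter is locally a regular `C¹` function, is
open, and the parameter is a regular `C¹` function on `D`. -/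
theorem exists_contDiffOn_of_fibres {E : Type*} [NormedAddCommGroup E] [NormedSpace ℝ E]
    (F : ℝ → Set E) (hdisj : ∀ s t z, z ∈ F s → z ∈ F t → s = t)
    (hloc : ∀ s, ∀ z ∈ F s, ∃ T : E → ℝ, ContDiffAt ℝ 1 T z ∧ fderiv ℝ T z ≠ 0 ∧
      ∀ᶠ z' in 𝓝 z, z' ∈ F (T z')) :
    IsOpen (⋃ s, F s) ∧ ∃ T : E → ℝ, ContDiffOn ℝ 1 T (⋃ s, F s) ∧
      (∀ z ∈ ⋃ s, F s, fderiv ℝ T z ≠ 0) ∧ ∀ s, F s = {z ∈ ⋃ s, F s | T z = s} := by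
  have hex : ∀ z, ∃ s, z ∈ ⋃ s, F s → z ∈ F s := by
    intro z
    by_cases h : z ∈ ⋃ s, F s
    · obtain ⟨s, hs⟩ := mem_iUnion.1 h
      exact ⟨s, fun _ => hs⟩
    · exact ⟨0, fun h' => absurd h' h⟩
  choose T hT using hex
  have hTeq : ∀ s, ∀ z ∈ F s, T z = s := fun s z hz =>
    hdisj _ _ z (hT z (mem_iUnion.2 ⟨s, hz⟩)) hz
  have hmain : ∀ z ∈ ⋃ s, F s, (⋃ s, F s) ∈ 𝓝 z ∧ ContDiffAt ℝ 1 T z ∧ fderiv ℝ T z ≠ 0 := by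
    intro z hz
    obtain ⟨T', h1, h2, h3⟩ := hloc _ z (hT z hz)
    have he : T =ᶠ[𝓝 z] T' := h3.mono fun z' hz' => hTeq _ z' hz'
    exact ⟨h3.mono fun z' hz' => mem_iUnion.2 ⟨_, hz'⟩, h1.congr_of_eventuallyEq he,
      by rwa [he.fderiv_eq]⟩
  refine ⟨isOpen_iff_mem_nhds.2 fun z hz => (hmain z hz).1, T,
    fun z hz => (hmain z hz).2.1.contDiffWithinAt, fun z hz => (hmain z hz).2.2, fun s => ?_⟩
  ext z
  exact ⟨fun h => ⟨mem_iUnion.2 ⟨s, h⟩, hTeq s z h⟩, fun h => h.2 ▸ hT z h.1⟩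

end BlowUpPoint

/-! ### The sign symmetry and the four-dimensional set of blow-up solutions -/

theorem isProfileSolution_neg {p a b : ℝ} {f : ℝ → ℝ} (hf : IsProfileSolution p a b f) :
    IsProfileSolution p a b (-f) := by
  refine ⟨hf.1.neg, fun y hy => ?_⟩
  have h := hf.2 y hy
  rw [iteratedDeriv_neg, deriv.neg, Pi.neg_apply, abs_neg]
  linear_combination -h

theorem isProfileSolution_neg_iff {p a b : ℝ} {f : ℝ → ℝ} :
    IsProfileSolution p a b (-f) ↔ IsProfileSolution p a b f :=
  ⟨fun h => neg_neg f ▸ isProfileSolution_neg h, isProfileSolution_neg⟩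

theorem isBlowUpSolution_neg_iff {p y₀ b : ℝ} {f : ℝ → ℝ} :
    IsBlowUpSolution p (-1) y₀ b f ↔ IsBlowUpSolution p 1 y₀ b (-f) := by
  unfold IsBlowUpSolution
  rw [isProfileSolution_neg_iff]
  simp [iteratedDeriv_neg]

theorem mem_blowUpFibre_neg_iff {p y₀ y₁ : ℝ} {z : Fin 4 → ℝ} :
    z ∈ blowUpFibre p (-1) y₀ y₁ ↔ -z ∈ blowUpFibre p 1 y₀ y₁ := by
  have hjet : ∀ f : ℝ → ℝ, jet (-f) y₁ = -jet f y₁ := fun f => by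
    ext i; simp [jet, iteratedDeriv_neg]
  constructor
  · rintro ⟨b, f, hy, hf, rfl⟩
    exact ⟨b, -f, hy, isBlowUpSolution_neg_iff.1 hf, hjet f⟩
  · rintro ⟨b, f, hy, hf, hz⟩
    refine ⟨b, -f, hy, isBlowUpSolution_neg_iff.2 (by rwa [neg_neg]), ?_⟩
    rw [hjet, hz, neg_neg]

theorem isBlowUpSolution_iff_tendsto_ratio {p y₀ b : ℝ} (hp : 1 < p) (hb : y₀ < b) (f : ℝ → ℝ) :
    IsBlowUpSolution p 1 y₀ b f ↔ IsProfileSolution p y₀ b f ∧ ∀ k : ℕ, k ≤ 3 →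
      Tendsto (fun y => iteratedDeriv k f y / iteratedDeriv k (explicitBlowUp p y₀) y)
        (𝓝[>] y₀) (𝓝 1) := by
  constructor
  · intro hf
    exact ⟨hf.1, fun k hk => (hf.isBlowUpCurve hb).tendsto_ratio hp hb ⟨k, by omega⟩⟩
  · rintro ⟨hf, hlim⟩
    have h := (isBlowUpCurve_of_tendsto_ratio hp hf.isJetCurve (hlim 0 (by norm_num))
      (hlim 1 (by norm_num))).isBlowUpSolution hp hb
    have e : (fun y => jet f y 0) = f := by funext y; simp [jet]
    rwa [e] at h

theorem proposition2p1 (p : ℝ) (hp : 1 < p) (σ : ℝ) (hσ : σ = 1 ∨ σ = -1) :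
    -- a solution is determined by its Cauchy data at one point
    (∀ a b y₁ : ℝ, y₁ ∈ Ioo a b → ∀ f g : ℝ → ℝ,
      IsProfileSolution p a b f → IsProfileSolution p a b g → jet f y₁ = jet g y₁ →
        EqOn f g (Ioo a b)) ∧
    -- the set of blow-up solutions is four-dimensional, `y₀` is one of the four parameters, and
    -- for fixed `y₀` there remains a three-dimensional manifold
    (∀ y₁ : ℝ, IsOpen (blowUpData p σ y₁) ∧ (blowUpData p σ y₁).Nonempty ∧
      ∃ T : (Fin 4 → ℝ) → ℝ,
        ContDiffOn ℝ 1 T (blowUpData p σ y₁) ∧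
        (∀ z ∈ blowUpData p σ y₁, fderiv ℝ T z ≠ 0) ∧
        ∀ y₀ : ℝ, blowUpFibre p σ y₀ y₁ = {z ∈ blowUpData p σ y₁ | T z = y₀}) ∧
    -- every point `y₀` occurs as a blow-up point
    (∀ y₀ : ℝ, ∃ b : ℝ, y₀ < b ∧ ∃ f : ℝ → ℝ, IsBlowUpSolution p σ y₀ b f) ∧
    -- the solutions blowing up at `y₀` form the stable set of the explicit solution
    (∀ y₀ b : ℝ, y₀ < b → ∀ f : ℝ → ℝ,
      IsBlowUpSolution p σ y₀ b f ↔
        IsProfileSolution p y₀ b f ∧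
          ∀ k : ℕ, k ≤ 3 →
            Tendsto (fun y => iteratedDeriv k f y / iteratedDeriv k (explicitBlowUp p y₀) y)
              (𝓝[>] y₀) (𝓝 σ)) ∧
    -- the linearization about the explicit solution and its characteristic equation
    (∀ (y₀ : ℝ) (m : ℂ),
      IsEulerMode p y₀ m ↔ eulerPhi m = (p : ℂ) * eulerPhi (-4 / ((p : ℂ) - 1))) ∧
    -- three of its four roots have real part larger than `-4/(p-1)`
    (∃ mp mm β : ℝ, 3 < mp ∧ mm < -4 / (p - 1) ∧ 0 < β ∧
      ∀ m : ℂ, eulerPhi m = (p : ℂ) * eulerPhi (-4 / ((p : ℂ) - 1)) ↔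
        m = mp ∨ m = mm ∨ m = 3 / 2 + β * Complex.I ∨ m = 3 / 2 - β * Complex.I) := by
  refine ⟨fun a b y₁ hy f g hf hg hfg t ht => ?_, fun y₁ => ?_, fun y₀ => ?_, fun y₀ b hb f => ?_,
    fun y₀ m => isEulerMode_iff hp y₀ m, exists_eulerRoots hp⟩
  · have h := congrFun (hf.isJetCurve.eqOn hp hg.isJetCurve hy hfg ht) 0
    simpa [jet] using h
  · obtain ⟨y₀, z, hz⟩ := exists_mem_blowUpFibre hp y₁
    rcases hσ with rfl | rfl
    · obtain ⟨h1, h2⟩ := exists_contDiffOn_of_fibres (fun y₀ => blowUpFibre p 1 y₀ y₁)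
        (fun _ _ _ => blowUpFibre_unique hp) (fun _ _ => exists_contDiffAt_blowUpPoint hp)
      exact ⟨h1, ⟨z, mem_iUnion.2 ⟨y₀, hz⟩⟩, h2⟩
    · obtain ⟨h1, h2⟩ := exists_contDiffOn_of_fibres (fun y₀ => blowUpFibre p (-1) y₀ y₁)
        (fun _ _ _ h h' => blowUpFibre_unique hp (mem_blowUpFibre_neg_iff.1 h)
          (mem_blowUpFibre_neg_iff.1 h'))
        (fun s w hw => by
          obtain ⟨T, hT, hne, hev⟩ :=
            exists_contDiffAt_blowUpPoint hp (mem_blowUpFibre_neg_iff.1 hw)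
          refine ⟨fun x => T (-x), hT.comp w contDiff_neg.contDiffAt, ?_,
            (continuous_neg.tendsto w).eventually hev |>.mono fun x hx =>
              mem_blowUpFibre_neg_iff.2 hx⟩
          intro h0
          have hd := (HasFDerivAt.comp (g := T) w (hT.differentiableAt one_ne_zero).hasFDerivAt
            (hasFDerivAt_id w).neg).fderiv
          refine hne (ContinuousLinearMap.ext fun v => ?_)
          simpa using DFunLike.congr_fun (hd.symm.trans h0) (-v))
      exact ⟨h1, ⟨-z, mem_iUnion.2 ⟨y₀, mem_blowUpFibre_neg_iff.2 (by rwa [neg_neg])⟩⟩, h2⟩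
  · obtain ⟨b, hb, f, hf⟩ := exists_isBlowUpSolution hp y₀
    rcases hσ with rfl | rfl
    · exact ⟨b, hb, f, hf⟩
    · exact ⟨b, hb, -f, isBlowUpSolution_neg_iff.2 (by rwa [neg_neg])⟩
  · rcases hσ with rfl | rfl
    · exact isBlowUpSolution_iff_tendsto_ratio hp hb f
    · rw [isBlowUpSolution_neg_iff, isBlowUpSolution_iff_tendsto_ratio hp hb,
        isProfileSolution_neg_iff]
      refine and_congr_right fun _ => forall₂_congr fun k _ => ?_
      simp only [iteratedDeriv_neg, neg_div]
      rw [← tendsto_neg_iff]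
      simp only [neg_neg]
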